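/- **Setting.** A *snake graph* $\mathcal G_1=(G_1,\dots,G_d)$, $d\ge 1$, is a sequence of unit squares (tiles) in the plane such that each $G_{i+1}$ is the northern or the eastern neighbour of $G_i$; the edge shared by $G_i$ and $G_{i+1}$ is the interior edge $e_i$, and all other edges are boundary edges. $\mathcal G_1[i,j]$ is the snake graph $(G_i,\dots,G_j)$, $\overline{\mathcal G}_1[j,i]$ is the same graph reflected so that the order of the tiles is reversed, and $G^{NE}$, ${}_{SW}G$ denote the pairs of north/east and of south/west edges of a tile (or of the last, respectively first, tile of a snake graph). A *sign function* $f$ assigns $\pm$ to the edges such that on each tile the north and west edges have one sign and the south and east edges have the opposite sign. $\mathcal H\setminus\mathrm{pred}(e_i)$ (resp. $\mathcal H\setminus\mathrm{succ}(e_i)$) is the part of a snake graph $\mathcal H$ formed by the tiles after (resp. before) the interior edge $e_i$; for $e\in\mathcal H^{NE}$ (resp. $e\in{}_{SW}\mathcal H$) it is the single edge $e$. A *band graph* is obtained from a snake graph with at least one tile by identifying an edge $b$ in the SW of the first tile with the edge $b'$ of the same sign in the NE of the last tile, the SW vertex of the first tile being identified with the endpoint of $b'$ other than the NE vertex; its interior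 edges are those of the snake graph and $b=b'$. $\mathrm{Match}$ of a snake graph is its set of perfect matchings. $\mathrm{Match}$ of a band graph is its set of *good* perfect matchings: those $P$ for which there is an interior edge $e$ such that $P\sqcup\{e\}$ is a perfect matching of the snake graph obtained by cutting along $e$ (where one copy of $e$ is added to $P$). Let $\mathcal G_1$ have a self-overlap in the opposite direction: $1\le s\le t$, $s<s'\le t'\le d$, and an isomorphism $i_2 i_1^{-1}:\mathcal G_1[s,t]\to\mathcal G_1[s',t']$ that maps $G_k$ to $G_{s+t'-k}$ and the SW vertex of $G_s$ to the NE vertex of $G_{t'}$, and that is maximal, i.e. does not extend to larger snake subgraphs; write $\mathcal G$ for the overlap and $i_1(\mathcal G)=\mathcal G_1[s,t]$, $i_2(\mathcal G)=\mathcal G_1[s',t']$. Suppose that $\mathcal G_1$ self-crosses in $\mathcal G$: $f(e_t)=f(e_{s'-1})$, and $f(e_{s-1})=-f(e_t)$ if $s>1$, or $f(e_{s'-1})=-f(e_{t'})$ if $t'<d$ (no second condition if $s=1$ and $t'=d$). Suppose $s'>t+1$, so that $\mathcal G_1[t+1,s'-1]$ has at least one tile. The *resolution* is $\mathcal G_{34}+(\mathcal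 G_5\sqcup\mathcal G_6^\circ)$, where * $\mathcal G_{34}=\mathcal G_1[1,t]\cup\overline{\mathcal G}_1[s'-1,t+1]\cup\mathcal G_1[s',d]$; the first two pieces are glued along the boundary edge in $G_t^{NE}$ and $e_{s'-1}$, the last two along $e_t$ and the boundary edge in ${}_{SW}G_{s'}$; * with $\mathcal G_5'=\mathcal G_1[1,s-1]\cup\mathcal G_1[t'+1,d]$, glued along the boundary edges in $G_{s-1}^{NE}$ and ${}_{SW}G_{t'+1}$, and $f_5$ a sign function on $\mathcal G_5'$: $\mathcal G_5=\mathcal G_5'$ if $s\ne1,t'\ne d$; $\mathcal G_5=\mathcal G_5'\setminus\mathrm{pred}(e)$ if $s=1,t'\neq d$, where $e$ is the first edge in $\mathrm{Int}(\mathcal G_5')\cup\mathcal G_5'^{NE}$ with $f_5(e)=f_5(e_{t'})$; $\mathcal G_5=\mathcal G_5'\setminus\mathrm{succ}(e)$ if $s\ne1,t'=d$, where $e$ is the last edge in $\mathrm{Int}(\mathcal G_5')\cup{}_{SW}\mathcal G_5'$ with $f_5(e)=f_5(e_{s-1})$; and $\mathcal G_5=0$, with $\mathrm{Match}\,\mathcal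 G_5=\emptyset$, if $s=1,t'=d$; * $\mathcal G_6^\circ$ is the band graph obtained from $\mathcal G_1[t+1,s'-1]$ by identifying the boundary edge $b$ in ${}_{SW}G_{t+1}$ with the boundary edge $b'$ in $G_{s'-1}^{NE}$. Put $\mathrm{Match}(\mathrm{Res}_{\mathcal G}(\mathcal G_1))=\mathrm{Match}\,\mathcal G_{34}\,\sqcup\,\mathrm{Match}\,\mathcal G_5\times\mathrm{Match}\,\mathcal G_6^\circ$. *Switching.* Order the edges of $\mathcal G$, viewed as $\mathcal G_1[s,t]$, tile by tile, on each tile first the SW edges and then the NE edges (an interior edge counts as a NE edge of the earlier tile). A position is a cut in this order, including the two extreme ones; switching $P_1\in\mathrm{Match}\,\mathcal G_1$ at a position means: keep $P_1$ on all edges outside the two overlaps, use $P_1|_{i_1(\mathcal G)}$ before and $P_1|_{i_2(\mathcal G)}$ after the position on the first copy of $\mathcal G$ in $\mathcal G_{34}$, and vice versa on the second copy. It is a *switching position* if the result is a perfect matching of $\mathcal G_{34}$. Switching of $P_{34}\in\mathrm{Match}\,\mathcal G_{34}$ to $\mathcal G_1$ is defined in the same way. *The map $\varphi$.* If $P_1\in\mathrm{Match}\,\mathcal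 G_1$ has a switching position, $\varphi(P_1)=P_{34}$ is the result of switching at the first one. Otherwise $\varphi(P_1)=(P_5,P_6)$, the restrictions of $P_1$ to $\mathcal G_5$ and $\mathcal G_6^\circ$, where an edge that arises by gluing two edges of $\mathcal G_1$ belongs to the restriction if and only if both of them belong to $P_1$. *The map $\psi$.* $\psi(P_{34})$ is the result of switching $P_{34}$ at its first switching position; $\psi(P_5,P_6)$ is the unique perfect matching of $\mathcal G_1$ whose restrictions to $\mathcal G_5$ and $\mathcal G_6^\circ$ are $P_5$ and $P_6$ and which contains no interior edge of $\mathcal G_1$ outside $\mathcal G_5$ and $\mathcal G_6^\circ$. **Theorem.** $\varphi$ is a well-defined bijection $\mathrm{Match}\,\mathcal G_1\to\mathrm{Match}(\mathrm{Res}_{\mathcal G}(\mathcal G_1))$; in particular $P_6$ is a good matching of $\mathcal G_6^\circ$ whenever $P_1$ has no switching position. The map $\psi$ is well defined on $\mathrm{Match}(\mathrm{Res}_{\mathcal G}(\mathcal G_1))$ (every $P_{34}$ has a switching position, and the completion of every pair $(P_5,P_6)$ exists and is unique), and it is the inverse of $\varphi$. -/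

import Mathlib

open scoped Graph

namespace Snake

/-! ### Tiles -/

/-- The four sides of a tile (a unit square in the plane). -/
inductive Side
  | south | east | north | west

/-- The four corners of a tile. -/
inductive Corner
  | sw | se | ne | nw

/-- The corner among SW, NE that lies on the side. -/
def Side.tip : Side → Corner
  | .south => .sw
  | .west => .sw
  | .north => .ne
  | .east => .ne

/-- The corner among SE, NW that lies on the side. Thus the two endpoints of a side `a`
are `a.tip` and `a.other`. -/
def Side.other : Side → Corner
  | .south => .se
  | .west => .nw
  | .north => .nw
  | .east => .se

/-- A side of the tile with index `x.1`. -/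
abbrev TileSide := ℕ × Side

/-- A corner of the tile with index `c.1`. -/
abbrev TileCorner := ℕ × Corner

def tipCorner (x : TileSide) : TileCorner := (x.1, x.2.tip)

def otherCorner (x : TileSide) : TileCorner := (x.1, x.2.other)

/-! ### Gluing tiles along sides

A gluing is a set of pairs of tile sides. The two sides of a pair are identified *crosswise*: the
corner SW or NE of each of them is identified with the corner SE or NW of the other one. For
instance, if `G_{i+1}` is north of `G_i`, then the north side of `G_i` is the south side of
`G_{i+1}`: the NE corner of `G_i` is the SE corner of `G_{i+1}`, and the NW corner of `G_i` is the
SW corner of `G_{i+1}`. This is also the identification that defines a band graph (the SW vertex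
of the first tile is glued to the endpoint of `b'` that is not NE), and it is the
one that results when a piece of a snake graph is reflected, so that the order of its tiles
is reversed and the SW and NE corners of each tile change their roles. -/

abbrev Gluing := Set (TileSide × TileSide)

/-- Elementary identifications of corners. -/
inductive CornerGlued (Γ : Gluing) : TileCorner → TileCorner → Prop
  | tip_other {x y : TileSide} (h : (x, y) ∈ Γ) : CornerGlued Γ (tipCorner x) (otherCorner y)
  | other_tip {x y : TileSide} (h : (x, y) ∈ Γ) : CornerGlued Γ (otherCorner x) (tipCorner y)

/-- Corners up to the equivalence relation generated by the gluing. -/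
def Vertex (Γ : Gluing) : Type := Quot (CornerGlued Γ)

/-- Sides up to the equivalence relation generated by the gluing. -/
def Edge (Γ : Gluing) : Type := Quot (fun x y : TileSide => (x, y) ∈ Γ)

def vertex (Γ : Gluing) (c : TileCorner) : Vertex Γ := Quot.mk _ c

def edge (Γ : Gluing) (x : TileSide) : Edge Γ := Quot.mk _ x

/-- The two endpoints of an edge of the glued graph. -/
def ends (Γ : Gluing) : Edge Γ → Sym2 (Vertex Γ) :=
  Quot.lift (fun x => s(vertex Γ (tipCorner x), vertex Γ (otherCorner x))) (by
    intro x y h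
    have h1 : vertex Γ (tipCorner x) = vertex Γ (otherCorner y) :=
      Quot.sound (CornerGlued.tip_other h)
    have h2 : vertex Γ (otherCorner x) = vertex Γ (tipCorner y) :=
      Quot.sound (CornerGlued.other_tip h)
    show s(_, _) = s(_, _)
    rw [h1, h2]
    exact Sym2.eq_swap)

/-- The (multi)graph that consists of the sides in `F`, with their endpoints, where sides and
corners are identified by the gluing `Γ`. -/
def sideGraph (Γ : Gluing) (F : Set TileSide) : Graph (Vertex Γ) (Edge Γ) where
  vertexSet := {v | ∃ x ∈ F, v ∈ ends Γ (edge Γ x)}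
  IsLink e v w := (∃ x ∈ F, edge Γ x = e) ∧ ends Γ e = s(v, w)
  isLink_symm := fun _ _ => ⟨fun _ _ h => ⟨h.1, h.2.trans Sym2.eq_swap⟩⟩
  eq_or_eq_of_isLink_of_isLink := by
    rintro e x y v w ⟨_, h⟩ ⟨_, h'⟩
    rcases Sym2.eq_iff.1 (h.symm.trans h') with h | h
    · exact Or.inl h.1
    · exact Or.inr h.1
  left_mem_of_isLink := by
    rintro e v w ⟨⟨x, hx, rfl⟩, h⟩
    exact ⟨x, hx, by rw [h]; exact Sym2.mem_mk_left v w⟩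

/-- All sides of the tiles with index in `T`. -/
def sidesOf (T : Set ℕ) : Set TileSide := {x | x.1 ∈ T}

/-! ### Perfect matchings -/

/-- A set `P` of edges such that each vertex is incident to exactly one edge in `P`. -/
def IsPerfectMatching {α β : Type*} (G : Graph α β) (P : Set β) : Prop :=
  P ⊆ E(G) ∧ ∀ v ∈ V(G), ∃! e, e ∈ P ∧ G.Inc e v

/-- Good perfect matchings of the band graph with tiles in `T` and gluing `Γ` (whose interior
edges are the glued edges, that is, the elements `(a, b)` of `Γ`): perfect matchings `P` such that,
for some interior edge `(a, b)`, adding to `P` one copy of it gives a perfect matching `Q` of the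
snake graph that is obtained by cutting along that edge. In the cut graph the edge has
two copies, `a` and `b`; here `x` is the copy that is added. -/
def IsGoodMatching (Γ : Gluing) (T : Set ℕ) (P : Set (Edge Γ)) : Prop :=
  IsPerfectMatching (sideGraph Γ (sidesOf T)) P ∧
  ∃ a b : TileSide, (a, b) ∈ Γ ∧
    ∃ Q : Set (Edge (Γ \ {(a, b)})),
      IsPerfectMatching (sideGraph (Γ \ {(a, b)}) (sidesOf T)) Q ∧
      ∃ x : TileSide, (x = a ∨ x = b) ∧ edge (Γ \ {(a, b)}) x ∈ Q ∧
        P = {e | ∃ y : TileSide, edge (Γ \ {(a, b)}) y ∈ Q ∧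
          edge (Γ \ {(a, b)}) y ≠ edge (Γ \ {(a, b)}) x ∧ edge Γ y = e}

/-! ### Snake graphs -/

/-- A snake graph `(G_1, …, G_d)` with `d ≥ 1` tiles. For `1 ≤ i < d` the tile `G_{i+1}` is the
northern neighbour of `G_i` if `north i` is true, and its eastern neighbour otherwise; the other
values of `north` are irrelevant. -/
structure SnakeGraph where
  d : ℕ
  one_le_d : 1 ≤ d
  north : ℕ → Bool

namespace SnakeGraph

variable (G : SnakeGraph)

/-- The side of `G_i` that is shared with `G_{i+1}`, for `1 ≤ i < d`. -/
def exit (i : ℕ) : Side := if G.north i then .north else .east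

/-- The side of `G_i` that is shared with `G_{i-1}`, for `1 < i ≤ d`. -/
def entry (i : ℕ) : Side := if G.north (i - 1) then .south else .west

/-- The boundary edge among the north and east sides of `G_i`, for `1 ≤ i < d`. -/
def exitBdry (i : ℕ) : Side := if G.north i then .east else .north

/-- The boundary edge among the south and west sides of `G_i`, for `1 < i ≤ d`. -/
def entryBdry (i : ℕ) : Side := if G.north (i - 1) then .west else .south

/-- The interior edge `e_i`, shared by `G_i` and `G_{i+1}`, as a side of `G_i`. -/
def inner (i : ℕ) : TileSide := (i, G.exit i)

/-- The pair of sides that become the interior edge `e_i`. -/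
def glue (i : ℕ) : TileSide × TileSide := (G.inner i, (i + 1, G.entry (i + 1)))

/-- The gluing of the tiles of the snake graph. -/
def gluing : Gluing := {g | ∃ i, 1 ≤ i ∧ i < G.d ∧ g = G.glue i}

/-- The indices of the tiles. -/
def tiles : Set ℕ := Set.Icc 1 G.d

/-- The snake graph as a graph. -/
def graph : Graph (Vertex G.gluing) (Edge G.gluing) := sideGraph G.gluing (sidesOf G.tiles)

/-- The set of perfect matchings of the snake graph. -/
def Match : Set (Set (Edge G.gluing)) := {P | IsPerfectMatching G.graph P}

/-- A sign function: on each tile the north and west edges have the same sign, the south and east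
edges have the same sign, and the signs of the north and south edges are opposite. -/
def IsSignFunction (f : Edge G.gluing → ℤˣ) : Prop :=
  ∀ i ∈ G.tiles,
    f (edge G.gluing (i, .north)) = f (edge G.gluing (i, .west)) ∧
    f (edge G.gluing (i, .south)) = f (edge G.gluing (i, .east)) ∧
    f (edge G.gluing (i, .north)) = -f (edge G.gluing (i, .south))

/-- The sign `f(e_i)` of an interior edge. -/
def innerSign (f : Edge G.gluing → ℤˣ) (i : ℕ) : ℤˣ := f (edge G.gluing (G.inner i))

end SnakeGraph

/-! ### Self-overlaps in the opposite direction -/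

/-- The two symmetries of a square that interchange the corners SW and NE. -/
inductive Flip
  | rotation | reflection

/-- Action on the corners. -/
def Flip.corner : Flip → Corner → Corner
  | _, .sw => .ne
  | _, .ne => .sw
  | .rotation, .se => .nw
  | .rotation, .nw => .se
  | .reflection, .se => .se
  | .reflection, .nw => .nw

/-- Action on the sides. -/
def Flip.side : Flip → Side → Side
  | .rotation, .south => .north
  | .rotation, .north => .south
  | .rotation, .east => .west
  | .rotation, .west => .east
  | .reflection, .south => .east
  | .reflection, .east => .south
  | .reflection, .north => .west
  | .reflection, .west => .north

theorem Flip.tip_side (σ : Flip) (a : Side) : (σ.side a).tip = σ.corner a.tip := by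
  cases σ <;> cases a <;> rfl

theorem Flip.other_side (σ : Flip) (a : Side) : (σ.side a).other = σ.corner a.other := by
  cases σ <;> cases a <;> rfl

namespace SnakeGraph

variable (G : SnakeGraph)

/-- The map that sends the tile `G_k` to the tile `G_{s+t'-k}` by the square symmetry `σ` is an
isomorphism from the snake graph `G[s,t]` onto the snake graph `G[s',t']`: it maps the edge shared
by `G_k` and `G_{k+1}` to the edge shared by their images. These are the isomorphisms that
map the SW vertex of `G_s` to the NE vertex of `G_{t'}`. -/
def IsOppositeIso (σ : Flip) (s t s' t' : ℕ) : Prop :=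
  1 ≤ s ∧ s ≤ t ∧ t ≤ G.d ∧ 1 ≤ s' ∧ s' ≤ t' ∧ t' ≤ G.d ∧ s + t' = t + s' ∧
  ∀ k, s ≤ k → k < t →
    σ.side (G.exit k) = G.entry (s + t' - k) ∧
    σ.side (G.entry (k + 1)) = G.exit (s + t' - (k + 1))

/-- A self-overlap `G[s,t] ≅ G[s',t']` in the opposite direction, with `s < s'`, whose embeddings
`i₁`, `i₂` are such that `i₂ ∘ i₁⁻¹` maps `G_k` to `G_{s+t'-k}` by `σ`. The overlap is
maximal: this isomorphism extends to no larger pair of snake subgraphs. -/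
structure OppositeOverlap where
  σ : Flip
  s : ℕ
  t : ℕ
  s' : ℕ
  t' : ℕ
  lt : s < s'
  iso : G.IsOppositeIso σ s t s' t'
  maximal : ∀ a b a' b' : ℕ, a ≤ s → t ≤ b → a' ≤ s' → t' ≤ b' → a + b' = s + t' →
    G.IsOppositeIso σ a b a' b' → a = s ∧ b = t ∧ a' = s' ∧ b' = t'

namespace OppositeOverlap

variable {G} (o : G.OppositeOverlap) (f : Edge G.gluing → ℤˣ)

/-- `G` has a self-crossing in the overlap: (i) `f(e_{s-1}) = -f(e_t)` if `s > 1`, or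
`f(e_{s'-1}) = -f(e_{t'})` if `t' < d`, there being no condition if `s = 1` and `t' = d`;
and (ii) `f(e_t) = f(e_{s'-1})`. -/
def SelfCrosses : Prop :=
  ((1 < o.s ∧ G.innerSign f (o.s - 1) = -G.innerSign f o.t) ∨
    (o.t' < G.d ∧ G.innerSign f (o.s' - 1) = -G.innerSign f o.t') ∨
    (o.s = 1 ∧ o.t' = G.d)) ∧
  G.innerSign f o.t = G.innerSign f (o.s' - 1)

/-! ### The resolution -/

/-- The gluing of `G₃₄ = G[1,t] ∪ Ḡ[s'-1,t+1] ∪ G[s',d]`: the first two pieces are glued along the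
boundary edge in the NE of `G_t` and the edge `e_{s'-1}` of `G_{s'-1}`, the last two along the edge
`e_t` of `G_{t+1}` and the boundary edge in the SW of `G_{s'}`. -/
def gluing34 : Gluing :=
  {g | ∃ i, 1 ≤ i ∧ i < G.d ∧ i ≠ o.t ∧ i ≠ o.s' - 1 ∧ g = G.glue i} ∪
  {((o.t, G.exitBdry o.t), (o.s' - 1, G.exit (o.s' - 1))),
    ((o.t + 1, G.entry (o.t + 1)), (o.s', G.entryBdry o.s'))}

def graph34 : Graph (Vertex o.gluing34) (Edge o.gluing34) := sideGraph o.gluing34 (sidesOf G.tiles)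

def Match34 : Set (Set (Edge o.gluing34)) := {P | IsPerfectMatching o.graph34 P}

/-- The gluing of `G₅' = G[1,s-1] ∪ G[t'+1,d]`: the two pieces, if both are non-empty, are glued
along the boundary edge in the NE of `G_{s-1}` and the boundary edge in the SW of `G_{t'+1}`. -/
def gluing5 : Gluing :=
  {g | ∃ i, 1 ≤ i ∧ i < G.d ∧ (i + 1 < o.s ∨ o.t' < i) ∧ g = G.glue i} ∪
  {g | 1 < o.s ∧ o.t' < G.d ∧
    g = ((o.s - 1, G.exitBdry (o.s - 1)), (o.t' + 1, G.entryBdry (o.t' + 1)))}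

end OppositeOverlap

variable {G} in
/-- The sides of `G[p,q] \ pred(e)`, where `e` is the first edge of sign `ε` among the interior
edges of `G[p,q]` followed by the north and east edges of `G_q`: if `e = e_i`, all sides of the
tiles `G_{i+1}, …, G_q`; if `e` is not interior, just `e`. -/
def sidesAfterFirst (f : Edge G.gluing → ℤˣ) (p q : ℕ) (ε : ℤˣ) : Set TileSide :=
  {x | ∃ i, IsLeast {j | p ≤ j ∧ j < q ∧ G.innerSign f j = ε} i ∧ i + 1 ≤ x.1 ∧ x.1 ≤ q} ∪
  {x | (∀ j, p ≤ j → j < q → G.innerSign f j ≠ ε) ∧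
    x.1 = q ∧ (x.2 = .north ∨ x.2 = .east) ∧ f (edge G.gluing x) = ε}

variable {G} in
/-- The sides of `G[p,q] \ succ(e)`, where `e` is the last edge of sign `ε` among the south and
west edges of `G_p` followed by the interior edges of `G[p,q]`: if `e = e_i`, all sides of the
tiles `G_p, …, G_i`; if `e` is not interior, just `e`. -/
def sidesBeforeLast (f : Edge G.gluing → ℤˣ) (p q : ℕ) (ε : ℤˣ) : Set TileSide :=
  {x | ∃ i, IsGreatest {j | p ≤ j ∧ j < q ∧ G.innerSign f j = ε} i ∧ p ≤ x.1 ∧ x.1 ≤ i} ∪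
  {x | (∀ j, p ≤ j → j < q → G.innerSign f j ≠ ε) ∧
    x.1 = p ∧ (x.2 = .south ∨ x.2 = .west) ∧ f (edge G.gluing x) = ε}

namespace OppositeOverlap

variable {G} (o : G.OppositeOverlap) (f : Edge G.gluing → ℤˣ)

open Classical in
/-- The sides of `G₅`: all of `G₅'` if `s ≠ 1` and `t' ≠ d`; `G₅' \ pred(e)` with `e` the first edge
such that `f(e) = f(e_{t'})` if `s = 1` and `t' ≠ d`; `G₅' \ succ(e)` with `e` the last edge such that
`f(e) = f(e_{s-1})` if `s ≠ 1` and `t' = d`. In the last two cases `G₅'` is a piece of `G`,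
and the sign function on it is the restriction of `f`. -/
noncomputable def sides5 : Set TileSide :=
  if o.s ≠ 1 ∧ o.t' ≠ G.d then sidesOf (Set.Icc 1 (o.s - 1) ∪ Set.Icc (o.t' + 1) G.d)
  else if o.s = 1 ∧ o.t' ≠ G.d then
    sidesAfterFirst f (o.t' + 1) G.d (G.innerSign f o.t')
  else if o.s ≠ 1 ∧ o.t' = G.d then
    sidesBeforeLast f 1 (o.s - 1) (G.innerSign f (o.s - 1))
  else ∅

noncomputable def graph5 : Graph (Vertex o.gluing5) (Edge o.gluing5) :=
  sideGraph o.gluing5 (o.sides5 f)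

/-- The perfect matchings of `G₅`; there are none if `s = 1` and `t' = d`, where `G₅ = 0`. -/
def Match5 : Set (Set (Edge o.gluing5)) :=
  {P | ¬(o.s = 1 ∧ o.t' = G.d) ∧ IsPerfectMatching (o.graph5 f) P}

/-- The tiles `G_{t+1}, …, G_{s'-1}` of the band graph `G₆°`. -/
def tiles6 : Set ℕ := Set.Icc (o.t + 1) (o.s' - 1)

/-- The gluing of the band graph `G₆°`, obtained from `G[t+1,s'-1]` by identifying the boundary
edge `b` in the SW of `G_{t+1}` with the boundary edge `b'` in the NE of `G_{s'-1}`. -/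
def gluing6 : Gluing :=
  {g | ∃ i, o.t < i ∧ i + 1 < o.s' ∧ g = G.glue i} ∪
  {((o.s' - 1, G.exitBdry (o.s' - 1)), (o.t + 1, G.entryBdry (o.t + 1)))}

/-- The good perfect matchings of `G₆°`. -/
def Match6 : Set (Set (Edge o.gluing6)) := {P | IsGoodMatching o.gluing6 o.tiles6 P}

/-- The matchings of the resolution `G₃₄ + (G₅ ⊔ G₆°)`. -/
def MatchRes : Set (Set (Edge o.gluing34) ⊕ (Set (Edge o.gluing5) × Set (Edge o.gluing6))) :=
  Sum.inl '' o.Match34 ∪ Sum.inr '' (o.Match5 f ×ˢ o.Match6)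

/-! ### Switching -/

/-- The isomorphism `i₂ ∘ i₁⁻¹`, and its inverse, on sides. -/
def flip (x : TileSide) : TileSide := (o.s + o.t' - x.1, o.σ.side x.2)

/-- Position, in the first copy `G[s,t]` of the overlap, of a side. The edges are ordered along the
overlap: the south and west edges of `G_s`, the north and east edges of `G_s`, the remaining edge
among the south and west edges of `G_{s+1}`, the north and east edges of `G_{s+1}`, etc. -/
noncomputable def rank (x : TileSide) : ℕ :=
  open Classical in
  if o.s < x.1 ∧ x.2 = G.entry x.1 then 2 * (x.1 - 1)
  else if x.2 = .south ∨ x.2 = .west then 2 * x.1 - 1 else 2 * x.1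

/-- Switching at position `p` a set `P` of edges of the graph with gluing `Γ` into a set of
edges of the graph with gluing `Δ`. Both graphs have the tiles of `G`, and they contain the
overlap as `G[s,t]` and as `G[s',t']`. On the first copy of the overlap we use the restriction of
`P` to the first copy up to the position `p` and its restriction to the second copy after
it; on the second copy it is the other way round; away from the overlaps nothing changes. -/
def switch (Γ Δ : Gluing) (p : ℕ) (P : Set (Edge Γ)) : Set (Edge Δ) :=
  {e | ∃ x : TileSide, x.1 ∈ G.tiles ∧ edge Δ x = e ∧
    ((x.1 ∈ Set.Icc o.s o.t ∧
        ((o.rank x ≤ p ∧ edge Γ x ∈ P) ∨ (p < o.rank x ∧ edge Γ (o.flip x) ∈ P))) ∨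
      (x.1 ∈ Set.Icc o.s' o.t' ∧
        ((o.rank (o.flip x) ≤ p ∧ edge Γ x ∈ P) ∨
          (p < o.rank (o.flip x) ∧ edge Γ (o.flip x) ∈ P))) ∨
      ((∀ y : TileSide, y.1 ∈ Set.Icc o.s o.t ∪ Set.Icc o.s' o.t' → edge Δ y ≠ edge Δ x) ∧
        edge Γ x ∈ P))}

/-- The switching positions: the positions, from the beginning of the overlap to its end, where
switching gives a perfect matching of the other graph. -/
def switchPositions (Γ Δ : Gluing) (P : Set (Edge Γ)) : Set ℕ :=
  {p | 2 * o.s - 2 ≤ p ∧ p ≤ 2 * o.t ∧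
    IsPerfectMatching (sideGraph Δ (sidesOf G.tiles)) (o.switch Γ Δ p P)}

/-! ### The maps `φ` and `ψ` -/

/-- Restriction of a set `P` of edges of `G` to the graph with sides `F` and gluing `Γ`. An edge
that comes from two edges of `G` by gluing is in the restriction if both of them are in `P`. -/
def restrict (Γ : Gluing) (F : Set TileSide) (P : Set (Edge G.gluing)) : Set (Edge Γ) :=
  {e | (∃ x ∈ F, edge Γ x = e) ∧ ∀ x ∈ F, edge Γ x = e → edge G.gluing x ∈ P}

noncomputable def restrict5 (P : Set (Edge G.gluing)) : Set (Edge o.gluing5) :=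
  restrict o.gluing5 (o.sides5 f) P

def restrict6 (P : Set (Edge G.gluing)) : Set (Edge o.gluing6) :=
  restrict o.gluing6 (sidesOf o.tiles6) P

open Classical in
/-- `φ` switches a matching at its first switching position if there is one, and otherwise it
takes the restrictions to `G₅` and `G₆°`. -/
noncomputable def phi (P : Set (Edge G.gluing)) :
    Set (Edge o.gluing34) ⊕ (Set (Edge o.gluing5) × Set (Edge o.gluing6)) :=
  if (o.switchPositions G.gluing o.gluing34 P).Nonempty then
    Sum.inl (o.switch G.gluing o.gluing34 (sInf (o.switchPositions G.gluing o.gluing34 P)) P)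
  else Sum.inr (o.restrict5 f P, o.restrict6 P)

/-- `P` is a matching of `G` whose restriction to `G₅ ⊔ G₆°` is `(P₅, P₆)` and whose restriction to
the complement of `G₅` and `G₆°` consists of boundary edges of `G` only. -/
def IsCompletion (P₅ : Set (Edge o.gluing5)) (P₆ : Set (Edge o.gluing6))
    (P : Set (Edge G.gluing)) : Prop :=
  P ∈ G.Match ∧ o.restrict5 f P = P₅ ∧ o.restrict6 P = P₆ ∧
  ∀ e ∈ P, (∀ x ∈ o.sides5 f ∪ sidesOf o.tiles6, edge G.gluing x ≠ e) →
    ∀ i, 1 ≤ i → i < G.d → e ≠ edge G.gluing (G.inner i)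

open Classical in
/-- `ψ` switches a matching of `G₃₄` at its first switching position, and maps a pair `(P₅, P₆)` to
its completion. (The default value `∅` is for sets that are not matchings of the
resolution.) -/
noncomputable def psi :
    Set (Edge o.gluing34) ⊕ (Set (Edge o.gluing5) × Set (Edge o.gluing6)) →
      Set (Edge G.gluing)
  | Sum.inl P => o.switch o.gluing34 G.gluing (sInf (o.switchPositions o.gluing34 G.gluing P)) P
  | Sum.inr (P₅, P₆) => if h : ∃ P, o.IsCompletion f P₅ P₆ P then h.choose else ∅

end OppositeOverlap

end SnakeGraph

end Snake

/-!
A perfect matching of a glued graph is encoded by a choice of one of the two perfect matchings of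
the square on each tile: on every tile either both horizontal or both vertical sides are
*selected*, at least one of any two glued sides is selected, and an edge belongs to the matching if
and only if all sides that represent it are selected. This works for all snake graphs, since the
two edges at the SW corner of the first tile determine the first choice, and every choice
determines the next one (`Tame.isPerfectMatching_matchingOf`, `Tame.exists_of_isPerfectMatching`,
`Arcs.isPerfectMatching_iff`). For the band graph the matchings of this form are exactly the good ones
(`isGoodMatching_iff`), and this is what makes the restriction `P₆` good.

In this encoding `G` and `G₃₄` differ in one respect only: the two copies of the overlap exchange the
ends of the middle piece to which they are glued (`OppositeOverlap.Strands`). Switching at a position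
exchanges the choices on the two copies from some tile on (`OppositeOverlap.swap`), and it succeeds
if and only if the two copies agree on the tile that is cut or that begins there, or, at the extreme
positions, if the tiles next to the overlaps select the sides along which they are glued
(`GoodPos`, `Strands.switchPositions_eq`). That condition is not changed by switching, so switching at
the first such position is an involution between the matchings of `G` and of `G₃₄` that have
switching positions (`Strands.switch_first`).

The remaining cases are settled by signs. The sign of a choice on a tile (`state`) is the sign of the
selected sides at the SW corner, the opposite of that of the selected sides at the NE corner; the
two copies of the overlap carry opposite signs, so that they agree on a tile if and only if the signs
of their choices there are equal. If they agree nowhere, then the constraints along the two copies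
together force the sign to be constant on each of them (`state_eq_of_not_agree`). In `G₃₄` the crossing
condition then makes the outer end of the overlap a switching position (`exists_goodPos34`). In `G`
the signs on the overlaps are forced, and they propagate outwards as long as the interior edges do not
have the sign at which `G₅` begins (`isSplit_of_forall_not_goodPos`). What is left free are the choices
on the tiles of `G₅` and of the band graph; the impossibility of switching at the two extreme positions
is the constraint for the newly glued edge of `G₅` and of the band graph. Conversely, every pair of
matchings is completed in this way only (`IsSplit.isCompletion`, `IsSplit.eq_of_isCompletion`).
-/

namespace Snake

/-! ### Sides and corners of a tile -/

/-- The sides of a square split into its two perfect matchings: the horizontal sides (south and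
north) and the vertical ones. -/
def Side.horizontal : Side → Bool
  | .south => true
  | .north => true
  | .east => false
  | .west => false

/-- The second side at the SW or NE corner of a given side. -/
def Side.tipMate : Side → Side
  | .south => .west
  | .west => .south
  | .north => .east
  | .east => .north

/-- The second side at the SE or NW corner of a given side. -/
def Side.otherMate : Side → Side
  | .south => .east
  | .east => .south
  | .north => .west
  | .west => .north

/-- The second side of the same tile at its SW or NE corner that lies on `x`. -/
def tipMate (x : TileSide) : TileSide := (x.1, x.2.tipMate)

/-- The second side of the same tile at its SE or NW corner that lies on `x`. -/
def otherMate (x : TileSide) : TileSide := (x.1, x.2.otherMate)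

/-- The side `x` belongs to the perfect matching of its tile that is recorded by `h`, where `h k`
tells whether the tile with index `k` is matched by its horizontal or by its vertical sides. -/
def Sel (h : ℕ → Bool) (x : TileSide) : Prop := x.2.horizontal = h x.1

@[simp] theorem tipMate_fst (x : TileSide) : (tipMate x).1 = x.1 := rfl

@[simp] theorem otherMate_fst (x : TileSide) : (otherMate x).1 = x.1 := rfl

@[simp] theorem tipMate_tipMate (x : TileSide) : tipMate (tipMate x) = x := by
  rcases x with ⟨k, a⟩; cases a <;> rfl

@[simp] theorem tipCorner_tipMate (x : TileSide) : tipCorner (tipMate x) = tipCorner x := by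
  rcases x with ⟨k, a⟩; cases a <;> rfl

@[simp] theorem otherCorner_otherMate (x : TileSide) :
    otherCorner (otherMate x) = otherCorner x := by
  rcases x with ⟨k, a⟩; cases a <;> rfl

theorem tipMate_ne (x : TileSide) : tipMate x ≠ x := by
  rcases x with ⟨k, a⟩; cases a <;> simp [tipMate, Side.tipMate]

theorem otherMate_ne (x : TileSide) : otherMate x ≠ x := by
  rcases x with ⟨k, a⟩; cases a <;> simp [otherMate, Side.otherMate]

theorem tipCorner_eq_iff {x y : TileSide} :
    tipCorner x = tipCorner y ↔ x = y ∨ x = tipMate y := by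
  rcases x with ⟨k, a⟩; rcases y with ⟨l, b⟩
  cases a <;> cases b <;> simp [tipCorner, tipMate, Side.tip, Side.tipMate]

theorem otherCorner_eq_iff {x y : TileSide} :
    otherCorner x = otherCorner y ↔ x = y ∨ x = otherMate y := by
  rcases x with ⟨k, a⟩; rcases y with ⟨l, b⟩
  cases a <;> cases b <;> simp [otherCorner, otherMate, Side.other, Side.otherMate]

theorem tipCorner_ne_otherCorner (x y : TileSide) : tipCorner x ≠ otherCorner y := by
  rcases x with ⟨k, a⟩; rcases y with ⟨l, b⟩
  cases a <;> cases b <;> simp [tipCorner, otherCorner, Side.tip, Side.other]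

theorem sel_tipMate {h : ℕ → Bool} {x : TileSide} : Sel h (tipMate x) ↔ ¬ Sel h x := by
  rcases x with ⟨k, a⟩
  cases a <;> cases hk : h k <;> simp [Sel, tipMate, Side.tipMate, Side.horizontal, hk]

theorem sel_otherMate {h : ℕ → Bool} {x : TileSide} : Sel h (otherMate x) ↔ ¬ Sel h x := by
  rcases x with ⟨k, a⟩
  cases a <;> cases hk : h k <;> simp [Sel, otherMate, Side.otherMate, Side.horizontal, hk]

theorem sel_congr {h h' : ℕ → Bool} {x : TileSide} (e : h x.1 = h' x.1) : Sel h x ↔ Sel h' x := by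
  simp [Sel, e]

theorem eq_of_sel_iff {h h' : ℕ → Bool} {x : TileSide} (e : Sel h x ↔ Sel h' x) :
    h x.1 = h' x.1 := by
  unfold Sel at e
  by_contra hne
  rcases hx : x.2.horizontal <;> rcases h1 : h x.1 <;> rcases h2 : h' x.1 <;> simp_all

/-! ### Vertices and edges of a glued graph -/

/-- Two sides are glued to each other, in either order. -/
def Glued (Γ : Gluing) (x y : TileSide) : Prop := (x, y) ∈ Γ ∨ (y, x) ∈ Γ

theorem Glued.symm {Γ : Gluing} {x y : TileSide} (h : Glued Γ x y) : Glued Γ y x := Or.symm h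

/-- A gluing of tiles in which each side is glued to at most one other side, and at most one side
at each SW or NE corner is glued. Then a vertex of the glued graph consists of at most three
corners: at most one SE or NW corner, and the SW or NE corners that are glued to it. -/
structure Tame (Γ : Gluing) : Prop where
  unique : ∀ {x y y' : TileSide}, Glued Γ x y → Glued Γ x y' → y = y'
  tip_eq : ∀ {x y x' y' : TileSide}, Glued Γ x y → Glued Γ x' y' → tipCorner x = tipCorner x' →
    x = x'
  irrefl : ∀ x : TileSide, ¬ Glued Γ x x

theorem vertex_eq_of_glued {Γ : Gluing} {x y : TileSide} (h : Glued Γ x y) :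
    vertex Γ (tipCorner x) = vertex Γ (otherCorner y) := by
  rcases h with h | h
  · exact Quot.sound (CornerGlued.tip_other h)
  · exact (Quot.sound (CornerGlued.other_tip h)).symm

theorem edge_eq_of_glued {Γ : Gluing} {x y : TileSide} (h : Glued Γ x y) :
    edge Γ x = edge Γ y := by
  rcases h with h | h
  · exact Quot.sound h
  · exact (Quot.sound h).symm

theorem mem_ends {Γ : Gluing} {x : TileSide} {v : Vertex Γ} :
    v ∈ ends Γ (edge Γ x) ↔ v = vertex Γ (tipCorner x) ∨ v = vertex Γ (otherCorner x) :=
  Sym2.mem_iff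

theorem isPerfectMatching_sideGraph {Γ : Gluing} {F : Set TileSide} {P : Set (Edge Γ)} :
    IsPerfectMatching (sideGraph Γ F) P ↔ P ⊆ edge Γ '' F ∧
      ∀ x ∈ F, ∀ v ∈ ends Γ (edge Γ x), ∃! e, e ∈ P ∧ v ∈ ends Γ e := by
  have hE : E(sideGraph Γ F) = edge Γ '' F := by
    ext e
    rw [Graph.edge_mem_iff_exists_isLink]
    constructor
    · rintro ⟨v, w, h, -⟩
      exact h
    · rintro ⟨x, hx, rfl⟩
      exact ⟨_, _, ⟨x, hx, rfl⟩, rfl⟩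
  have hI : ∀ e v, (sideGraph Γ F).Inc e v ↔ e ∈ edge Γ '' F ∧ v ∈ ends Γ e := by
    intro e v
    constructor
    · rintro ⟨w, h, h'⟩
      exact ⟨h, h' ▸ Sym2.mem_mk_left v w⟩
    · rintro ⟨h, h'⟩
      obtain ⟨w, hw⟩ := Sym2.mem_iff_exists.1 h'
      exact ⟨w, h, hw⟩
  unfold IsPerfectMatching
  rw [hE]
  refine and_congr_right fun hP => ?_
  have hc : ∀ v, (∃! e, e ∈ P ∧ (sideGraph Γ F).Inc e v) ↔ ∃! e, e ∈ P ∧ v ∈ ends Γ e := by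
    intro v
    refine existsUnique_congr fun e => and_congr_right fun he => ?_
    rw [hI]
    exact and_iff_right (hP he)
  simp_rw [hc]
  constructor
  · intro h x hx v hv
    exact h v ⟨x, hx, hv⟩
  · rintro h v ⟨x, hx, hv⟩
    exact h x hx v hv

namespace Tame

variable {Γ : Gluing} (hΓ : Tame Γ)
include hΓ

theorem edge_eq_iff {x y : TileSide} : edge Γ x = edge Γ y ↔ x = y ∨ Glued Γ x y := by
  refine ⟨fun h => ?_, ?_⟩
  · have hrel : Relation.EqvGen (fun x y : TileSide => (x, y) ∈ Γ) x y := Quot.eqvGen_exact h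
    clear h
    induction hrel with
    | rel x y h => exact Or.inr (Or.inl h)
    | refl x => exact Or.inl rfl
    | symm x y _ ih => exact ih.imp Eq.symm Glued.symm
    | trans x y z _ _ ih ih' =>
      rcases ih with rfl | ih
      · exact ih'
      · rcases ih' with rfl | ih'
        · exact Or.inr ih
        · exact Or.inl (hΓ.unique ih.symm ih')
  · rintro (rfl | h)
    · rfl
    · exact edge_eq_of_glued h

open Classical in
omit hΓ in
/-- A representative of each vertex: the SE or NW corner in it, if there is one. -/
noncomputable def root (Γ : Gluing) (c : TileCorner) : TileCorner :=
  if h : ∃ y : TileSide, ∃ x, Glued Γ x y ∧ tipCorner x = c then otherCorner h.choose else c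

theorem root_tip {x y : TileSide} (h : Glued Γ x y) : root Γ (tipCorner x) = otherCorner y := by
  have hex : ∃ y' : TileSide, ∃ x', Glued Γ x' y' ∧ tipCorner x' = tipCorner x := ⟨y, x, h, rfl⟩
  unfold root
  rw [dif_pos hex]
  obtain ⟨x', h', e⟩ := hex.choose_spec
  rw [hΓ.tip_eq h' h e] at h'
  rw [hΓ.unique h' h]

omit hΓ in
theorem root_other (x : TileSide) : root Γ (otherCorner x) = otherCorner x := by
  unfold root
  refine dif_neg ?_
  rintro ⟨y, x', -, h⟩
  exact tipCorner_ne_otherCorner _ _ h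

omit hΓ in
theorem root_eq_self_or (c : TileCorner) :
    root Γ c = c ∨ ∃ x y, Glued Γ x y ∧ tipCorner x = c ∧ root Γ c = otherCorner y := by
  unfold root
  split_ifs with h
  · obtain ⟨x, hx, e⟩ := h.choose_spec
    exact Or.inr ⟨x, _, hx, e, rfl⟩
  · exact Or.inl rfl

theorem vertex_eq_iff {c c' : TileCorner} :
    vertex Γ c = vertex Γ c' ↔ root Γ c = root Γ c' := by
  constructor
  · intro h
    have hr : ∀ c c', CornerGlued Γ c c' → root Γ c = root Γ c' := by
      rintro _ _ (⟨h⟩ | ⟨h⟩)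
      · rw [hΓ.root_tip (Or.inl h), root_other]
      · rw [hΓ.root_tip (Or.inr h), root_other]
    exact congrArg (Quot.lift (root Γ) hr) h
  · have hv : ∀ c, vertex Γ (root Γ c) = vertex Γ c := by
      intro c
      rcases root_eq_self_or (Γ := Γ) c with h | ⟨x, y, h, rfl, e⟩
      · rw [h]
      · rw [e, vertex_eq_of_glued h]
    intro h
    rw [← hv c, h, hv]

/-- The edges at a vertex that contains a SE or NW corner. -/
theorem otherCorner_mem_ends {z : TileSide} {e : Edge Γ} :
    vertex Γ (otherCorner z) ∈ ends Γ e ↔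
      ∃ z', (z' = z ∨ z' = otherMate z) ∧
        (e = edge Γ z' ∨ ∃ y, Glued Γ z' y ∧ e = edge Γ (tipMate y)) := by
  constructor
  · induction e using Quot.ind with | _ x =>
    intro h
    rcases mem_ends.1 h with h | h
    · rw [hΓ.vertex_eq_iff, root_other] at h
      rcases root_eq_self_or (Γ := Γ) (tipCorner x) with h' | ⟨x', y, hx, e, h'⟩
      · exact absurd (h'.symm.trans h.symm) (tipCorner_ne_otherCorner _ _)
      · refine ⟨y, otherCorner_eq_iff.1 (h'.symm.trans h.symm), ?_⟩
        rcases tipCorner_eq_iff.1 e.symm with rfl | rfl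
        · exact Or.inl (edge_eq_of_glued hx)
        · exact Or.inr ⟨x', hx.symm, rfl⟩
    · rw [hΓ.vertex_eq_iff, root_other, root_other] at h
      exact ⟨x, otherCorner_eq_iff.1 h.symm, Or.inl rfl⟩
  · rintro ⟨z', hz, h⟩
    rw [← otherCorner_eq_iff.2 hz]
    rcases h with rfl | ⟨y, hy, rfl⟩
    · exact mem_ends.2 (Or.inr rfl)
    · refine mem_ends.2 (Or.inl ?_)
      rw [tipCorner_tipMate, vertex_eq_of_glued hy.symm]

/-- The edges at a vertex that consists of a SW or NE corner only. -/
theorem tipCorner_mem_ends {z : TileSide} (h1 : ∀ y, ¬ Glued Γ z y)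
    (h2 : ∀ y, ¬ Glued Γ (tipMate z) y) {e : Edge Γ} :
    vertex Γ (tipCorner z) ∈ ends Γ e ↔ e = edge Γ z ∨ e = edge Γ (tipMate z) := by
  have hz : root Γ (tipCorner z) = tipCorner z := by
    rcases root_eq_self_or (Γ := Γ) (tipCorner z) with h | ⟨x, y, hx, e, -⟩
    · exact h
    · rcases tipCorner_eq_iff.1 e with rfl | rfl
      · exact absurd hx (h1 y)
      · exact absurd hx (h2 y)
  constructor
  · induction e using Quot.ind with | _ x =>
    intro h
    have hx : tipCorner z = tipCorner x := by
      rcases mem_ends.1 h with h | h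
      · rw [hΓ.vertex_eq_iff, hz] at h
        rcases root_eq_self_or (Γ := Γ) (tipCorner x) with h' | ⟨x', y, hx, e, h'⟩
        · exact h.trans h'
        · exact absurd (h.trans h') (tipCorner_ne_otherCorner _ _)
      · rw [hΓ.vertex_eq_iff, hz, root_other] at h
        exact absurd h (tipCorner_ne_otherCorner _ _)
    rcases tipCorner_eq_iff.1 hx.symm with rfl | rfl
    · exact Or.inl rfl
    · exact Or.inr rfl
  · rintro (rfl | rfl)
    · exact mem_ends.2 (Or.inl rfl)
    · exact mem_ends.2 (Or.inl (by rw [tipCorner_tipMate]))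

/-! ### Perfect matchings of a glued graph in terms of its tiles -/

omit hΓ in
/-- The vertex at the SE or NW corner of `x` is matched by an edge on the same side of that vertex
as `x`: by `x` itself, or by the edge next to the side that is glued to `x`. -/
def Ext (Γ : Gluing) (P : Set (Edge Γ)) (x : TileSide) : Prop :=
  edge Γ x ∈ P ∨ ∃ y, Glued Γ x y ∧ edge Γ (tipMate y) ∈ P

theorem isPerfectMatching_of_ext {T : Set ℕ} {P : Set (Edge Γ)}
    (hT : ∀ x y, Glued Γ x y → x.1 ∈ T → y.1 ∈ T)
    (hP : P ⊆ edge Γ '' sidesOf T)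
    (hext : ∀ x : TileSide, x.1 ∈ T → (Ext Γ P x ↔ ¬ Ext Γ P (otherMate x)))
    (hexcl : ∀ x y : TileSide, x.1 ∈ T → Glued Γ x y →
      ¬ (edge Γ x ∈ P ∧ edge Γ (tipMate y) ∈ P))
    (htip : ∀ x : TileSide, x.1 ∈ T → (∀ y, ¬ Glued Γ x y) → (∀ y, ¬ Glued Γ (tipMate x) y) →
      (edge Γ x ∈ P ↔ ¬ edge Γ (tipMate x) ∈ P)) :
    IsPerfectMatching (sideGraph Γ (sidesOf T)) P := by
  refine isPerfectMatching_sideGraph.2 ⟨hP, ?_⟩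
  have hother : ∀ z : TileSide, z.1 ∈ T →
      ∃! e, e ∈ P ∧ vertex Γ (otherCorner z) ∈ ends Γ e := by
    suffices H : ∀ z : TileSide, z.1 ∈ T → Ext Γ P z →
        ∃! e, e ∈ P ∧ vertex Γ (otherCorner z) ∈ ends Γ e by
      intro z hz
      by_cases h : Ext Γ P z
      · exact H z hz h
      · have := H (otherMate z) hz (by rwa [hext _ hz, not_not] at h)
        rwa [otherCorner_otherMate] at this
    intro z hz h
    have h' := (hext z hz).1 h
    have key : ∀ e, e ∈ P → vertex Γ (otherCorner z) ∈ ends Γ e →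
        e = edge Γ z ∨ ∃ y, Glued Γ z y ∧ e = edge Γ (tipMate y) := by
      intro e he hv
      obtain ⟨z', rfl | rfl, hz'⟩ := hΓ.otherCorner_mem_ends.1 hv
      · exact hz'
      · refine absurd ?_ h'
        rcases hz' with rfl | ⟨y, hy, rfl⟩
        · exact Or.inl he
        · exact Or.inr ⟨y, hy, he⟩
    refine existsUnique_of_exists_of_unique ?_ ?_
    · rcases h with h | ⟨y, hy, h⟩
      · exact ⟨_, h, hΓ.otherCorner_mem_ends.2 ⟨z, Or.inl rfl, Or.inl rfl⟩⟩
      · exact ⟨_, h, hΓ.otherCorner_mem_ends.2 ⟨z, Or.inl rfl, Or.inr ⟨y, hy, rfl⟩⟩⟩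
    · rintro e e' ⟨he, hv⟩ ⟨he', hv'⟩
      rcases key e he hv with rfl | ⟨y, hy, rfl⟩ <;>
        rcases key e' he' hv' with rfl | ⟨y', hy', rfl⟩
      · rfl
      · exact absurd ⟨he, he'⟩ (hexcl z y' hz hy')
      · exact absurd ⟨he', he⟩ (hexcl z y hz hy)
      · rw [hΓ.unique hy hy']
  intro x hx v hv
  rcases mem_ends.1 hv with rfl | rfl
  · by_cases h1 : ∃ y, Glued Γ x y
    · obtain ⟨y, hy⟩ := h1
      rw [vertex_eq_of_glued hy]
      exact hother y (hT x y hy hx)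
    by_cases h2 : ∃ y, Glued Γ (tipMate x) y
    · obtain ⟨y, hy⟩ := h2
      rw [← tipCorner_tipMate, vertex_eq_of_glued hy]
      exact hother y (hT _ y hy hx)
    push Not at h1 h2
    simp_rw [hΓ.tipCorner_mem_ends h1 h2]
    have := htip x hx h1 h2
    by_cases hp : edge Γ x ∈ P
    · refine ⟨edge Γ x, ⟨hp, Or.inl rfl⟩, ?_⟩
      rintro e ⟨he, rfl | rfl⟩
      · rfl
      · exact absurd he (this.1 hp)
    · refine ⟨edge Γ (tipMate x), ⟨not_not.1 fun h => hp (this.2 h), Or.inr rfl⟩, ?_⟩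
      rintro e ⟨he, rfl | rfl⟩
      · exact absurd he hp
      · rfl
  · exact hother x hx

end Tame

/-- The set of edges `e` with at least one representative in `F`, such that all
representatives of `e` in `F` are selected by `h`. -/
def matchingOf (Γ : Gluing) (F : Set TileSide) (h : ℕ → Bool) : Set (Edge Γ) :=
  {e | (∃ x ∈ F, edge Γ x = e) ∧ ∀ x ∈ F, edge Γ x = e → Sel h x}

/-- At least one of any two sides in `F` that are glued to each other is selected. -/
def Valid (Γ : Gluing) (F : Set TileSide) (h : ℕ → Bool) : Prop :=
  ∀ x ∈ F, ∀ y ∈ F, Glued Γ x y → Sel h x ∨ Sel h y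

namespace Tame

variable {Γ : Gluing} (hΓ : Tame Γ)
include hΓ

theorem mem_matchingOf {F : Set TileSide} {h : ℕ → Bool} {x : TileSide} (hx : x ∈ F) :
    edge Γ x ∈ matchingOf Γ F h ↔ Sel h x ∧ ∀ y ∈ F, Glued Γ x y → Sel h y := by
  constructor
  · rintro ⟨-, h'⟩
    exact ⟨h' x hx rfl, fun y hy hxy => h' y hy (edge_eq_of_glued hxy).symm⟩
  · rintro ⟨h1, h2⟩
    refine ⟨⟨x, hx, rfl⟩, fun y hy e => ?_⟩
    rcases hΓ.edge_eq_iff.1 e with rfl | h'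
    · exact h1
    · exact h2 y hy h'.symm

theorem not_glued_tipMate {x y : TileSide} (h : Glued Γ x y) (z : TileSide) :
    ¬ Glued Γ (tipMate x) z := fun h' =>
  tipMate_ne x (hΓ.tip_eq h' h (tipCorner_tipMate x))

/-- If each tile is matched by one of its two perfect matchings, and at least one of any two glued
sides is selected, then the union of these matchings, from which an edge is removed
if only one of its two copies is selected, is a perfect matching of the glued graph. -/
theorem isPerfectMatching_matchingOf {T : Set ℕ} {h : ℕ → Bool}
    (hT : ∀ x y, Glued Γ x y → x.1 ∈ T → y.1 ∈ T) (hv : Valid Γ (sidesOf T) h) :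
    IsPerfectMatching (sideGraph Γ (sidesOf T)) (matchingOf Γ (sidesOf T) h) := by
  set P := matchingOf Γ (sidesOf T) h with hP
  have hm : ∀ x : TileSide, x.1 ∈ T → (edge Γ x ∈ P ↔ Sel h x ∧ ∀ y, Glued Γ x y → Sel h y) := by
    intro x hx
    rw [hP, hΓ.mem_matchingOf (F := sidesOf T) hx]
    exact and_congr_right fun _ => ⟨fun H y hy => H y (hT x y hy hx) hy, fun H y _ hy => H y hy⟩
  have hm' : ∀ x y : TileSide, x.1 ∈ T → Glued Γ x y →
      (edge Γ (tipMate y) ∈ P ↔ ¬ Sel h y) := by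
    intro x y hx hxy
    rw [hm (tipMate y) (hT x y hxy hx), sel_tipMate]
    exact and_iff_left fun z hz => absurd hz (hΓ.not_glued_tipMate hxy.symm z)
  have hext : ∀ x : TileSide, x.1 ∈ T → (Ext Γ P x ↔ Sel h x) := by
    intro x hx
    constructor
    · rintro (h' | ⟨y, hy, h'⟩)
      · exact ((hm x hx).1 h').1
      · exact (hv x hx y (hT x y hy hx) hy).resolve_right ((hm' x y hx hy).1 h')
    · intro h'
      by_cases H : ∃ y, Glued Γ x y ∧ ¬ Sel h y
      · obtain ⟨y, hy, hs⟩ := H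
        exact Or.inr ⟨y, hy, (hm' x y hx hy).2 hs⟩
      · push Not at H
        exact Or.inl ((hm x hx).2 ⟨h', H⟩)
  refine hΓ.isPerfectMatching_of_ext hT ?_ ?_ ?_ ?_
  · rintro e ⟨⟨x, hx, rfl⟩, -⟩
    exact ⟨x, hx, rfl⟩
  · intro x hx
    rw [hext x hx, hext (otherMate x) hx, sel_otherMate, not_not]
  · rintro x y hx hxy ⟨h1, h2⟩
    exact (hm' x y hx hxy).1 h2 (((hm x hx).1 h1).2 y hxy)
  · intro x hx h1 h2
    rw [hm x hx, hm (tipMate x) hx, sel_tipMate]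
    simp [h1, h2]

/-- A perfect matching arises from matchings of the tiles as in `isPerfectMatching_matchingOf`,
provided that the tiles are glued along chains: with respect to some rank, each tile has a SW or
NE corner at which it is glued to nothing or to a tile of smaller rank. The reason is that the
two sides at that corner are matched alternatively; this property passes
from one SW or NE corner of a tile to the other one and across each glued side. -/
theorem exists_of_isPerfectMatching {T : Set ℕ} {P : Set (Edge Γ)}
    (hT : ∀ x y, Glued Γ x y → x.1 ∈ T → y.1 ∈ T)
    (hne : ∀ x y, Glued Γ x y → x.1 ≠ y.1)
    (r : ℕ → ℕ) (hr : ∀ k ∈ T, ∃ z : TileSide, z.1 = k ∧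
      ∀ x y, Glued Γ x y → tipCorner x = tipCorner z → r y.1 < r k)
    (hP : IsPerfectMatching (sideGraph Γ (sidesOf T)) P) :
    ∃ h, Valid Γ (sidesOf T) h ∧ P = matchingOf Γ (sidesOf T) h := by
  obtain ⟨hsub, hP⟩ := isPerfectMatching_sideGraph.1 hP
  have hexcl : ∀ x y : TileSide, x.1 ∈ T → Glued Γ x y →
      ¬ (edge Γ x ∈ P ∧ edge Γ (tipMate y) ∈ P) := by
    rintro x y hx hxy ⟨h1, h2⟩
    have := (hP x hx _ (mem_ends.2 (Or.inr rfl))).unique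
      ⟨h1, hΓ.otherCorner_mem_ends.2 ⟨x, Or.inl rfl, Or.inl rfl⟩⟩
      ⟨h2, hΓ.otherCorner_mem_ends.2 ⟨x, Or.inl rfl, Or.inr ⟨y, hxy, rfl⟩⟩⟩
    rcases hΓ.edge_eq_iff.1 this with h | h
    · exact hne x y hxy (by rw [h, tipMate_fst])
    · exact hΓ.not_glued_tipMate hxy.symm x h.symm
  have hext : ∀ x : TileSide, x.1 ∈ T → (Ext Γ P (otherMate x) ↔ ¬ Ext Γ P x) := by
    intro x hx
    obtain ⟨e, ⟨he, hv⟩, hu⟩ := hP x hx _ (mem_ends.2 (Or.inr rfl))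
    have huniq : ∀ e' ∈ P, vertex Γ (otherCorner x) ∈ ends Γ e' → e' = e :=
      fun e' h1 h2 => hu e' ⟨h1, h2⟩
    clear hu
    have hrep : ∀ z, (z = x ∨ z = otherMate x) → Ext Γ P z →
        e = edge Γ z ∨ ∃ y, Glued Γ z y ∧ e = edge Γ (tipMate y) := by
      rintro z hz (h | ⟨y, hy, h⟩)
      · exact Or.inl (huniq _ h (hΓ.otherCorner_mem_ends.2 ⟨z, hz, Or.inl rfl⟩)).symm
      · exact Or.inr ⟨y, hy,
          (huniq _ h (hΓ.otherCorner_mem_ends.2 ⟨z, hz, Or.inr ⟨y, hy, rfl⟩⟩)).symm⟩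
    have hsome : Ext Γ P x ∨ Ext Γ P (otherMate x) := by
      obtain ⟨z, hz, h⟩ := hΓ.otherCorner_mem_ends.1 hv
      have : Ext Γ P z := by
        rcases h with rfl | ⟨y, hy, rfl⟩
        · exact Or.inl he
        · exact Or.inr ⟨y, hy, he⟩
      rcases hz with rfl | rfl
      · exact Or.inl this
      · exact Or.inr this
    refine ⟨fun h2 h1 => ?_, fun h => hsome.resolve_left h⟩
    have htm : ∀ z w y, Glued Γ z y → edge Γ w ≠ edge Γ (tipMate y) ∨ w = tipMate y := by
      intro z w y hy
      by_contra! H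
      rcases hΓ.edge_eq_iff.1 H.1 with h | h
      · exact H.2 h
      · exact hΓ.not_glued_tipMate hy.symm w h.symm
    rcases hrep x (Or.inl rfl) h1 with e1 | ⟨y, hy, e1⟩ <;>
      rcases hrep _ (Or.inr rfl) h2 with e2 | ⟨y', hy', e2⟩
    · rcases hΓ.edge_eq_iff.1 (e1.symm.trans e2) with h | h
      · exact otherMate_ne x h.symm
      · exact hne _ _ h rfl
    · rcases htm _ x y' hy' with h | h
      · exact h (e1.symm.trans e2)
      · exact hne _ _ hy' (by rw [← tipMate_fst y', ← h, otherMate_fst])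
    · rcases htm _ (otherMate x) y hy with h | h
      · exact h (e2.symm.trans e1)
      · exact hne _ _ hy (by rw [← tipMate_fst y, ← h, otherMate_fst])
    · rcases htm _ (tipMate y) y' hy' with h | h
      · exact h (e1.symm.trans e2)
      · have : y = y' := by rw [← tipMate_tipMate y, h, tipMate_tipMate]
        subst this
        exact otherMate_ne x (hΓ.unique hy.symm hy'.symm).symm
  have hfree : ∀ x : TileSide, (∀ y, ¬ Glued Γ x y) → (Ext Γ P x ↔ edge Γ x ∈ P) := by
    intro x hx
    simp [Ext, hx]
  have hfree' : ∀ x y : TileSide, Glued Γ x y →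
      (Ext Γ P (tipMate x) ↔ edge Γ (tipMate x) ∈ P) := fun x y hxy =>
    hfree _ (hΓ.not_glued_tipMate hxy)
  have htip : ∀ x : TileSide, x.1 ∈ T → (∀ y, ¬ Glued Γ x y) →
      (∀ y, ¬ Glued Γ (tipMate x) y) → (Ext Γ P (tipMate x) ↔ ¬ Ext Γ P x) := by
    intro x hx h1 h2
    rw [hfree _ h1, hfree _ h2]
    obtain ⟨e, ⟨he, hv⟩, hu⟩ := hP x hx _ (mem_ends.2 (Or.inl rfl))
    simp only [hΓ.tipCorner_mem_ends h1 h2] at hv hu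
    constructor
    · intro h' h
      have e1 := hu _ ⟨h, Or.inl rfl⟩
      have e2 := hu _ ⟨h', Or.inr rfl⟩
      rcases hΓ.edge_eq_iff.1 (e1.trans e2.symm) with h | h
      · exact tipMate_ne x h.symm
      · exact h1 _ h
    · intro h
      rcases hv with rfl | rfl
      · exact absurd he h
      · exact he
  -- Alternation at one of the two tips of a tile, at one side there, and at the
  -- other side there are equivalent.
  have halt : ∀ x : TileSide, x.1 ∈ T → (Ext Γ P (tipMate x) ↔ ¬ Ext Γ P x) →
      ∀ z : TileSide, z.1 = x.1 → (Ext Γ P (tipMate z) ↔ ¬ Ext Γ P z) := by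
    intro x hx h z hz
    have h3 := hext x hx
    have h4 := hext (tipMate x) hx
    rcases x with ⟨k, a⟩
    rcases z with ⟨l, b⟩
    obtain rfl : l = k := hz
    cases a <;> cases b <;>
      simp only [tipMate, otherMate, Side.tipMate, Side.otherMate] at h h3 h4 ⊢ <;> simp [h4, h3, h]
  have hstep : ∀ x y : TileSide, x.1 ∈ T → Glued Γ x y → (Ext Γ P (tipMate x) ↔ ¬ Ext Γ P x) →
      (Ext Γ P (tipMate y) ↔ ¬ Ext Γ P y) := by
    intro x y hx hxy h
    have e : edge Γ x = edge Γ y := edge_eq_of_glued hxy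
    have hEx : Ext Γ P x ↔ edge Γ y ∈ P ∨ edge Γ (tipMate y) ∈ P := by
      refine or_congr (by rw [e]) ⟨?_, fun h => ⟨y, hxy, h⟩⟩
      rintro ⟨y', hy', h⟩
      rwa [hΓ.unique hxy hy']
    have hEy : Ext Γ P y ↔ edge Γ y ∈ P ∨ edge Γ (tipMate x) ∈ P := by
      refine or_congr Iff.rfl ⟨?_, fun h => ⟨x, hxy.symm, h⟩⟩
      rintro ⟨x', hx', h⟩
      rwa [hΓ.unique hxy.symm hx']
    have h1 := hexcl x y hx hxy
    have h2 := hexcl y x (hT x y hxy hx) hxy.symm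
    rw [hfree' x y hxy] at h
    rw [hfree' y x hxy.symm]
    rw [e] at h1
    tauto
  have hall : ∀ n k, r k = n → k ∈ T → ∀ z : TileSide, z.1 = k →
      (Ext Γ P (tipMate z) ↔ ¬ Ext Γ P z) := by
    intro n
    induction n using Nat.strong_induction_on with
    | _ n ih =>
      rintro k rfl hk
      obtain ⟨z, rfl, hz⟩ := hr k hk
      suffices H : ∃ x : TileSide, x.1 = z.1 ∧ (Ext Γ P (tipMate x) ↔ ¬ Ext Γ P x) by
        obtain ⟨x, hx, H⟩ := H
        intro w hw
        exact halt x (hx ▸ hk) H w (hw.trans hx.symm)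
      have hglue : ∀ x y, Glued Γ x y → tipCorner x = tipCorner z →
          (Ext Γ P (tipMate x) ↔ ¬ Ext Γ P x) := by
        intro x y hxy e
        have hx : x.1 ∈ T := by
          have : (tipCorner x).1 = (tipCorner z).1 := by rw [e]
          change x.1 = z.1 at this
          rwa [this]
        exact hstep y x (hT x y hxy hx) hxy.symm
          (ih _ (hz x y hxy e) _ rfl (hT x y hxy hx) y rfl)
      by_cases h1 : ∃ y, Glued Γ z y
      · obtain ⟨y, hy⟩ := h1
        exact ⟨z, rfl, hglue z y hy rfl⟩
      by_cases h2 : ∃ y, Glued Γ (tipMate z) y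
      · obtain ⟨y, hy⟩ := h2
        exact ⟨tipMate z, rfl, hglue _ y hy (tipCorner_tipMate z)⟩
      push Not at h1 h2
      exact ⟨z, rfl, htip z hk h1 h2⟩
  classical
  refine ⟨fun k => decide (Ext Γ P (k, .south)), ?_⟩
  set h : ℕ → Bool := fun k => decide (Ext Γ P (k, .south)) with hh
  have hsel : ∀ x : TileSide, x.1 ∈ T → (Sel h x ↔ Ext Γ P x) := by
    rintro ⟨k, a⟩ hk
    have h1 := hall _ k rfl hk (k, .south) rfl
    have h2 := hext (k, .south) hk
    have h3 := hext (k, .west) hk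
    simp only [tipMate, otherMate, Side.tipMate, Side.otherMate] at h1 h2 h3
    cases a <;> simp only [Sel, Side.horizontal, hh, eq_comm (a := true), eq_comm (a := false),
      decide_eq_true_eq, decide_eq_false_iff_not, h3, h2, h1, not_not]
  have hnot : ∀ x y : TileSide, x.1 ∈ T → Glued Γ x y → Ext Γ P y →
      ¬ edge Γ (tipMate y) ∈ P := by
    intro x y hx hxy h1 h2
    rw [← hfree' y x hxy.symm, hall _ _ rfl (hT x y hxy hx) y rfl] at h2
    exact h2 h1
  refine ⟨fun x hx y hy hxy => ?_, ?_⟩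
  · rw [hsel x hx, hsel y hy]
    by_contra! H
    exact H.1 (Or.inr ⟨y, hxy,
      (hfree' y x hxy.symm).1 ((hall _ _ rfl hy y rfl).2 H.2)⟩)
  · have hmem : ∀ x ∈ sidesOf T, (edge Γ x ∈ P ↔ edge Γ x ∈ matchingOf Γ (sidesOf T) h) := by
      intro x hx
      rw [hΓ.mem_matchingOf hx, hsel x hx]
      constructor
      · intro hp
        refine ⟨Or.inl hp, fun y hy hxy => (hsel y hy).2 (Or.inl ?_)⟩
        rwa [← edge_eq_of_glued hxy]
      · rintro ⟨h1 | ⟨y, hy, h1⟩, h2⟩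
        · exact h1
        · have hyT := hT x y hy hx
          exact absurd h1 (hnot x y hx hy ((hsel y hyT).1 (h2 y hyT hy)))
    ext e
    constructor
    · intro he
      obtain ⟨x, hx, rfl⟩ := hsub he
      exact (hmem x hx).1 he
    · intro he
      obtain ⟨x, hx, rfl⟩ := he.1
      exact (hmem x hx).2 he

end Tame

/-! ### Tiles glued along oriented arcs -/

/-- The gluing `Γ` is described by arcs: for each arc `R j k`, the side `out j` of the tile `j` is
glued to the side `inn k` of the tile `k`. The two sides are at opposite tips
of each tile, and a tile is the source and the target of at most one arc. Snake graphs are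
the case of linearly ordered arcs, band graphs the case of a cycle. -/
structure Arcs (Γ : Gluing) (inn out : ℕ → Side) (R : ℕ → ℕ → Prop) : Prop where
  glued_iff : ∀ x y, Glued Γ x y ↔ ∃ j k, R j k ∧
    ((x = (j, out j) ∧ y = (k, inn k)) ∨ (x = (k, inn k) ∧ y = (j, out j)))
  tip_ne : ∀ k, (inn k).tip ≠ (out k).tip
  right_unique : ∀ {j k k'}, R j k → R j k' → k = k'
  left_unique : ∀ {j j' k}, R j k → R j' k → j = j'

namespace Arcs

variable {Γ : Gluing} {inn out : ℕ → Side} {R : ℕ → ℕ → Prop}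

theorem tame (A : Arcs Γ inn out R) : Tame Γ := by
  have hne : ∀ j k, ((j, out j) : TileSide) ≠ (k, inn k) := by
    intro j k h
    obtain ⟨rfl, h⟩ := Prod.mk.inj h
    exact A.tip_ne j (by rw [h])
  have htip : ∀ j k, tipCorner (j, out j) ≠ tipCorner (k, inn k) := by
    intro j k h
    obtain ⟨h1, h2⟩ := Prod.mk.inj h
    obtain rfl : j = k := h1
    exact A.tip_ne j h2.symm
  refine ⟨?_, ?_, ?_⟩
  · intro x y y' h h'
    obtain ⟨j, k, hR, ⟨rfl, rfl⟩ | ⟨rfl, rfl⟩⟩ := (A.glued_iff _ _).1 h <;>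
      obtain ⟨j', k', hR', ⟨h1, rfl⟩ | ⟨h1, rfl⟩⟩ := (A.glued_iff _ _).1 h'
    · obtain ⟨rfl, -⟩ := Prod.mk.inj h1
      rw [A.right_unique hR hR']
    · exact absurd h1 (hne _ _)
    · exact absurd h1.symm (hne _ _)
    · obtain ⟨rfl, -⟩ := Prod.mk.inj h1
      rw [A.left_unique hR hR']
  · intro x y x' y' h h' e
    obtain ⟨j, k, hR, ⟨rfl, rfl⟩ | ⟨rfl, rfl⟩⟩ := (A.glued_iff _ _).1 h <;>
      obtain ⟨j', k', hR', ⟨rfl, rfl⟩ | ⟨rfl, rfl⟩⟩ := (A.glued_iff _ _).1 h'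
    · obtain ⟨h1, -⟩ := Prod.mk.inj e
      obtain rfl : j = j' := h1
      rfl
    · exact absurd e (htip _ _)
    · exact absurd e.symm (htip _ _)
    · obtain ⟨h1, -⟩ := Prod.mk.inj e
      obtain rfl : k = k' := h1
      rfl
  · intro x h
    obtain ⟨j, k, -, ⟨rfl, h2⟩ | ⟨rfl, h2⟩⟩ := (A.glued_iff _ _).1 h
    · exact hne _ _ h2
    · exact hne _ _ h2.symm

end Arcs

/-- The part of a gluing that concerns only tiles with index in `T`. -/
def Gluing.restrictTo (Γ : Gluing) (T : Set ℕ) : Gluing := {g ∈ Γ | g.1.1 ∈ T ∧ g.2.1 ∈ T}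

theorem glued_restrictTo {Γ : Gluing} {T : Set ℕ} {x y : TileSide} :
    Glued (Gluing.restrictTo Γ T) x y ↔ Glued Γ x y ∧ x.1 ∈ T ∧ y.1 ∈ T := by
  constructor
  · rintro (⟨h, h1, h2⟩ | ⟨h, h1, h2⟩)
    · exact ⟨Or.inl h, h1, h2⟩
    · exact ⟨Or.inr h, h2, h1⟩
  · rintro ⟨h | h, h1, h2⟩
    · exact Or.inl ⟨h, h1, h2⟩
    · exact Or.inr ⟨h, h2, h1⟩

/-- The perfect matchings of a graph of tiles depend only on which corners and which sides of its
tiles are identified. -/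
theorem isPerfectMatching_transfer {Γ Γ' : Gluing} {T : Set ℕ}
    (hv : ∀ c c' : TileCorner, c.1 ∈ T → c'.1 ∈ T →
      (vertex Γ c = vertex Γ c' ↔ vertex Γ' c = vertex Γ' c'))
    (he : ∀ x y : TileSide, x.1 ∈ T → y.1 ∈ T → (edge Γ x = edge Γ y ↔ edge Γ' x = edge Γ' y))
    {P : Set (Edge Γ)} {P' : Set (Edge Γ')} (hP' : P' ⊆ edge Γ' '' sidesOf T)
    (hPP : ∀ x : TileSide, x.1 ∈ T → (edge Γ x ∈ P ↔ edge Γ' x ∈ P'))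
    (h : IsPerfectMatching (sideGraph Γ (sidesOf T)) P) :
    IsPerfectMatching (sideGraph Γ' (sidesOf T)) P' := by
  rw [isPerfectMatching_sideGraph] at h ⊢
  refine ⟨hP', ?_⟩
  have hmem : ∀ (c : TileCorner) (x : TileSide), c.1 ∈ T → x.1 ∈ T →
      (vertex Γ c ∈ ends Γ (edge Γ x) ↔ vertex Γ' c ∈ ends Γ' (edge Γ' x)) := by
    intro c x hc hx
    rw [mem_ends, mem_ends, hv c (tipCorner x) hc hx, hv c (otherCorner x) hc hx]
  have key : ∀ c : TileCorner, c.1 ∈ T → (∃! e, e ∈ P ∧ vertex Γ c ∈ ends Γ e) →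
      ∃! e, e ∈ P' ∧ vertex Γ' c ∈ ends Γ' e := by
    rintro c hc ⟨e, ⟨heP, hce⟩, hu⟩
    obtain ⟨x, hx, rfl⟩ := h.1 heP
    refine ⟨edge Γ' x, ⟨(hPP x hx).1 heP, (hmem c x hc hx).1 hce⟩, ?_⟩
    rintro e' ⟨he', hce'⟩
    obtain ⟨y, hy, rfl⟩ := hP' he'
    exact (he y x hy hx).1 (hu _ ⟨(hPP y hy).2 he', (hmem c y hc hy).2 hce'⟩)
  intro x hx v hvx
  rcases mem_ends.1 hvx with rfl | rfl
  · exact key (tipCorner x) hx (h.2 x hx _ (mem_ends.2 (Or.inl rfl)))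
  · exact key (otherCorner x) hx (h.2 x hx _ (mem_ends.2 (Or.inr rfl)))

theorem matchingOf_subset {Γ : Gluing} {F : Set TileSide} {h : ℕ → Bool} :
    matchingOf Γ F h ⊆ edge Γ '' F := fun _ he => he.1

namespace Arcs

variable {Γ : Gluing} {inn out : ℕ → Side} {R : ℕ → ℕ → Prop}

theorem restrictTo (A : Arcs Γ inn out R) (T : Set ℕ) :
    Arcs (Gluing.restrictTo Γ T) inn out (fun j k => R j k ∧ j ∈ T ∧ k ∈ T) where
  glued_iff x y := by
    rw [glued_restrictTo, A.glued_iff]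
    constructor
    · rintro ⟨⟨j, k, hR, ⟨rfl, rfl⟩ | ⟨rfl, rfl⟩⟩, h1, h2⟩
      · exact ⟨j, k, ⟨hR, h1, h2⟩, Or.inl ⟨rfl, rfl⟩⟩
      · exact ⟨j, k, ⟨hR, h2, h1⟩, Or.inr ⟨rfl, rfl⟩⟩
    · rintro ⟨j, k, ⟨hR, h1, h2⟩, ⟨rfl, rfl⟩ | ⟨rfl, rfl⟩⟩
      · exact ⟨⟨j, k, hR, Or.inl ⟨rfl, rfl⟩⟩, h1, h2⟩
      · exact ⟨⟨j, k, hR, Or.inr ⟨rfl, rfl⟩⟩, h2, h1⟩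
  tip_ne := A.tip_ne
  right_unique h h' := A.right_unique h.1 h'.1
  left_unique h h' := A.left_unique h.1 h'.1

theorem vertex_restrictTo (A : Arcs Γ inn out R) {T : Set ℕ}
    (hconv : ∀ i j k, R i j → R j k → i ∈ T → k ∈ T → j ∈ T) (c c' : TileCorner)
    (hc : c.1 ∈ T) (hc' : c'.1 ∈ T) :
    vertex Γ c = vertex Γ c' ↔
      vertex (Gluing.restrictTo Γ T) c = vertex (Gluing.restrictTo Γ T) c' := by
  have hΓ := A.tame
  constructor
  · rw [hΓ.vertex_eq_iff]
    intro h
    have hg : ∀ x y, Glued Γ x y → x.1 ∈ T → y.1 ∈ T →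
        vertex (Gluing.restrictTo Γ T) (tipCorner x) =
          vertex (Gluing.restrictTo Γ T) (otherCorner y) := fun x y h1 h2 h3 =>
      vertex_eq_of_glued (glued_restrictTo.2 ⟨h1, h2, h3⟩)
    rcases Tame.root_eq_self_or (Γ := Γ) c with e | ⟨x, y, hxy, rfl, e⟩ <;>
      rcases Tame.root_eq_self_or (Γ := Γ) c' with e' | ⟨x', y', hxy', rfl, e'⟩
    · rw [← e, h, e']
    · have : c = otherCorner y' := by rw [← e, h, e']
      subst this
      exact (hg x' y' hxy' hc' hc).symm
    · have : c' = otherCorner y := by rw [← e', ← h, e]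
      subst this
      exact hg x y hxy hc hc'
    · have hyy : otherCorner y = otherCorner y' := by rw [← e, h, e']
      rcases otherCorner_eq_iff.1 hyy with rfl | hyy'
      · rw [hΓ.unique hxy.symm hxy'.symm]
      · -- Both sides at this SE or NW corner are glued, to tiles in `T`.
        have hyT : y.1 ∈ T := by
          have h1 : y.1 = y'.1 := by rw [hyy', otherMate_fst]
          obtain ⟨j, k, hR, ⟨rfl, rfl⟩ | ⟨rfl, rfl⟩⟩ := (A.glued_iff _ _).1 hxy <;>
            obtain ⟨j', k', hR', ⟨rfl, rfl⟩ | ⟨rfl, rfl⟩⟩ := (A.glued_iff _ _).1 hxy'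
          · obtain rfl : k = k' := h1
            exact absurd hyy'.symm (otherMate_ne _)
          · obtain rfl : k = j' := h1
            exact hconv _ _ _ hR hR' hc hc'
          · obtain rfl : j = k' := h1
            exact hconv _ _ _ hR' hR hc' hc
          · obtain rfl : j = j' := h1
            exact absurd hyy'.symm (otherMate_ne _)
        have hyT' : y'.1 ∈ T := by
          have h1 : y.1 = y'.1 := by rw [hyy', otherMate_fst]
          rwa [← h1]
        rw [hg x y hxy hc hyT, hg x' y' hxy' hc' hyT', hyy]
  · intro h
    have hT := (A.restrictTo T).tame
    rw [hT.vertex_eq_iff] at h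
    have hv : ∀ c, vertex Γ (Tame.root (Gluing.restrictTo Γ T) c) = vertex Γ c := by
      intro c
      rcases Tame.root_eq_self_or (Γ := Gluing.restrictTo Γ T) c with e | ⟨x, y, hxy, rfl, e⟩
      · rw [e]
      · rw [e, vertex_eq_of_glued (glued_restrictTo.1 hxy).1]
    rw [← hv c, h, hv]

/-- The perfect matchings of a snake graph: those obtained from matchings of the tiles such that
at least one of any two glued sides is selected. -/
theorem isPerfectMatching_iff (A : Arcs Γ inn out R) (r : ℕ → ℕ) (hr : ∀ j k, R j k → r j < r k)
    {T : Set ℕ} (hconv : ∀ i j k, R i j → R j k → i ∈ T → k ∈ T → j ∈ T) {P : Set (Edge Γ)} :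
    IsPerfectMatching (sideGraph Γ (sidesOf T)) P ↔
      ∃ h, Valid Γ (sidesOf T) h ∧ P = matchingOf Γ (sidesOf T) h := by
  have hΓ := A.tame
  have A' := A.restrictTo T
  have hΓ' := A'.tame
  set Γ' := Gluing.restrictTo Γ T with hΓ'def
  have hT : ∀ x y, Glued Γ' x y → x.1 ∈ T → y.1 ∈ T := fun x y h _ => (glued_restrictTo.1 h).2.2
  have hvalid : ∀ h, Valid Γ (sidesOf T) h ↔ Valid Γ' (sidesOf T) h := fun h =>
    ⟨fun H x hx y hy hxy => H x hx y hy (glued_restrictTo.1 hxy).1,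
      fun H x hx y hy hxy => H x hx y hy (glued_restrictTo.2 ⟨hxy, hx, hy⟩)⟩
  have hv := A.vertex_restrictTo hconv
  have he : ∀ x y : TileSide, x.1 ∈ T → y.1 ∈ T →
      (edge Γ x = edge Γ y ↔ edge Γ' x = edge Γ' y) := by
    intro x y hx hy
    rw [hΓ.edge_eq_iff, hΓ'.edge_eq_iff, glued_restrictTo]
    tauto
  have hmem : ∀ h, ∀ x : TileSide, x.1 ∈ T →
      (edge Γ x ∈ matchingOf Γ (sidesOf T) h ↔ edge Γ' x ∈ matchingOf Γ' (sidesOf T) h) := by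
    intro h x hx
    rw [hΓ.mem_matchingOf (F := sidesOf T) hx, hΓ'.mem_matchingOf (F := sidesOf T) hx]
    refine and_congr_right fun _ => forall_congr' fun y => forall_congr' fun hy => ?_
    rw [glued_restrictTo]
    have hy' : y.1 ∈ T := hy
    tauto
  constructor
  · intro hP
    have hsub := (isPerfectMatching_sideGraph.1 hP).1
    set P' : Set (Edge Γ') := {e | ∃ x ∈ sidesOf T, edge Γ' x = e ∧ edge Γ x ∈ P} with hP'
    have hPP : ∀ x : TileSide, x.1 ∈ T → (edge Γ x ∈ P ↔ edge Γ' x ∈ P') := by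
      intro x hx
      refine ⟨fun h => ⟨x, hx, rfl, h⟩, ?_⟩
      rintro ⟨y, hy, e, h⟩
      rwa [(he x y hx hy).2 e.symm]
    have hPM := isPerfectMatching_transfer hv he (P' := P')
      (by rintro _ ⟨x, hx, rfl, -⟩; exact ⟨x, hx, rfl⟩) hPP hP
    obtain ⟨h, h1, h2⟩ := hΓ'.exists_of_isPerfectMatching hT (by
        intro x y hxy e
        obtain ⟨j, k, hR, ⟨rfl, rfl⟩ | ⟨rfl, rfl⟩⟩ := (A.glued_iff _ _).1 (glued_restrictTo.1 hxy).1
        · exact absurd (hr _ _ hR) (by simp at e; simp [e])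
        · exact absurd (hr _ _ hR) (by simp at e; simp [e])) r (by
        intro k hk
        refine ⟨(k, inn k), rfl, ?_⟩
        intro x y hxy e
        obtain ⟨j, k', hR, ⟨rfl, rfl⟩ | ⟨rfl, rfl⟩⟩ :=
          (A.glued_iff _ _).1 (glued_restrictTo.1 hxy).1
        · obtain ⟨e1, e2⟩ := Prod.mk.inj e
          obtain rfl : j = k := e1
          exact absurd e2.symm (A.tip_ne j)
        · obtain ⟨e1, e2⟩ := Prod.mk.inj e
          obtain rfl : k' = k := e1
          exact hr _ _ hR) hPM
    refine ⟨h, (hvalid h).2 h1, ?_⟩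
    ext e
    constructor
    · intro heP
      obtain ⟨x, hx, rfl⟩ := hsub heP
      rw [hmem h x hx, ← h2]
      exact (hPP x hx).1 heP
    · intro heP
      obtain ⟨x, hx, rfl⟩ := heP.1
      rw [hmem h x hx, ← h2] at heP
      exact (hPP x hx).2 heP
  · rintro ⟨h, hval, rfl⟩
    exact isPerfectMatching_transfer (fun c c' hc hc' => (hv c c' hc hc').symm)
      (fun x y hx hy => (he x y hx hy).symm) matchingOf_subset
      (fun x hx => (hmem h x hx).symm)
      (hΓ'.isPerfectMatching_matchingOf hT ((hvalid h).1 hval))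

end Arcs

theorem isPerfectMatching_singleton {Γ : Gluing} {x : TileSide} {P : Set (Edge Γ)} :
    IsPerfectMatching (sideGraph Γ {x}) P ↔ P = {edge Γ x} := by
  rw [isPerfectMatching_sideGraph, Set.image_singleton]
  constructor
  · rintro ⟨h1, h2⟩
    obtain ⟨e, ⟨he, -⟩, -⟩ := h2 x rfl _ (mem_ends.2 (Or.inl rfl))
    refine Set.Subset.antisymm h1 ?_
    rintro _ rfl
    rwa [← Set.mem_singleton_iff.1 (h1 he)]
  · rintro rfl
    refine ⟨subset_rfl, ?_⟩
    rintro y rfl v hv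
    exact ⟨edge Γ y, ⟨rfl, hv⟩, fun e he => he.1⟩

/-! ### Good matchings of a band graph -/

section Band

variable {Γ : Gluing} {a b : TileSide}

/-- Deleting a selected copy `x` of the cut edge from a matching of the cut graph gives the
matching of the band graph with the same selection on the tiles. -/
theorem Tame.remove_copy (hΓ : Tame Γ) {T : Set ℕ}
    (hT : ∀ x y, Glued Γ x y → x.1 ∈ T → y.1 ∈ T) (hcut : Tame (Γ \ {(a, b)}))
    (hab : (a, b) ∈ Γ) (hba : (b, a) ∉ Γ) {h : ℕ → Bool} {x : TileSide} (hx : x = a ∨ x = b)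
    (hsel : Sel h x) :
    {e | ∃ y : TileSide, edge (Γ \ {(a, b)}) y ∈ matchingOf (Γ \ {(a, b)}) (sidesOf T) h ∧
      edge (Γ \ {(a, b)}) y ≠ edge (Γ \ {(a, b)}) x ∧ edge Γ y = e} =
    matchingOf Γ (sidesOf T) h := by
  have hsub : ∀ y z, Glued (Γ \ {(a, b)}) y z → Glued Γ y z :=
    fun y z h => h.imp (fun h => h.1) fun h => h.1
  have hsplit : ∀ y z, Glued Γ y z → Glued (Γ \ {(a, b)}) y z ∨ (y = a ∧ z = b) ∨
      (y = b ∧ z = a) := by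
    rintro y z (h | h)
    · by_cases e : (y, z) = (a, b)
      · exact Or.inr (Or.inl (Prod.mk.inj e))
      · exact Or.inl (Or.inl ⟨h, e⟩)
    · by_cases e : (z, y) = (a, b)
      · exact Or.inr (Or.inr (Prod.mk.inj e).symm)
      · exact Or.inl (Or.inr ⟨h, e⟩)
  have hga : Glued Γ a b := Or.inl hab
  have hfree : ∀ z, ¬ Glued (Γ \ {(a, b)}) x z := by
    intro z hz
    rcases hx with rfl | rfl
    · obtain rfl := hΓ.unique (hsub _ _ hz) hga
      rcases hz with hz | hz
      · exact hz.2 rfl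
      · exact hba hz.1
    · obtain rfl := hΓ.unique (hsub _ _ hz) hga.symm
      rcases hz with hz | hz
      · exact hba hz.1
      · exact hz.2 rfl
  have hxx : ∃ w, Glued Γ x w := by
    rcases hx with rfl | rfl
    · exact ⟨b, hga⟩
    · exact ⟨a, hga.symm⟩
  obtain ⟨w, hw⟩ := hxx
  have hfree' : ∀ y, edge (Γ \ {(a, b)}) y = edge (Γ \ {(a, b)}) x → y = x := by
    intro y hy
    rcases hcut.edge_eq_iff.1 hy with h | h
    · exact h
    · exact absurd h.symm (hfree y)
  ext e
  constructor
  · rintro ⟨y, hy, hne, rfl⟩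
    obtain ⟨⟨y', hy', e'⟩, hall⟩ := hy
    have hyT : y ∈ sidesOf T := by
      rcases hcut.edge_eq_iff.1 e' with rfl | h
      · exact hy'
      · exact hT _ _ (hsub _ _ h) hy'
    refine (hΓ.mem_matchingOf hyT).2 ⟨hall y hyT rfl, fun z hz hyz => ?_⟩
    rcases hsplit y z hyz with h | h
    · exact hall z hz (edge_eq_of_glued h).symm
    · have : z = x ∨ y = x := by
        rcases hx with rfl | rfl <;> rcases h with ⟨rfl, rfl⟩ | ⟨rfl, rfl⟩ <;> simp
      rcases this with rfl | rfl
      · exact hsel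
      · exact absurd rfl hne
  · intro he
    obtain ⟨y, hy, rfl⟩ := he.1
    have hmem : ∀ z ∈ sidesOf T, edge Γ z = edge Γ y →
        edge (Γ \ {(a, b)}) z ∈ matchingOf (Γ \ {(a, b)}) (sidesOf T) h := by
      intro z hz hzy
      refine (hcut.mem_matchingOf hz).2 ⟨he.2 z hz hzy, fun z' hz' h' => ?_⟩
      exact he.2 z' hz' ((edge_eq_of_glued (hsub _ _ h')).symm.trans hzy)
    by_cases hyx : y = x
    · subst hyx
      refine ⟨w, hmem w (hT _ _ hw hy) (edge_eq_of_glued hw).symm, fun e' => ?_,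
        (edge_eq_of_glued hw).symm⟩
      obtain rfl := hfree' w e'
      exact hΓ.irrefl _ hw
    · exact ⟨y, hmem y hy rfl, fun e' => hyx (hfree' y e'), rfl⟩

theorem isGoodMatching_iff (hΓ : Tame Γ) {T : Set ℕ}
    (hT : ∀ x y, Glued Γ x y → x.1 ∈ T → y.1 ∈ T) (hne : Γ.Nonempty)
    (hΓT : ∀ a b, (a, b) ∈ Γ → a.1 ∈ T)
    (hanti : ∀ a b, (a, b) ∈ Γ → (b, a) ∉ Γ)
    (hcut : ∀ a b, (a, b) ∈ Γ → Tame (Γ \ {(a, b)}) ∧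
      ∀ Q, IsPerfectMatching (sideGraph (Γ \ {(a, b)}) (sidesOf T)) Q ↔
        ∃ h, Valid (Γ \ {(a, b)}) (sidesOf T) h ∧ Q = matchingOf (Γ \ {(a, b)}) (sidesOf T) h)
    {P : Set (Edge Γ)} :
    IsGoodMatching Γ T P ↔ ∃ h, Valid Γ (sidesOf T) h ∧ P = matchingOf Γ (sidesOf T) h := by
  constructor
  · rintro ⟨-, a, b, hab, Q, hQ, x, hx, hxQ, rfl⟩
    obtain ⟨hc1, hc2⟩ := hcut a b hab
    obtain ⟨h, hv, rfl⟩ := (hc2 Q).1 hQ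
    have haT : a ∈ sidesOf T := hΓT a b hab
    have hbT : b ∈ sidesOf T := hT a b (Or.inl hab) haT
    have hxT : x ∈ sidesOf T := by rcases hx with rfl | rfl <;> assumption
    have hsel : Sel h x := ((hc1.mem_matchingOf hxT).1 hxQ).1
    refine ⟨h, fun y hy z hz hyz => ?_, hΓ.remove_copy hT hc1 hab (hanti a b hab) hx hsel⟩
    by_cases e : Glued (Γ \ {(a, b)}) y z
    · exact hv y hy z hz e
    · have : (y = a ∧ z = b) ∨ (y = b ∧ z = a) := by
        rcases hyz with h | h
        · by_contra! H
          exact e (Or.inl ⟨h, fun h' => H.1 (Prod.mk.inj h').1 (Prod.mk.inj h').2⟩)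
        · by_contra! H
          exact e (Or.inr ⟨h, fun h' => H.2 (Prod.mk.inj h').2 (Prod.mk.inj h').1⟩)
      rcases hx with rfl | rfl <;> rcases this with ⟨rfl, rfl⟩ | ⟨rfl, rfl⟩ <;> simp [hsel]
  · rintro ⟨h, hv, rfl⟩
    refine ⟨hΓ.isPerfectMatching_matchingOf hT hv, ?_⟩
    obtain ⟨⟨a, b⟩, hab⟩ := hne
    obtain ⟨hc1, hc2⟩ := hcut a b hab
    have haT : a ∈ sidesOf T := hΓT a b hab
    have hbT : b ∈ sidesOf T := hT a b (Or.inl hab) haT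
    have hga : Glued Γ a b := Or.inl hab
    have hsub : ∀ y z, Glued (Γ \ {(a, b)}) y z → Glued Γ y z :=
      fun y z h => h.imp (fun h => h.1) fun h => h.1
    refine ⟨a, b, hab, _, (hc2 _).2
      ⟨h, fun y hy z hz hyz => hv y hy z hz (hsub _ _ hyz), rfl⟩, ?_⟩
    have key : ∀ x, (x = a ∨ x = b) → Sel h x → ∃ x : TileSide, (x = a ∨ x = b) ∧
        edge (Γ \ {(a, b)}) x ∈ matchingOf (Γ \ {(a, b)}) (sidesOf T) h ∧
        matchingOf Γ (sidesOf T) h = {e | ∃ y : TileSide,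
          edge (Γ \ {(a, b)}) y ∈ matchingOf (Γ \ {(a, b)}) (sidesOf T) h ∧
          edge (Γ \ {(a, b)}) y ≠ edge (Γ \ {(a, b)}) x ∧ edge Γ y = e} := by
      intro x hx hsel
      have hxT : x ∈ sidesOf T := by rcases hx with rfl | rfl <;> assumption
      refine ⟨x, hx, (hc1.mem_matchingOf hxT).2 ⟨hsel, fun y _ hy => ?_⟩,
        (hΓ.remove_copy hT hc1 hab (hanti a b hab) hx hsel).symm⟩
      exfalso
      rcases hx with rfl | rfl
      · obtain rfl := hΓ.unique (hsub _ _ hy) hga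
        rcases hy with hy | hy
        · exact hy.2 rfl
        · exact hanti _ _ hab hy.1
      · obtain rfl := hΓ.unique (hsub _ _ hy) hga.symm
        rcases hy with hy | hy
        · exact hanti _ _ hab hy.1
        · exact hy.2 rfl
    rcases hv a haT b hbT hga with hs | hs
    · exact key a (Or.inl rfl) hs
    · exact key b (Or.inr rfl) hs

end Band

/-! ### The snake and band graphs of the resolution -/

namespace SnakeGraph

variable (G : SnakeGraph)

theorem tip_exit (i : ℕ) : (G.exit i).tip = .ne := by
  unfold exit; split_ifs <;> rfl

theorem tip_exitBdry (i : ℕ) : (G.exitBdry i).tip = .ne := by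
  unfold exitBdry; split_ifs <;> rfl

theorem tip_entry (i : ℕ) : (G.entry i).tip = .sw := by
  unfold entry; split_ifs <;> rfl

theorem tip_entryBdry (i : ℕ) : (G.entryBdry i).tip = .sw := by
  unfold entryBdry; split_ifs <;> rfl

theorem tipMate_exit (i : ℕ) : tipMate (i, G.exit i) = (i, G.exitBdry i) := by
  unfold exit exitBdry; split_ifs <;> rfl

theorem tipMate_exitBdry (i : ℕ) : tipMate (i, G.exitBdry i) = (i, G.exit i) := by
  unfold exit exitBdry; split_ifs <;> rfl

theorem tipMate_entry (i : ℕ) : tipMate (i, G.entry i) = (i, G.entryBdry i) := by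
  unfold entry entryBdry; split_ifs <;> rfl

theorem tipMate_entryBdry (i : ℕ) : tipMate (i, G.entryBdry i) = (i, G.entry i) := by
  unfold entry entryBdry; split_ifs <;> rfl

theorem glued_gluing {x y : TileSide} : Glued G.gluing x y ↔ ∃ i, 1 ≤ i ∧ i < G.d ∧
    ((x = (i, G.exit i) ∧ y = (i + 1, G.entry (i + 1))) ∨
      (x = (i + 1, G.entry (i + 1)) ∧ y = (i, G.exit i))) := by
  constructor
  · rintro (⟨i, h1, h2, h⟩ | ⟨i, h1, h2, h⟩)
    · exact ⟨i, h1, h2, Or.inl (Prod.mk.inj h)⟩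
    · exact ⟨i, h1, h2, Or.inr (Prod.mk.inj h).symm⟩
  · rintro ⟨i, h1, h2, ⟨rfl, rfl⟩ | ⟨rfl, rfl⟩⟩
    · exact Or.inl ⟨i, h1, h2, rfl⟩
    · exact Or.inr ⟨i, h1, h2, rfl⟩

theorem glued_inner {i : ℕ} (h1 : 1 ≤ i) (h2 : i < G.d) :
    Glued G.gluing (i, G.exit i) (i + 1, G.entry (i + 1)) :=
  G.glued_gluing.2 ⟨i, h1, h2, Or.inl ⟨rfl, rfl⟩⟩

theorem arcs : Arcs G.gluing G.entry G.exit (fun j k => 1 ≤ j ∧ j < G.d ∧ k = j + 1) where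
  glued_iff x y := by
    rw [glued_gluing]
    constructor
    · rintro ⟨i, h1, h2, h⟩
      exact ⟨i, i + 1, ⟨h1, h2, rfl⟩, h⟩
    · rintro ⟨i, _, ⟨h1, h2, rfl⟩, h⟩
      exact ⟨i, h1, h2, h⟩
  tip_ne k := by rw [tip_entry, tip_exit]; simp
  right_unique h h' := by omega
  left_unique h h' := by omega

theorem tame : Tame G.gluing := G.arcs.tame

theorem mem_Match {P : Set (Edge G.gluing)} : P ∈ G.Match ↔
    ∃ h, Valid G.gluing (sidesOf G.tiles) h ∧ P = matchingOf G.gluing (sidesOf G.tiles) h := by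
  refine G.arcs.isPerfectMatching_iff id (fun j k h => by simp only [id]; omega) ?_
  rintro i j k ⟨h1, h2, h3⟩ ⟨h4, h5, h6⟩ _ _
  constructor <;> omega

namespace OppositeOverlap

variable {G} (o : G.OppositeOverlap)

theorem one_le_s : 1 ≤ o.s := o.iso.1

theorem s_le_t : o.s ≤ o.t := o.iso.2.1

theorem s'_le_t' : o.s' ≤ o.t' := o.iso.2.2.2.2.1

theorem t'_le_d : o.t' ≤ G.d := o.iso.2.2.2.2.2.1

theorem s_add_t' : o.s + o.t' = o.t + o.s' := o.iso.2.2.2.2.2.2.1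

/-- The side along which a tile of `G₃₄` is glued to its predecessor. On the middle piece, which is
traversed backwards, exits and entries change their roles. -/
def inn34 (k : ℕ) : Side :=
  if o.t < k ∧ k < o.s' then G.exit k else if k = o.s' then G.entryBdry k else G.entry k

/-- The side along which a tile of `G₃₄` is glued to its successor. -/
def out34 (k : ℕ) : Side :=
  if o.t < k ∧ k < o.s' then G.entry k else if k = o.t then G.exitBdry k else G.exit k

/-- The order of the tiles in `G₃₄`, where the middle piece is traversed backwards. -/
def Next34 (j k : ℕ) : Prop :=
  (1 ≤ j ∧ j < G.d ∧ k = j + 1 ∧ (j < o.t ∨ o.s' ≤ j)) ∨ (j = o.t ∧ k + 1 = o.s') ∨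
    (o.t < k ∧ k + 1 = j ∧ j < o.s') ∨ (j = o.t + 1 ∧ k = o.s')

theorem glued_gluing34 {x y : TileSide} : Glued o.gluing34 x y ↔
    (∃ i, 1 ≤ i ∧ i < G.d ∧ i ≠ o.t ∧ i ≠ o.s' - 1 ∧
      ((x = (i, G.exit i) ∧ y = (i + 1, G.entry (i + 1))) ∨
        (x = (i + 1, G.entry (i + 1)) ∧ y = (i, G.exit i)))) ∨
    (x = (o.t, G.exitBdry o.t) ∧ y = (o.s' - 1, G.exit (o.s' - 1))) ∨
    (x = (o.s' - 1, G.exit (o.s' - 1)) ∧ y = (o.t, G.exitBdry o.t)) ∨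
    (x = (o.t + 1, G.entry (o.t + 1)) ∧ y = (o.s', G.entryBdry o.s')) ∨
    (x = (o.s', G.entryBdry o.s') ∧ y = (o.t + 1, G.entry (o.t + 1))) := by
  constructor
  · rintro ((⟨i, h1, h2, h3, h4, h⟩ | h | h) | (⟨i, h1, h2, h3, h4, h⟩ | h | h))
    · exact Or.inl ⟨i, h1, h2, h3, h4, Or.inl (Prod.mk.inj h)⟩
    · exact Or.inr (Or.inl (Prod.mk.inj h))
    · exact Or.inr (Or.inr (Or.inr (Or.inl (Prod.mk.inj h))))
    · exact Or.inl ⟨i, h1, h2, h3, h4, Or.inr (Prod.mk.inj h).symm⟩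
    · exact Or.inr (Or.inr (Or.inl (Prod.mk.inj h).symm))
    · exact Or.inr (Or.inr (Or.inr (Or.inr (Prod.mk.inj h).symm)))
  · rintro (⟨i, h1, h2, h3, h4, ⟨rfl, rfl⟩ | ⟨rfl, rfl⟩⟩ | ⟨rfl, rfl⟩ | ⟨rfl, rfl⟩ | ⟨rfl, rfl⟩ |
      ⟨rfl, rfl⟩)
    · exact Or.inl (Or.inl ⟨i, h1, h2, h3, h4, rfl⟩)
    · exact Or.inr (Or.inl ⟨i, h1, h2, h3, h4, rfl⟩)
    · exact Or.inl (Or.inr (Or.inl rfl))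
    · exact Or.inr (Or.inr (Or.inl rfl))
    · exact Or.inl (Or.inr (Or.inr rfl))
    · exact Or.inr (Or.inr (Or.inr rfl))

theorem arcs34 (hband : o.t + 1 < o.s') : Arcs o.gluing34 o.inn34 o.out34 o.Next34 where
  glued_iff x y := by
    have h0 := o.one_le_s
    have h1 := o.s_le_t
    have h2 := o.s'_le_t'
    have h3 := o.t'_le_d
    have eout : ∀ k, (k < o.t ∨ o.s' ≤ k) → o.out34 k = G.exit k := fun k hk => by
      unfold out34; rw [if_neg (by omega), if_neg (by omega)]
    have einn : ∀ k, (k ≤ o.t ∨ o.s' < k) → o.inn34 k = G.entry k := fun k hk => by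
      unfold inn34; rw [if_neg (by omega), if_neg (by omega)]
    have mout : ∀ k, o.t < k → k < o.s' → o.out34 k = G.entry k := fun k hk hk' => by
      unfold out34; rw [if_pos ⟨hk, hk'⟩]
    have minn : ∀ k, o.t < k → k < o.s' → o.inn34 k = G.exit k := fun k hk hk' => by
      unfold inn34; rw [if_pos ⟨hk, hk'⟩]
    have tout : o.out34 o.t = G.exitBdry o.t := by
      unfold out34; rw [if_neg (by omega), if_pos rfl]
    have sinn : o.inn34 o.s' = G.entryBdry o.s' := by
      unfold inn34; rw [if_neg (by omega), if_pos rfl]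
    have hmid : o.inn34 (o.s' - 1) = G.exit (o.s' - 1) := minn _ (by omega) (by omega)
    have hmid' : o.out34 (o.t + 1) = G.entry (o.t + 1) := mout _ (by omega) (by omega)
    rw [glued_gluing34]
    constructor
    · rintro (⟨i, hi1, hi2, hi3, hi4, h⟩ | ⟨rfl, rfl⟩ | ⟨rfl, rfl⟩ | ⟨rfl, rfl⟩ | ⟨rfl, rfl⟩)
      · by_cases hm : o.t < i ∧ i < o.s'
        · refine ⟨i + 1, i, Or.inr (Or.inr (Or.inl ⟨hm.1, rfl, by omega⟩)), ?_⟩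
          rw [mout (i + 1) (by omega) (by omega), minn i hm.1 hm.2]
          rcases h with ⟨rfl, rfl⟩ | ⟨rfl, rfl⟩
          · exact Or.inr ⟨rfl, rfl⟩
          · exact Or.inl ⟨rfl, rfl⟩
        · refine ⟨i, i + 1, Or.inl ⟨hi1, hi2, rfl, by omega⟩, ?_⟩
          rw [eout i (by omega), einn (i + 1) (by omega)]
          exact h
      · exact ⟨o.t, o.s' - 1, Or.inr (Or.inl ⟨rfl, by omega⟩), Or.inl ⟨by rw [tout], by rw [hmid]⟩⟩
      · exact ⟨o.t, o.s' - 1, Or.inr (Or.inl ⟨rfl, by omega⟩), Or.inr ⟨by rw [hmid], by rw [tout]⟩⟩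
      · exact ⟨o.t + 1, o.s', Or.inr (Or.inr (Or.inr ⟨rfl, rfl⟩)),
          Or.inl ⟨by rw [hmid'], by rw [sinn]⟩⟩
      · exact ⟨o.t + 1, o.s', Or.inr (Or.inr (Or.inr ⟨rfl, rfl⟩)),
          Or.inr ⟨by rw [sinn], by rw [hmid']⟩⟩
    · rintro ⟨j, k, ⟨hj1, hj2, rfl, hj3⟩ | ⟨rfl, hk⟩ | ⟨hk, rfl, hj⟩ | ⟨rfl, rfl⟩, h⟩
      · rw [eout j hj3, einn (j + 1) (by omega)] at h
        exact Or.inl ⟨j, hj1, hj2, by omega, by omega, h⟩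
      · obtain rfl : k = o.s' - 1 := by omega
        rw [tout, hmid] at h
        rcases h with h | h
        · exact Or.inr (Or.inl h)
        · exact Or.inr (Or.inr (Or.inl h))
      · rw [mout (k + 1) (by omega) hj, minn k hk (by omega)] at h
        exact Or.inl ⟨k, by omega, by omega, by omega, by omega, h.symm⟩
      · rw [sinn, hmid'] at h
        rcases h with h | h
        · exact Or.inr (Or.inr (Or.inr (Or.inl h)))
        · exact Or.inr (Or.inr (Or.inr (Or.inr h)))
  tip_ne k := by
    unfold inn34 out34
    split_ifs <;> simp [tip_entry, tip_exit, tip_entryBdry, tip_exitBdry]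
  right_unique := by unfold Next34; intros; omega
  left_unique := by unfold Next34; intros; omega

theorem mem_Match34 (hband : o.t + 1 < o.s') {P : Set (Edge o.gluing34)} : P ∈ o.Match34 ↔
    ∃ h, Valid o.gluing34 (sidesOf G.tiles) h ∧ P = matchingOf o.gluing34 (sidesOf G.tiles) h := by
  have h0 := o.one_le_s
  have h1 := o.s_le_t
  have h2 := o.s'_le_t'
  have h3 := o.t'_le_d
  refine (o.arcs34 hband).isPerfectMatching_iff
    (fun k => if o.t < k ∧ k < o.s' then o.t + o.s' - k else k) (fun j k h => ?_) ?_
  · unfold Next34 at h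
    split_ifs <;> omega
  · rintro i j k h h' hi hk
    simp only [tiles, Set.mem_Icc] at hi hk ⊢
    unfold Next34 at h h'
    omega

/-- The side along which a tile of `G₅'` is glued to its predecessor. -/
def inn5 (k : ℕ) : Side := if k = o.t' + 1 then G.entryBdry k else G.entry k

/-- The side along which a tile of `G₅'` is glued to its successor. -/
def out5 (k : ℕ) : Side := if k + 1 = o.s then G.exitBdry k else G.exit k

/-- The tile `k` follows the tile `j` in `G₅'`. -/
def Next5 (j k : ℕ) : Prop :=
  (1 ≤ j ∧ j < G.d ∧ k = j + 1 ∧ (j + 1 < o.s ∨ o.t' < j)) ∨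
    (1 < o.s ∧ o.t' < G.d ∧ j + 1 = o.s ∧ k = o.t' + 1)

theorem arcs5 : Arcs o.gluing5 o.inn5 o.out5 o.Next5 where
  glued_iff x y := by
    have h0 := o.one_le_s
    have h1 := o.s_le_t
    have h2 := o.s'_le_t'
    have hst := o.lt
    have hg : ∀ i, (i + 1 < o.s ∨ o.t' < i) →
        ((i, o.out5 i) : TileSide) = (i, G.exit i) ∧
          ((i + 1, o.inn5 (i + 1)) : TileSide) = (i + 1, G.entry (i + 1)) := by
      intro i hi
      unfold out5 inn5
      rw [if_neg (by omega), if_neg (by omega)]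
      exact ⟨rfl, rfl⟩
    have hx : 1 < o.s → ((o.s - 1, o.out5 (o.s - 1)) : TileSide) = (o.s - 1, G.exitBdry (o.s - 1)) := by
      intro h
      unfold out5
      rw [if_pos (by omega)]
    have hy : ((o.t' + 1, o.inn5 (o.t' + 1)) : TileSide) = (o.t' + 1, G.entryBdry (o.t' + 1)) := by
      unfold inn5
      rw [if_pos rfl]
    have hmem : ∀ x y : TileSide, (x, y) ∈ o.gluing5 ↔
        ∃ j k, o.Next5 j k ∧ (x = (j, o.out5 j) ∧ y = (k, o.inn5 k)) := by
      intro x y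
      constructor
      · rintro (⟨i, h1, h2, h3, h⟩ | ⟨h1, h2, h⟩)
        · obtain ⟨e1, e2⟩ := hg i h3
          exact ⟨i, i + 1, Or.inl ⟨h1, h2, rfl, h3⟩, by rw [e1, e2]; exact Prod.mk.inj h⟩
        · refine ⟨o.s - 1, o.t' + 1, Or.inr ⟨h1, h2, by omega, rfl⟩, ?_⟩
          rw [hx h1, hy]
          exact Prod.mk.inj h
      · rintro ⟨j, k, ⟨h1, h2, rfl, h3⟩ | ⟨h1, h2, h3, rfl⟩, rfl, rfl⟩
        · obtain ⟨e1, e2⟩ := hg j h3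
          rw [e1, e2]
          exact Or.inl ⟨j, h1, h2, h3, rfl⟩
        · obtain rfl : j = o.s - 1 := by omega
          rw [hx h1, hy]
          exact Or.inr ⟨h1, h2, rfl⟩
    unfold Glued
    rw [hmem, hmem]
    constructor
    · rintro (⟨j, k, h, h'⟩ | ⟨j, k, h, h'⟩)
      · exact ⟨j, k, h, Or.inl h'⟩
      · exact ⟨j, k, h, Or.inr h'.symm⟩
    · rintro ⟨j, k, h, h' | h'⟩
      · exact Or.inl ⟨j, k, h, h'⟩
      · exact Or.inr ⟨j, k, h, h'.symm⟩
  tip_ne k := by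
    unfold inn5 out5
    split_ifs <;> simp [tip_entry, tip_exit, tip_entryBdry, tip_exitBdry]
  right_unique := by
    have := o.s_le_t; have := o.s'_le_t'; have := o.lt
    unfold Next5; intros; omega
  left_unique := by
    have := o.s_le_t; have := o.s'_le_t'; have := o.lt
    unfold Next5; intros; omega

/-- The side along which a tile of the band graph is glued to its predecessor. -/
def inn6 (k : ℕ) : Side := if k = o.t + 1 then G.entryBdry k else G.entry k

/-- The side along which a tile of the band graph is glued to its successor. -/
def out6 (k : ℕ) : Side := if k + 1 = o.s' then G.exitBdry k else G.exit k

/-- The tile `k` follows the tile `j` in the cyclic order of the band graph. -/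
def Next6 (j k : ℕ) : Prop := (o.t < j ∧ k = j + 1 ∧ k < o.s') ∨ (j + 1 = o.s' ∧ k = o.t + 1)

theorem mem_gluing6 (hband : o.t + 1 < o.s') {x y : TileSide} : (x, y) ∈ o.gluing6 ↔
    ∃ j k, o.Next6 j k ∧ (x = (j, o.out6 j) ∧ y = (k, o.inn6 k)) := by
  have hg : ∀ i, o.t < i → i + 1 < o.s' →
      ((i, o.out6 i) : TileSide) = (i, G.exit i) ∧
        ((i + 1, o.inn6 (i + 1)) : TileSide) = (i + 1, G.entry (i + 1)) := by
    intro i hi hi'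
    unfold out6 inn6
    rw [if_neg (by omega), if_neg (by omega)]
    exact ⟨rfl, rfl⟩
  have hx : ((o.s' - 1, o.out6 (o.s' - 1)) : TileSide) = (o.s' - 1, G.exitBdry (o.s' - 1)) := by
    unfold out6
    rw [if_pos (by omega)]
  have hy : ((o.t + 1, o.inn6 (o.t + 1)) : TileSide) = (o.t + 1, G.entryBdry (o.t + 1)) := by
    unfold inn6
    rw [if_pos rfl]
  constructor
  · rintro (⟨i, h1, h2, h⟩ | h)
    · obtain ⟨e1, e2⟩ := hg i h1 h2
      exact ⟨i, i + 1, Or.inl ⟨h1, rfl, h2⟩, by rw [e1, e2]; exact Prod.mk.inj h⟩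
    · refine ⟨o.s' - 1, o.t + 1, Or.inr ⟨by omega, rfl⟩, ?_⟩
      rw [hx, hy]
      exact Prod.mk.inj h
  · rintro ⟨j, k, ⟨h1, rfl, h2⟩ | ⟨h1, rfl⟩, rfl, rfl⟩
    · obtain ⟨e1, e2⟩ := hg j h1 h2
      rw [e1, e2]
      exact Or.inl ⟨j, h1, h2, rfl⟩
    · obtain rfl : j = o.s' - 1 := by omega
      rw [hx, hy]
      exact Or.inr rfl

theorem tip_inn6_ne (k : ℕ) : (o.inn6 k).tip ≠ (o.out6 k).tip := by
  unfold inn6 out6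
  split_ifs <;> simp [tip_entry, tip_exit, tip_entryBdry, tip_exitBdry]

theorem arcs6 (hband : o.t + 1 < o.s') : Arcs o.gluing6 o.inn6 o.out6 o.Next6 where
  glued_iff x y := by
    unfold Glued
    rw [o.mem_gluing6 hband, o.mem_gluing6 hband]
    constructor
    · rintro (⟨j, k, h, h'⟩ | ⟨j, k, h, h'⟩)
      · exact ⟨j, k, h, Or.inl h'⟩
      · exact ⟨j, k, h, Or.inr h'.symm⟩
    · rintro ⟨j, k, h, h' | h'⟩
      · exact Or.inl ⟨j, k, h, h'⟩
      · exact Or.inr ⟨j, k, h, h'.symm⟩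
  tip_ne := o.tip_inn6_ne
  right_unique := by unfold Next6; intros; omega
  left_unique := by unfold Next6; intros; omega

theorem arcs6_cut (hband : o.t + 1 < o.s') {j₀ k₀ : ℕ} (h₀ : o.Next6 j₀ k₀) :
    Arcs (o.gluing6 \ {((j₀, o.out6 j₀), (k₀, o.inn6 k₀))}) o.inn6 o.out6
      (fun j k => o.Next6 j k ∧ j ≠ j₀) where
  glued_iff x y := by
    have hmem : ∀ x y : TileSide,
        (x, y) ∈ o.gluing6 \ {((j₀, o.out6 j₀), (k₀, o.inn6 k₀))} ↔
        ∃ j k, (o.Next6 j k ∧ j ≠ j₀) ∧ (x = (j, o.out6 j) ∧ y = (k, o.inn6 k)) := by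
      intro x y
      rw [Set.mem_sdiff, o.mem_gluing6 hband]
      constructor
      · rintro ⟨⟨j, k, h, rfl, rfl⟩, hne⟩
        refine ⟨j, k, ⟨h, ?_⟩, rfl, rfl⟩
        rintro rfl
        rw [(o.arcs6 hband).right_unique h h₀] at hne
        exact hne rfl
      · rintro ⟨j, k, ⟨h, hne⟩, rfl, rfl⟩
        refine ⟨⟨j, k, h, rfl, rfl⟩, fun e => hne ?_⟩
        exact congrArg (fun g : TileSide × TileSide => g.1.1) (Set.mem_singleton_iff.1 e)
    unfold Glued
    rw [hmem, hmem]
    constructor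
    · rintro (⟨j, k, h, h'⟩ | ⟨j, k, h, h'⟩)
      · exact ⟨j, k, h, Or.inl h'⟩
      · exact ⟨j, k, h, Or.inr h'.symm⟩
    · rintro ⟨j, k, h, h' | h'⟩
      · exact Or.inl ⟨j, k, h, h'⟩
      · exact Or.inr ⟨j, k, h, h'.symm⟩
  tip_ne := o.tip_inn6_ne
  right_unique h h' := (o.arcs6 hband).right_unique h.1 h'.1
  left_unique h h' := (o.arcs6 hband).left_unique h.1 h'.1

theorem mem_Match6 (hband : o.t + 1 < o.s') {P : Set (Edge o.gluing6)} : P ∈ o.Match6 ↔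
    ∃ h, Valid o.gluing6 (sidesOf o.tiles6) h ∧ P = matchingOf o.gluing6 (sidesOf o.tiles6) h := by
  have A := o.arcs6 hband
  refine isGoodMatching_iff A.tame ?_ ?_ ?_ ?_ ?_
  · intro x y hxy _
    obtain ⟨j, k, h, ⟨rfl, rfl⟩ | ⟨rfl, rfl⟩⟩ := (A.glued_iff _ _).1 hxy <;>
    · simp only [tiles6, Set.mem_Icc]
      unfold Next6 at h
      omega
  · exact ⟨_, Or.inr rfl⟩
  · intro a b hab
    obtain ⟨j, k, h, rfl, rfl⟩ := (o.mem_gluing6 hband).1 hab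
    simp only [tiles6, Set.mem_Icc]
    unfold Next6 at h
    omega
  · intro a b hab hba
    obtain ⟨j, k, h, rfl, rfl⟩ := (o.mem_gluing6 hband).1 hab
    obtain ⟨j', k', h', e, e'⟩ := (o.mem_gluing6 hband).1 hba
    obtain ⟨rfl, e⟩ := Prod.mk.inj e
    exact o.tip_inn6_ne k (by rw [e])
  · intro a b hab
    obtain ⟨j₀, k₀, h₀, rfl, rfl⟩ := (o.mem_gluing6 hband).1 hab
    have A' := o.arcs6_cut hband h₀
    refine ⟨A'.tame, fun Q =>
      -- Along the cut graph the tiles are ordered cyclically, starting after the cut.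
      A'.isPerfectMatching_iff (fun k => if j₀ < k then k else k + o.s') (fun j k h => ?_) ?_⟩
    · unfold Next6 at h h₀
      split_ifs <;> omega
    · rintro i j k ⟨h, -⟩ ⟨h', -⟩ - -
      simp only [tiles6, Set.mem_Icc]
      unfold Next6 at h h'
      omega

end OppositeOverlap

end SnakeGraph

/-! ### The two copies of the overlap -/

theorem Flip.side_side (σ : Flip) (a : Side) : σ.side (σ.side a) = a := by
  cases σ <;> cases a <;> rfl

theorem Flip.tipMate_side (σ : Flip) (a : Side) : (σ.side a).tipMate = σ.side a.tipMate := by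
  cases σ <;> cases a <;> rfl

/-- The action of a symmetry of the square on its two perfect matchings. -/
def Flip.matching : Flip → Bool → Bool
  | .rotation, b => b
  | .reflection, b => !b

theorem Flip.horizontal_side (σ : Flip) (a : Side) :
    (σ.side a).horizontal = σ.matching a.horizontal := by
  cases σ <;> cases a <;> rfl

theorem Flip.matching_matching (σ : Flip) (b : Bool) : σ.matching (σ.matching b) = b := by
  cases σ <;> cases b <;> rfl

namespace SnakeGraph

variable {G : SnakeGraph}

theorem flip_entry_of_flip_exit (σ : Flip) {i j : ℕ} :
    σ.side (G.exit i) = G.entry (j + 1) ↔ σ.side (G.entry (i + 1)) = G.exit j := by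
  unfold exit entry
  rw [Nat.add_sub_cancel, Nat.add_sub_cancel]
  cases σ <;> cases G.north i <;> cases G.north j <;> simp [Flip.side]

namespace OppositeOverlap

variable (o : G.OppositeOverlap)

/-- The copy of a side of `G[s,t]` in the overlap `G[s,t]` (for `false`) or `G[s',t']`
(for `true`). -/
def emb (c : Bool) (y : TileSide) : TileSide := if c then o.flip y else y

@[simp] theorem emb_false (y : TileSide) : o.emb false y = y := rfl

@[simp] theorem emb_true (y : TileSide) : o.emb true y = o.flip y := rfl

theorem tipMate_emb (c : Bool) (y : TileSide) : tipMate (o.emb c y) = o.emb c (tipMate y) := by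
  cases c
  · rfl
  · simp only [emb_true, flip, tipMate, Flip.tipMate_side]

theorem flip_flip {x : TileSide} (hx : x.1 ≤ o.s + o.t') : o.flip (o.flip x) = x := by
  rcases x with ⟨k, a⟩
  simp only [flip, Flip.side_side]
  congr 1
  dsimp only at hx
  omega

theorem emb_mem_tiles (c : Bool) {y : TileSide} (hy : y.1 ∈ Set.Icc o.s o.t) :
    (o.emb c y).1 ∈ G.tiles := by
  have h0 := o.one_le_s; have h1 := o.s_le_t; have h2 := o.s'_le_t'; have h3 := o.t'_le_d
  have h4 := o.s_add_t'; have h5 := o.lt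
  simp only [Set.mem_Icc] at hy
  cases c
  · simp only [emb_false, tiles, Set.mem_Icc]
    omega
  · simp only [emb_true, flip, tiles, Set.mem_Icc]
    omega

theorem flip_fst_mem {y : TileSide} (hy : y.1 ∈ Set.Icc o.s o.t) :
    (o.flip y).1 ∈ Set.Icc o.s' o.t' := by
  have h1 := o.s_le_t; have h2 := o.s'_le_t'; have h4 := o.s_add_t'
  simp only [Set.mem_Icc, flip] at hy ⊢
  omega

theorem flip_fst_mem' {y : TileSide} (hy : y.1 ∈ Set.Icc o.s' o.t') :
    (o.flip y).1 ∈ Set.Icc o.s o.t := by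
  have h1 := o.s_le_t; have h2 := o.s'_le_t'; have h4 := o.s_add_t'
  simp only [Set.mem_Icc, flip] at hy ⊢
  omega

theorem emb_fst_mem (c : Bool) {y : TileSide} (hy : y.1 ∈ Set.Icc o.s o.t) :
    (o.emb c y).1 ∈ Set.Icc o.s o.t ∪ Set.Icc o.s' o.t' := by
  cases c
  · exact Or.inl hy
  · exact Or.inr (o.flip_fst_mem hy)

theorem exists_emb {x : TileSide} (hx : x.1 ∈ Set.Icc o.s o.t ∪ Set.Icc o.s' o.t') :
    ∃ c, ∃ y : TileSide, y.1 ∈ Set.Icc o.s o.t ∧ x = o.emb c y := by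
  rcases hx with hx | hx
  · exact ⟨false, x, hx, rfl⟩
  · have h2 := o.s'_le_t'
    refine ⟨true, o.flip x, o.flip_fst_mem' hx, (o.flip_flip ?_).symm⟩
    simp only [Set.mem_Icc] at hx
    omega

theorem emb_inj (hband : o.t + 1 < o.s') {c c' : Bool} {y y' : TileSide}
    (hy : y.1 ∈ Set.Icc o.s o.t) (hy' : y'.1 ∈ Set.Icc o.s o.t) (e : o.emb c y = o.emb c' y') :
    c = c' ∧ y = y' := by
  have h2 := o.s'_le_t'
  have key : ∀ z z' : TileSide, z.1 ∈ Set.Icc o.s o.t → z'.1 ∈ Set.Icc o.s o.t →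
      z ≠ o.flip z' := by
    intro z z' hz hz' h
    have := o.flip_fst_mem hz'
    rw [← h] at this
    simp only [Set.mem_Icc] at hz this
    omega
  cases c <;> cases c'
  · exact ⟨rfl, e⟩
  · exact absurd e (key _ _ hy hy')
  · exact absurd e.symm (key _ _ hy' hy)
  · refine ⟨rfl, ?_⟩
    have h1 := o.s_add_t'
    simp only [Set.mem_Icc] at hy hy'
    have e' := congrArg o.flip e
    rwa [emb_true, emb_true, o.flip_flip (by omega), o.flip_flip (by omega)] at e'

/-- The overlap is adjacent to a further tile at the end of a given copy that corresponds to the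
beginning of `G[s,t]`. -/
def HasOuter (c : Bool) : Prop := if c then o.t' < G.d else 1 < o.s

/-- The side of that further tile that is glued to the given copy of the overlap. -/
def outer (c : Bool) : TileSide :=
  if c then (o.t' + 1, G.entry (o.t' + 1)) else (o.s - 1, G.exit (o.s - 1))

/-- The side of `G_s` along which the given copy of the overlap is glued to `outer`. -/
def outerSide (c : Bool) : Side := if c then o.σ.side (G.exit o.t') else G.entry o.s

/-- The side of `G_t` along which the given copy of the overlap is glued in `G` to the
middle piece `G[t+1,s'-1]`. -/
def innerSide (c : Bool) : Side := if c then G.exitBdry o.t else G.exit o.t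

/-- The side of the middle piece that is glued in `G` to the given copy of the overlap. -/
def middle (c : Bool) : TileSide :=
  if c then (o.s' - 1, G.exit (o.s' - 1)) else (o.t + 1, G.entry (o.t + 1))

theorem tip_outerSide (c : Bool) : (o.outerSide c).tip = .sw := by
  cases c
  · exact G.tip_entry _
  · simp [outerSide, Flip.tip_side, tip_exit, Flip.corner]

theorem tip_innerSide (c : Bool) : (o.innerSide c).tip = .ne := by
  cases c
  · exact G.tip_exit _
  · exact G.tip_exitBdry _

theorem tipMate_innerSide (c : Bool) : tipMate (o.t, o.innerSide c) = (o.t, o.innerSide (!c)) := by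
  cases c
  · exact G.tipMate_exit _
  · exact G.tipMate_exitBdry _

/-- The overlap cannot be extended towards the middle piece. -/
theorem flip_exit_ne (hband : o.t + 1 < o.s') : o.σ.side (G.exit o.t) ≠ G.entry o.s' := by
  intro h
  have h0 := o.one_le_s; have h1 := o.s_le_t; have h2 := o.s'_le_t'; have h3 := o.t'_le_d
  have h4 := o.s_add_t'
  have hs : o.s' - 1 + 1 = o.s' := by omega
  have h' : o.σ.side (G.entry (o.t + 1)) = G.exit (o.s' - 1) := by
    rw [← flip_entry_of_flip_exit, hs]
    exact h
  have := o.maximal o.s (o.t + 1) (o.s' - 1) o.t' le_rfl (by omega) (by omega) le_rfl rfl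
    ⟨h0, by omega, by omega, by omega, by omega, h3, by omega, ?_⟩
  · omega
  · intro k hk hk'
    rcases Nat.lt_succ_iff_lt_or_eq.1 hk' with hk' | rfl
    · exact o.iso.2.2.2.2.2.2.2 k hk hk'
    · have e1 : o.s + o.t' - o.t = o.s' := by omega
      have e2 : o.s + o.t' - (o.t + 1) = o.s' - 1 := by omega
      rw [e1, e2]
      exact ⟨h, h'⟩

theorem flip_exit_t (hband : o.t + 1 < o.s') : o.flip (o.t, G.exit o.t) = (o.s', G.entryBdry o.s') := by
  have h4 := o.s_add_t'
  have e1 : o.s + o.t' - o.t = o.s' := by omega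
  have h := o.flip_exit_ne hband
  have htip : tipCorner (o.flip (o.t, G.exit o.t)) = tipCorner (o.s', G.entry o.s') := by
    simp [tipCorner, flip, e1, Flip.tip_side, tip_exit, tip_entry, Flip.corner]
  rcases tipCorner_eq_iff.1 htip with h' | h'
  · exact absurd (Prod.mk.inj h').2 h
  · rw [h', tipMate_entry]

theorem flip_exitBdry_t (hband : o.t + 1 < o.s') :
    o.flip (o.t, G.exitBdry o.t) = (o.s', G.entry o.s') := by
  rw [← tipMate_exit, ← emb_true, ← tipMate_emb, emb_true, o.flip_exit_t hband, tipMate_entryBdry]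

/-- The overlap cannot be extended outwards at both ends. -/
theorem outerSide_ne (h0 : o.HasOuter false) (h1 : o.HasOuter true) :
    o.outerSide true ≠ o.outerSide false := by
  change 1 < o.s at h0
  change o.t' < G.d at h1
  intro h
  have h' : o.σ.side (G.entry o.s) = G.exit o.t' := by
    rw [← o.σ.side_side (G.exit o.t')]
    exact congrArg o.σ.side h.symm
  have hs1 := o.s_le_t; have hs2 := o.s'_le_t'
  have h4 := o.s_add_t'; have h5 := o.lt
  have hs : o.s - 1 + 1 = o.s := by omega
  have h'' : o.σ.side (G.exit (o.s - 1)) = G.entry (o.t' + 1) := by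
    rw [flip_entry_of_flip_exit, hs]
    exact h'
  have := o.maximal (o.s - 1) o.t o.s' (o.t' + 1) (by omega) le_rfl le_rfl (by omega) (by omega)
    ⟨by omega, by omega, by omega, by omega, by omega, by omega, by omega, ?_⟩
  · omega
  · intro k hk hk'
    have e : o.s - 1 + (o.t' + 1) = o.s + o.t' := by omega
    rw [e]
    by_cases hks : o.s ≤ k
    · exact o.iso.2.2.2.2.2.2.2 k hks hk'
    · obtain rfl : k = o.s - 1 := by omega
      have e1 : o.s + o.t' - (o.s - 1) = o.t' + 1 := by omega
      have e2 : o.s + o.t' - (o.s - 1 + 1) = o.t' := by omega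
      rw [e1, e2, hs]
      exact ⟨h'', h'⟩

theorem tipMate_outerSide (h : ∀ c, o.HasOuter c) (c : Bool) :
    tipMate (o.s, o.outerSide c) = (o.s, o.outerSide (!c)) := by
  have hne := o.outerSide_ne (h _) (h _)
  have htip : tipCorner (o.s, o.outerSide (!c)) = tipCorner (o.s, o.outerSide c) := by
    simp [tipCorner, tip_outerSide]
  rcases tipCorner_eq_iff.1 htip with h' | h'
  · have := (Prod.mk.inj h').2
    cases c
    · exact absurd this hne
    · exact absurd this.symm hne
  · exact h'.symm

theorem flip_exit {k : ℕ} (h1 : o.s ≤ k) (h2 : k < o.t) :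
    o.flip (k, G.exit k) = (o.s + o.t' - (k + 1) + 1, G.entry (o.s + o.t' - (k + 1) + 1)) := by
  have hs1 := o.s_le_t; have h4 := o.s_add_t'
  have e : o.s + o.t' - (k + 1) + 1 = o.s + o.t' - k := by omega
  rw [e]
  simp only [flip]
  rw [(o.iso.2.2.2.2.2.2.2 k h1 h2).1]

theorem flip_entry {k : ℕ} (h1 : o.s ≤ k) (h2 : k < o.t) :
    o.flip (k + 1, G.entry (k + 1)) = (o.s + o.t' - (k + 1), G.exit (o.s + o.t' - (k + 1))) := by
  simp only [flip]
  rw [(o.iso.2.2.2.2.2.2.2 k h1 h2).2]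

/-- The interior edges of `G`, other than the two edges between the overlaps and the
middle piece. -/
def Common (x y : TileSide) : Prop := ∃ i, 1 ≤ i ∧ i < G.d ∧ i ≠ o.t ∧ i ≠ o.s' - 1 ∧
  ((x = (i, G.exit i) ∧ y = (i + 1, G.entry (i + 1))) ∨
    (x = (i + 1, G.entry (i + 1)) ∧ y = (i, G.exit i)))

/-- What `G` and `G₃₄` have in common. In both graphs there are two copies of the overlap,
which are glued to the rest outside and to the two ends `m` of the middle piece along sides `b`
of (the two copies of) the last tile of the overlap. The graphs differ only in that the two copies
exchange their ends `m` and their sides `b`. -/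
structure Strands (Γ : Gluing) (b : Bool → Side) (m : Bool → TileSide) : Prop where
  isPerfectMatching_iff : ∀ P, IsPerfectMatching (sideGraph Γ (sidesOf G.tiles)) P ↔
    ∃ h, Valid Γ (sidesOf G.tiles) h ∧ P = matchingOf Γ (sidesOf G.tiles) h
  tame : Tame Γ
  glued_iff : ∀ x y, Glued Γ x y ↔ o.Common x y ∨
    ∃ c, (x = o.emb c (o.t, b c) ∧ y = m c) ∨ (x = m c ∧ y = o.emb c (o.t, b c))
  tipMate_side : ∀ c, tipMate (o.t, b c) = (o.t, b (!c))
  tip_side : ∀ c, (b c).tip = .ne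
  lt_middle : ∀ c, o.t < (m c).1
  middle_lt : ∀ c, (m c).1 < o.s'

theorem lt_middle (hband : o.t + 1 < o.s') (c : Bool) : o.t < (o.middle c).1 := by
  cases c
  · exact Nat.lt_succ_self _
  · exact Nat.lt_sub_of_add_lt hband

theorem middle_lt (hband : o.t + 1 < o.s') (c : Bool) : (o.middle c).1 < o.s' := by
  cases c
  · exact hband
  · exact Nat.sub_lt (by omega) one_pos

theorem strands (hband : o.t + 1 < o.s') : o.Strands G.gluing o.innerSide o.middle where
  isPerfectMatching_iff P := G.mem_Match (P := P)
  tame := G.tame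
  glued_iff x y := by
    have h0 := o.one_le_s; have h1 := o.s_le_t; have h2 := o.s'_le_t'; have h3 := o.t'_le_d
    have e1 : o.emb false (o.t, o.innerSide false) = (o.t, G.exit o.t) := rfl
    have hs : o.s' - 1 + 1 = o.s' := by omega
    have e2 : o.emb true (o.t, o.innerSide true) = (o.s' - 1 + 1, G.entry (o.s' - 1 + 1)) := by
      rw [hs]
      exact o.flip_exitBdry_t hband
    rw [glued_gluing]
    constructor
    · rintro ⟨i, hi1, hi2, h⟩
      by_cases hit : i = o.t
      · subst hit
        exact Or.inr ⟨false, h.imp (fun h => ⟨by rw [e1, h.1], h.2⟩) fun h => ⟨h.1, by rw [e1, h.2]⟩⟩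
      by_cases his : i = o.s' - 1
      · subst his
        exact Or.inr ⟨true, h.symm.imp (fun h => ⟨by rw [e2, h.1], h.2⟩)
          fun h => ⟨h.1, by rw [e2, h.2]⟩⟩
      · exact Or.inl ⟨i, hi1, hi2, hit, his, h⟩
    · rintro (⟨i, hi1, hi2, -, -, h⟩ | ⟨_ | _, h⟩)
      · exact ⟨i, hi1, hi2, h⟩
      · rw [e1] at h
        exact ⟨o.t, by omega, by omega, h⟩
      · rw [e2] at h
        exact ⟨o.s' - 1, by omega, by omega, h.symm⟩
  tipMate_side := o.tipMate_innerSide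
  tip_side := o.tip_innerSide
  lt_middle := o.lt_middle hband
  middle_lt := o.middle_lt hband

theorem strands34 (hband : o.t + 1 < o.s') :
    o.Strands o.gluing34 (fun c => o.innerSide (!c)) (fun c => o.middle (!c)) where
  isPerfectMatching_iff P := o.mem_Match34 hband (P := P)
  tame := (o.arcs34 hband).tame
  glued_iff x y := by
    have e1 : o.emb false (o.t, o.innerSide (!false)) = (o.t, G.exitBdry o.t) := rfl
    have e2 : o.emb true (o.t, o.innerSide (!true)) = (o.s', G.entryBdry o.s') :=
      o.flip_exit_t hband
    rw [glued_gluing34]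
    refine or_congr Iff.rfl ?_
    rw [Bool.exists_bool]
    rw [e1, e2]
    simp only [middle, Bool.not_false, Bool.not_true, if_true, Bool.false_eq_true, if_false]
    tauto
  tipMate_side c := o.tipMate_innerSide _
  tip_side c := o.tip_innerSide _
  lt_middle c := o.lt_middle hband _
  middle_lt c := o.middle_lt hband _

namespace Strands

variable {o} {Γ : Gluing} {b : Bool → Side} {m : Bool → TileSide}

theorem glued_middle (S : o.Strands Γ b m) (c : Bool) : Glued Γ (o.emb c (o.t, b c)) (m c) :=
  (S.glued_iff _ _).2 (Or.inr ⟨c, Or.inl ⟨rfl, rfl⟩⟩)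

theorem glued_exit (S : o.Strands Γ b m) (hband : o.t + 1 < o.s') (c : Bool) {k : ℕ}
    (h1 : o.s ≤ k) (h2 : k < o.t) :
    Glued Γ (o.emb c (k, G.exit k)) (o.emb c (k + 1, G.entry (k + 1))) := by
  have hs0 := o.one_le_s; have hs1 := o.s_le_t; have hs2 := o.s'_le_t'; have hs3 := o.t'_le_d
  have hs4 := o.s_add_t'
  refine (S.glued_iff _ _).2 (Or.inl ?_)
  cases c
  · exact ⟨k, by omega, by omega, by omega, by omega, Or.inl ⟨rfl, rfl⟩⟩
  · exact ⟨o.s + o.t' - (k + 1), by omega, by omega, by omega, by omega,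
      Or.inr ⟨o.flip_exit h1 h2, o.flip_entry h1 h2⟩⟩

theorem glued_outer (S : o.Strands Γ b m) (hband : o.t + 1 < o.s') {c : Bool}
    (hc : o.HasOuter c) : Glued Γ (o.emb c (o.s, o.outerSide c)) (o.outer c) := by
  have hs0 := o.one_le_s; have hs1 := o.s_le_t; have hs2 := o.s'_le_t'; have hs3 := o.t'_le_d
  have hs4 := o.s_add_t'
  refine (S.glued_iff _ _).2 (Or.inl ?_)
  cases c
  · change 1 < o.s at hc
    have e : o.s - 1 + 1 = o.s := by omega
    refine ⟨o.s - 1, by omega, by omega, by omega, by omega, Or.inr ⟨?_, rfl⟩⟩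
    rw [e]
    rfl
  · change o.t' < G.d at hc
    refine ⟨o.t', by omega, hc, by omega, by omega, Or.inl ⟨?_, rfl⟩⟩
    have e : o.s + o.t' - o.s = o.t' := by omega
    simp only [emb_true, flip, outerSide, if_true, Flip.side_side, e]

/-- The sides that are glued to a side of one of the two copies of the overlap. -/
theorem partner (S : o.Strands Γ b m) (hband : o.t + 1 < o.s') {c : Bool} {y z : TileSide}
    (hy : y.1 ∈ Set.Icc o.s o.t) (h : Glued Γ (o.emb c y) z) :
    (∃ k, o.s ≤ k ∧ k < o.t ∧ y = (k, G.exit k) ∧ z = o.emb c (k + 1, G.entry (k + 1))) ∨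
    (∃ k, o.s ≤ k ∧ k < o.t ∧ y = (k + 1, G.entry (k + 1)) ∧ z = o.emb c (k, G.exit k)) ∨
    (y = (o.t, b c) ∧ z = m c) ∨
    (o.HasOuter c ∧ y = (o.s, o.outerSide c) ∧ z = o.outer c) := by
  have hs0 := o.one_le_s; have hs1 := o.s_le_t; have hs2 := o.s'_le_t'; have hs3 := o.t'_le_d
  have hs4 := o.s_add_t'
  have hT : o.t ∈ Set.Icc o.s o.t := ⟨hs1, le_rfl⟩
  rcases (S.glued_iff _ _).1 h with ⟨i, hi1, hi2, hi3, hi4, hi⟩ | ⟨c', ⟨e1, e2⟩ | ⟨e1, -⟩⟩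
  · cases c
    · simp only [emb_false] at hi
      rcases hi with ⟨rfl, rfl⟩ | ⟨rfl, rfl⟩
      · simp only [Set.mem_Icc] at hy
        exact Or.inl ⟨i, hy.1, by omega, rfl, rfl⟩
      · simp only [Set.mem_Icc] at hy
        by_cases his : o.s ≤ i
        · exact Or.inr (Or.inl ⟨i, his, by omega, rfl, rfl⟩)
        · refine Or.inr (Or.inr (Or.inr ?_))
          obtain rfl : i = o.s - 1 := by omega
          have e : o.s - 1 + 1 = o.s := by omega
          refine ⟨show 1 < o.s by omega, ?_, rfl⟩
          rw [e]
          rfl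
    · have hflip : o.flip (o.flip y) = y := o.flip_flip (by have := hy.2; omega)
      have hmem := o.flip_fst_mem hy
      rw [emb_true] at hi
      rcases hi with ⟨e1, rfl⟩ | ⟨e1, rfl⟩
      · rw [e1] at hmem hflip
        simp only [Set.mem_Icc] at hmem
        by_cases hit : i = o.t'
        · subst hit
          refine Or.inr (Or.inr (Or.inr ⟨hi2, ?_, rfl⟩))
          rw [← hflip]
          have e : o.s + o.t' - o.t' = o.s := by omega
          simp only [flip, outerSide, if_true, e]
        · have hk := o.flip_entry (k := o.s + o.t' - (i + 1)) (by omega) (by omega)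
          have hk' := o.flip_exit (k := o.s + o.t' - (i + 1)) (by omega) (by omega)
          have ei : o.s + o.t' - (o.s + o.t' - (i + 1) + 1) = i := by omega
          rw [ei] at hk hk'
          refine Or.inr (Or.inl ⟨o.s + o.t' - (i + 1), by omega, by omega, ?_, ?_⟩)
          · rw [← hflip, ← hk, o.flip_flip]
            dsimp only
            omega
          · exact hk'.symm
      · rw [e1] at hmem hflip
        simp only [Set.mem_Icc] at hmem
        have hk := o.flip_exit (k := o.s + o.t' - (i + 1)) (by omega) (by omega)
        have hk' := o.flip_entry (k := o.s + o.t' - (i + 1)) (by omega) (by omega)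
        have ei : o.s + o.t' - (o.s + o.t' - (i + 1) + 1) = i := by omega
        rw [ei] at hk hk'
        refine Or.inl ⟨o.s + o.t' - (i + 1), by omega, by omega, ?_, ?_⟩
        · rw [← hflip, ← hk, o.flip_flip]
          dsimp only
          omega
        · exact hk'.symm
  · obtain ⟨rfl, rfl⟩ := o.emb_inj hband hy hT e1
    exact Or.inr (Or.inr (Or.inl ⟨rfl, e2⟩))
  · exfalso
    have h1 := S.lt_middle c'
    have h2 := S.middle_lt c'
    have h3 := o.emb_fst_mem c hy
    rw [e1] at h3
    rcases h3 with h3 | h3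
    · exact absurd h3.2 (by omega)
    · exact absurd h3.1 (by omega)

theorem glued_mem_tiles (S : o.Strands Γ b m) {x y : TileSide}
    (h : Glued Γ x y) : x.1 ∈ G.tiles := by
  have hs0 := o.one_le_s; have hs1 := o.s_le_t; have hs2 := o.s'_le_t'; have hs3 := o.t'_le_d
  rcases (S.glued_iff _ _).1 h with ⟨i, hi1, hi2, -, -, ⟨rfl, -⟩ | ⟨rfl, -⟩⟩ |
    ⟨c, ⟨rfl, -⟩ | ⟨rfl, -⟩⟩
  · exact ⟨hi1, hi2.le⟩
  · exact ⟨Nat.succ_pos _, hi2⟩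
  · exact o.emb_mem_tiles c ⟨hs1, le_rfl⟩
  · have h1 := S.lt_middle c
    have h2 := S.middle_lt c
    exact ⟨by omega, by omega⟩

/-- Away from the overlaps, two graphs with the same strands are glued in the same way. -/
theorem glued_congr {Γ' : Gluing} {b' : Bool → Side} {m' : Bool → TileSide}
    (S : o.Strands Γ b m) (S' : o.Strands Γ' b' m') {x y : TileSide}
    (hx : x.1 ∉ Set.Icc o.s o.t ∪ Set.Icc o.s' o.t')
    (hy : y.1 ∉ Set.Icc o.s o.t ∪ Set.Icc o.s' o.t') (h : Glued Γ x y) : Glued Γ' x y := by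
  have hT : o.t ∈ Set.Icc o.s o.t := ⟨o.s_le_t, le_rfl⟩
  rcases (S.glued_iff _ _).1 h with h | ⟨c, ⟨rfl, -⟩ | ⟨-, rfl⟩⟩
  · exact (S'.glued_iff _ _).2 (Or.inl h)
  · exact absurd (o.emb_fst_mem c hT) hx
  · exact absurd (o.emb_fst_mem c hT) hy

end Strands

end OppositeOverlap

end SnakeGraph

theorem tip_eq_sw_or (a : Side) : (a.tip = .sw ∧ (a = .south ∨ a = .west)) ∨
    (a.tip = .ne ∧ ¬ (a = .south ∨ a = .west)) := by
  cases a <;> simp [Side.tip]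

theorem sel_same_tile {h h' : ℕ → Bool} {x y x' y' : TileSide} (e : x.1 = y.1) (e' : x'.1 = y'.1)
    (hx : x.2.horizontal = x'.2.horizontal ↔ y.2.horizontal = y'.2.horizontal) :
    (Sel h x ↔ Sel h' x') ↔ (Sel h y ↔ Sel h' y') := by
  unfold Sel
  rw [e, e']
  revert hx
  cases x.2.horizontal <;> cases y.2.horizontal <;> cases x'.2.horizontal <;>
    cases y'.2.horizontal <;> cases h y.1 <;> cases h' y'.1 <;> decide

namespace SnakeGraph

variable {G : SnakeGraph}

namespace OppositeOverlap

variable (o : G.OppositeOverlap)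

theorem horizontal_emb (c c' : Bool) (x y : TileSide) :
    ((o.emb c x).2.horizontal = (o.emb c' x).2.horizontal ↔
      (o.emb c y).2.horizontal = (o.emb c' y).2.horizontal) := by
  cases c <;> cases c' <;> simp only [emb_true, emb_false, flip, Flip.horizontal_side] <;>
    cases o.σ <;> cases x.2.horizontal <;> cases y.2.horizontal <;> decide

theorem emb_fst_eq (c : Bool) {x y : TileSide} (e : x.1 = y.1) : (o.emb c x).1 = (o.emb c y).1 := by
  cases c
  · exact e
  · simp only [emb_true, flip, e]

/-- The tile `G_k` and its image in the other copy of the overlap are matched in the same way. -/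
def Agree (h : ℕ → Bool) (k : ℕ) : Prop :=
  Sel h (o.emb false (k, .north)) ↔ Sel h (o.emb true (k, .north))

variable {o} in
theorem agree_iff {h : ℕ → Bool} (c : Bool) (y : TileSide) :
    o.Agree h y.1 ↔ (Sel h (o.emb c y) ↔ Sel h (o.emb (!c) y)) := by
  have key : o.Agree h y.1 ↔ (Sel h (o.emb false y) ↔ Sel h (o.emb true y)) :=
    sel_same_tile (o.emb_fst_eq false rfl) (o.emb_fst_eq true rfl) (o.horizontal_emb _ _ _ _)
  cases c
  · exact key
  · exact key.trans Iff.comm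

/-- Exchange the matchings of the two copies of the overlap from the tile `G_K` on. -/
def swap (K : ℕ) (h : ℕ → Bool) (k : ℕ) : Bool :=
  if (o.s ≤ k ∧ k ≤ o.t ∧ K ≤ k) ∨ (o.s' ≤ k ∧ k ≤ o.t' ∧ K ≤ o.s + o.t' - k) then
    o.σ.matching (h (o.s + o.t' - k)) else h k

theorem swap_swap (hband : o.t + 1 < o.s') (K : ℕ) (h : ℕ → Bool) :
    o.swap K (o.swap K h) = h := by
  have h1 := o.s_le_t; have h2 := o.s'_le_t'; have h4 := o.s_add_t'
  funext k
  unfold swap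
  by_cases hk : (o.s ≤ k ∧ k ≤ o.t ∧ K ≤ k) ∨ (o.s' ≤ k ∧ k ≤ o.t' ∧ K ≤ o.s + o.t' - k)
  · rw [if_pos hk, if_pos (by omega), Flip.matching_matching]
    congr 1
    omega
  · rw [if_neg hk, if_neg hk]

theorem swap_outside (K : ℕ) (h : ℕ → Bool) {k : ℕ}
    (hk : k ∉ Set.Icc o.s o.t ∪ Set.Icc o.s' o.t') : o.swap K h k = h k := by
  unfold swap
  refine if_neg ?_
  rintro (⟨h1, h2, -⟩ | ⟨h1, h2, -⟩)
  · exact hk (Or.inl ⟨h1, h2⟩)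
  · exact hk (Or.inr ⟨h1, h2⟩)

theorem sel_swap_outside (K : ℕ) (h : ℕ → Bool) {x : TileSide}
    (hx : x.1 ∉ Set.Icc o.s o.t ∪ Set.Icc o.s' o.t') : Sel (o.swap K h) x ↔ Sel h x :=
  sel_congr (o.swap_outside K h hx)

theorem sel_swap (hband : o.t + 1 < o.s') (K : ℕ) (h : ℕ → Bool) (c : Bool) {y : TileSide}
    (hy : y.1 ∈ Set.Icc o.s o.t) :
    Sel (o.swap K h) (o.emb c y) ↔ if y.1 < K then Sel h (o.emb c y) else Sel h (o.emb (!c) y) := by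
  have h1 := o.s_le_t; have h2 := o.s'_le_t'; have h4 := o.s_add_t'
  rcases y with ⟨k, a⟩
  simp only [Set.mem_Icc] at hy
  have e : o.s + o.t' - (o.s + o.t' - k) = k := by omega
  have hm : ∀ a' b' : Bool, (a' = o.σ.matching b') ↔ o.σ.matching a' = b' := by
    cases o.σ <;> decide
  split_ifs with hk
  · refine sel_congr (if_neg ?_)
    cases c
    · simp only [emb_false]
      omega
    · simp only [emb_true, flip, e]
      omega
  · unfold Sel swap
    cases c
    · rw [if_pos (by simp only [emb_false]; omega)]
      simp only [emb_false, Bool.not_false, emb_true, flip, Flip.horizontal_side]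
      exact hm _ _
    · rw [if_pos (by simp only [emb_true, flip, e]; omega)]
      simp only [emb_true, Bool.not_true, emb_false, flip, Flip.horizontal_side, e]
      rw [hm, Flip.matching_matching]

theorem agree_swap (hband : o.t + 1 < o.s') (K : ℕ) (h : ℕ → Bool) {k : ℕ}
    (hk : k ∈ Set.Icc o.s o.t) : o.Agree (o.swap K h) k ↔ o.Agree h k := by
  unfold Agree
  rw [o.sel_swap hband K h false (y := (k, .north)) hk,
    o.sel_swap hband K h true (y := (k, .north)) hk]
  dsimp only
  split_ifs
  · rfl
  · exact Iff.comm

/-! ### Switching positions -/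

theorem rank_of_ne {y : TileSide} (hy : y.2.tip = .ne) : o.rank y = 2 * y.1 := by
  unfold rank
  rw [if_neg, if_neg]
  · intro h
    rcases h with h | h <;> simp [h, Side.tip] at hy
  · rintro ⟨-, h⟩
    rw [h, tip_entry] at hy
    cases hy

theorem rank_entry {k : ℕ} (hk : o.s < k) : o.rank (k, G.entry k) = 2 * (k - 1) := by
  unfold rank
  rw [if_pos ⟨hk, rfl⟩]

theorem rank_of_sw {y : TileSide} (hy : y.2.tip = .sw) (h : ¬ (o.s < y.1 ∧ y.2 = G.entry y.1)) :
    o.rank y = 2 * y.1 - 1 := by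
  unfold rank
  rw [if_neg h, if_pos]
  rcases tip_eq_sw_or y.2 with h' | h'
  · exact h'.2
  · rw [h'.1] at hy
    cases hy

/-- The positions at which the switch of the matching given by `h` turns out to be a perfect
matching. At the two extreme positions the condition concerns the tiles next to the overlaps; at
the other ones, the two copies have to agree on the tile that starts or that is cut there. -/
def GoodPos (m : Bool → TileSide) (h : ℕ → Bool) (p : ℕ) : Prop :=
  (p = 2 * o.s - 2 ∧ ∀ c, o.HasOuter c → Sel h (o.outer c)) ∨
  (∃ k, o.s ≤ k ∧ k ≤ o.t ∧ o.Agree h k ∧ (p = 2 * k - 1 ∨ (o.s < k ∧ p = 2 * k - 2))) ∨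
  (p = 2 * o.t ∧ ∀ c, Sel h (m c))

theorem outer_notMem (hband : o.t + 1 < o.s') {c : Bool} (hc : o.HasOuter c) :
    (o.outer c).1 ∉ Set.Icc o.s o.t ∪ Set.Icc o.s' o.t' := by
  have h1 := o.s_le_t; have h2 := o.s'_le_t'
  cases c
  · change 1 < o.s at hc
    simp only [outer, Bool.false_eq_true, if_false, Set.mem_union, Set.mem_Icc]
    omega
  · simp only [outer, if_true, Set.mem_union, Set.mem_Icc]
    omega

theorem switch_subset {Γ Δ : Gluing} (p : ℕ) (P : Set (Edge Γ)) :
    o.switch Γ Δ p P ⊆ edge Δ '' sidesOf G.tiles := by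
  rintro e ⟨x, hx, rfl, -⟩
  exact ⟨x, hx, rfl⟩

namespace Strands

variable {o} {Γ Δ : Gluing} {b : Bool → Side} {m : Bool → TileSide}

theorem middle_notMem (S : o.Strands Γ b m) (c : Bool) :
    (m c).1 ∉ Set.Icc o.s o.t ∪ Set.Icc o.s' o.t' := by
  have h1 := S.lt_middle c
  have h2 := S.middle_lt c
  simp only [Set.mem_union, Set.mem_Icc]
  omega

theorem goodPos_swap (S : o.Strands Γ b m) (hband : o.t + 1 < o.s') (K : ℕ) (h : ℕ → Bool)
    (p : ℕ) : o.GoodPos m (o.swap K h) p ↔ o.GoodPos m h p := by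
  refine or_congr (and_congr_right fun _ => forall_congr' fun c => forall_congr' fun hc => ?_)
    (or_congr ?_ (and_congr_right fun _ => forall_congr' fun c => ?_))
  · exact o.sel_swap_outside K h (o.outer_notMem hband hc)
  · refine exists_congr fun k => and_congr_right fun h1 => and_congr_right fun h2 => ?_
    rw [o.agree_swap hband K h ⟨h1, h2⟩]
  · exact o.sel_swap_outside K h (S.middle_notMem c)

theorem goodPos_not (m : Bool → TileSide) (h : ℕ → Bool) (p : ℕ) :
    o.GoodPos (fun c => m (!c)) h p ↔ o.GoodPos m h p := by
  unfold GoodPos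
  refine or_congr Iff.rfl (or_congr Iff.rfl (and_congr_right fun _ => ?_))
  rw [Bool.forall_bool, Bool.forall_bool]
  exact And.comm

/-- Sides of the last tile of the overlap. -/
theorem eq_side_t (S : o.Strands Γ b m) (c : Bool) {y : TileSide} (hy : y.1 = o.t)
    (htip : y.2.tip = .ne) : y = (o.t, b c) ∨ y = (o.t, b (!c)) := by
  have : tipCorner y = tipCorner (o.t, b c) := by
    simp [tipCorner, hy, htip, S.tip_side]
  rcases tipCorner_eq_iff.1 this with h | h
  · exact Or.inl h
  · rw [S.tipMate_side] at h
    exact Or.inr h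

omit b m in
theorem eq_exit_or {y : TileSide} (htip : y.2.tip = .ne) :
    y = (y.1, G.exit y.1) ∨ y = (y.1, G.exitBdry y.1) := by
  have : tipCorner y = tipCorner (y.1, G.exit y.1) := by simp [tipCorner, htip, tip_exit]
  rcases tipCorner_eq_iff.1 this with h | h
  · exact Or.inl h
  · rw [tipMate_exit] at h
    exact Or.inr h

omit b m in
theorem eq_entry_or {y : TileSide} (htip : y.2.tip = .sw) :
    y = (y.1, G.entry y.1) ∨ y = (y.1, G.entryBdry y.1) := by
  have : tipCorner y = tipCorner (y.1, G.entry y.1) := by simp [tipCorner, htip, tip_entry]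
  rcases tipCorner_eq_iff.1 this with h | h
  · exact Or.inl h
  · rw [tipMate_entry] at h
    exact Or.inr h

variable (S : o.Strands Γ b m)

include S in
theorem mem_of_glued {h : ℕ → Bool} {x z : TileSide} (hxz : Glued Γ x z) :
    edge Γ x ∈ matchingOf Γ (sidesOf G.tiles) h ↔ Sel h x ∧ Sel h z := by
  have hx : x ∈ sidesOf G.tiles := S.glued_mem_tiles hxz
  have hz : z ∈ sidesOf G.tiles := S.glued_mem_tiles hxz.symm
  rw [S.tame.mem_matchingOf hx]
  refine and_congr_right fun _ => ⟨fun H => H z hz hxz, fun hs y _ hy => ?_⟩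
  rwa [S.tame.unique hy hxz]

include S in
theorem mem_of_not_glued {h : ℕ → Bool} {x : TileSide} (hx : x.1 ∈ G.tiles)
    (hxz : ∀ z, ¬ Glued Γ x z) :
    edge Γ x ∈ matchingOf Γ (sidesOf G.tiles) h ↔ Sel h x := by
  rw [S.tame.mem_matchingOf (F := sidesOf G.tiles) hx]
  exact and_iff_left fun y _ hy => absurd hy (hxz y)

include S in
theorem mem_tipMate {h : ℕ → Bool} {x z : TileSide} (hxz : Glued Γ x z) :
    edge Γ (tipMate x) ∈ matchingOf Γ (sidesOf G.tiles) h ↔ Sel h (tipMate x) := by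
  have hxT : x.1 ∈ G.tiles := S.glued_mem_tiles hxz
  exact S.mem_of_not_glued (x := tipMate x) hxT (S.tame.not_glued_tipMate hxz)

include S in
/-- In a given copy of the overlap, a south or west side of its first tile is glued to nothing, unless
it is the one that is glued to the outer tile. -/
theorem not_glued_first (hband : o.t + 1 < o.s') {c : Bool} {y : TileSide} (hy : y.1 = o.s)
    (htip : y.2.tip = .sw) (hc : ¬ (o.HasOuter c ∧ y = (o.s, o.outerSide c))) (z : TileSide) :
    ¬ Glued Γ (o.emb c y) z := by
  intro h
  rcases S.partner hband (show y.1 ∈ Set.Icc o.s o.t from ⟨hy.ge, hy.trans_le o.s_le_t⟩) h with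
    ⟨k, -, -, rfl, -⟩ | ⟨k, hk, -, rfl, -⟩ | ⟨rfl, -⟩ | ⟨h1, h2, -⟩
  · rw [tip_exit] at htip
    cases htip
  · dsimp only at hy
    omega
  · rw [S.tip_side] at htip
    cases htip
  · exact hc ⟨h1, h2⟩

include S in
theorem glued_emb_emb (hband : o.t + 1 < o.s') {c c' : Bool} {y y' : TileSide}
    (hy : y.1 ∈ Set.Icc o.s o.t) (hy' : y'.1 ∈ Set.Icc o.s o.t)
    (h : Glued Γ (o.emb c y) (o.emb c' y')) : c = c' ∧ ∃ k, o.s ≤ k ∧ k < o.t ∧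
      ((y = (k, G.exit k) ∧ y' = (k + 1, G.entry (k + 1))) ∨
        (y = (k + 1, G.entry (k + 1)) ∧ y' = (k, G.exit k))) := by
  rcases S.partner hband hy h with ⟨k, h1, h2, rfl, e⟩ | ⟨k, h1, h2, rfl, e⟩ | ⟨rfl, e⟩ |
    ⟨h1, rfl, e⟩
  · obtain ⟨rfl, rfl⟩ := o.emb_inj hband hy' ⟨by dsimp only; omega, by dsimp only; omega⟩ e
    exact ⟨rfl, k, h1, h2, Or.inl ⟨rfl, rfl⟩⟩
  · obtain ⟨rfl, rfl⟩ := o.emb_inj hband hy' ⟨by dsimp only; omega, by dsimp only; omega⟩ e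
    exact ⟨rfl, k, h1, h2, Or.inr ⟨rfl, rfl⟩⟩
  · exact absurd (o.emb_fst_mem c' hy') (e ▸ S.middle_notMem c)
  · exact absurd (o.emb_fst_mem c' hy') (e ▸ o.outer_notMem hband h1)

section switch

variable (S' : o.Strands Δ (fun c => b (!c)) (fun c => m (!c)))
include S S'

/-- The result of switching on the two copies of the overlap. -/
theorem mem_switch (hband : o.t + 1 < o.s') (p : ℕ) (P : Set (Edge Γ)) (c : Bool) {y : TileSide}
    (hy : y.1 ∈ Set.Icc o.s o.t) : edge Δ (o.emb c y) ∈ o.switch Γ Δ p P ↔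
      (o.rank y ≤ p ∧ edge Γ (o.emb c y) ∈ P) ∨ (p < o.rank y ∧ edge Γ (o.emb (!c) y) ∈ P) := by
  have hs2 := o.s'_le_t'
  constructor
  · rintro ⟨x, hx, e, h⟩
    have key : ∃ c' y', y'.1 ∈ Set.Icc o.s o.t ∧ x = o.emb c' y' ∧
        ((o.rank y' ≤ p ∧ edge Γ (o.emb c' y') ∈ P) ∨
          (p < o.rank y' ∧ edge Γ (o.emb (!c') y') ∈ P)) := by
      rcases h with ⟨h1, h2⟩ | ⟨h1, h2⟩ | ⟨h1, h2⟩
      · exact ⟨false, x, h1, rfl, h2⟩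
      · have e' : o.flip (o.flip x) = x := o.flip_flip (by have := h1.2; omega)
        refine ⟨true, o.flip x, o.flip_fst_mem' h1, e'.symm, ?_⟩
        rw [emb_true, e']
        exact h2
      · exact absurd e.symm (h1 _ (o.emb_fst_mem c hy))
    obtain ⟨c', y', hy', rfl, hK⟩ := key
    rcases S'.tame.edge_eq_iff.1 e with e | e
    · obtain ⟨rfl, rfl⟩ := o.emb_inj hband hy' hy e
      exact hK
    · obtain ⟨rfl, k, h1, h2, ⟨rfl, rfl⟩ | ⟨rfl, rfl⟩⟩ := S'.glued_emb_emb hband hy' hy e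
      · rw [o.rank_entry (by omega), ← edge_eq_of_glued (S.glued_exit hband _ h1 h2),
          ← edge_eq_of_glued (S.glued_exit hband _ h1 h2)]
        rw [o.rank_of_ne (tip_exit _ _)] at hK
        exact hK
      · rw [o.rank_entry (by omega), ← edge_eq_of_glued (S.glued_exit hband _ h1 h2),
          ← edge_eq_of_glued (S.glued_exit hband _ h1 h2)] at hK
        rw [o.rank_of_ne (tip_exit _ _)]
        exact hK
  · intro h
    refine ⟨o.emb c y, o.emb_mem_tiles c hy, rfl, ?_⟩
    cases c
    · exact Or.inl ⟨hy, h⟩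
    · have e' : o.flip (o.flip y) = y := o.flip_flip (by
        have := hy.2; have := o.s_add_t'; have := o.s_le_t; omega)
      refine Or.inr (Or.inl ⟨o.flip_fst_mem hy, ?_⟩)
      rw [emb_true, e']
      exact h

theorem mem_switch_of_le (hband : o.t + 1 < o.s') {p : ℕ} (P : Set (Edge Γ)) (c : Bool)
    {y : TileSide} (hy : y.1 ∈ Set.Icc o.s o.t) (hp : o.rank y ≤ p) :
    edge Δ (o.emb c y) ∈ o.switch Γ Δ p P ↔ edge Γ (o.emb c y) ∈ P := by
  rw [S.mem_switch S' hband p P c hy]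
  simp [hp]

theorem mem_switch_of_lt (hband : o.t + 1 < o.s') {p : ℕ} (P : Set (Edge Γ)) (c : Bool)
    {y : TileSide} (hy : y.1 ∈ Set.Icc o.s o.t) (hp : p < o.rank y) :
    edge Δ (o.emb c y) ∈ o.switch Γ Δ p P ↔ edge Γ (o.emb (!c) y) ∈ P := by
  rw [S.mem_switch S' hband p P c hy]
  simp [hp]

/-- The result of switching away from the overlaps. -/
theorem mem_switch_outside (p : ℕ) (P : Set (Edge Γ)) {x : TileSide}
    (hxT : x.1 ∈ G.tiles) (hx : x.1 ∉ Set.Icc o.s o.t ∪ Set.Icc o.s' o.t')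
    (hxg : ∀ z, Glued Δ x z → z.1 ∉ Set.Icc o.s o.t ∪ Set.Icc o.s' o.t') :
    edge Δ x ∈ o.switch Γ Δ p P ↔ edge Γ x ∈ P := by
  have hno : ∀ z : TileSide, z.1 ∈ Set.Icc o.s o.t ∪ Set.Icc o.s' o.t' → edge Δ z ≠ edge Δ x := by
    intro z hz e
    rcases S'.tame.edge_eq_iff.1 e with rfl | h
    · exact hx hz
    · exact hxg z h.symm hz
  constructor
  · rintro ⟨z, -, e, h⟩
    rcases h with ⟨h1, -⟩ | ⟨h1, -⟩ | ⟨-, h2⟩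
    · exact absurd e (hno z (Or.inl h1))
    · exact absurd e (hno z (Or.inr h1))
    · rcases S'.tame.edge_eq_iff.1 e with rfl | h
      · exact h2
      · have hz : z.1 ∉ Set.Icc o.s o.t ∪ Set.Icc o.s' o.t' := hxg z h.symm
        rwa [← edge_eq_of_glued (S'.glued_congr S hz hx h)]
  · exact fun h => ⟨x, hxT, rfl, Or.inr (Or.inr ⟨hno, h⟩)⟩

end switch

end Strands

end OppositeOverlap

end SnakeGraph

namespace SnakeGraph

variable {G : SnakeGraph}

namespace OppositeOverlap

variable (o : G.OppositeOverlap)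

theorem GoodPos.agree {o : G.OppositeOverlap} {m : Bool → TileSide} {h : ℕ → Bool} {p k : ℕ}
    (hp : o.GoodPos m h p) (h1 : o.s ≤ k) (h2 : k ≤ o.t)
    (hk : p = 2 * k - 1 ∨ (o.s < k ∧ p = 2 * k - 2)) : o.Agree h k := by
  have h0 := o.one_le_s
  rcases hp with ⟨e, -⟩ | ⟨k', h1', h2', ha, hk'⟩ | ⟨e, -⟩
  · omega
  · obtain rfl : k = k' := by omega
    exact ha
  · omega

theorem GoodPos.outer {o : G.OppositeOverlap} {m : Bool → TileSide} {h : ℕ → Bool} {p : ℕ}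
    (hp : o.GoodPos m h p) (e : p = 2 * o.s - 2) (c : Bool) (hc : o.HasOuter c) :
    Sel h (o.outer c) := by
  have h0 := o.one_le_s; have h1 := o.s_le_t
  rcases hp with ⟨-, h⟩ | ⟨k', h1', h2', ha, hk'⟩ | ⟨e', -⟩
  · exact h c hc
  · omega
  · omega

theorem GoodPos.middle {o : G.OppositeOverlap} {m : Bool → TileSide} {h : ℕ → Bool} {p : ℕ}
    (hp : o.GoodPos m h p) (e : p = 2 * o.t) (c : Bool) : Sel h (m c) := by
  have h0 := o.one_le_s; have h1 := o.s_le_t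
  rcases hp with ⟨e', -⟩ | ⟨k', h1', h2', ha, hk'⟩ | ⟨-, h⟩
  · omega
  · omega
  · exact h c

theorem GoodPos.le {o : G.OppositeOverlap} {m : Bool → TileSide} {h : ℕ → Bool} {p : ℕ}
    (hp : o.GoodPos m h p) : 2 * o.s - 2 ≤ p ∧ p ≤ 2 * o.t := by
  have h0 := o.one_le_s; have h1 := o.s_le_t
  rcases hp with ⟨e', -⟩ | ⟨k', h1', h2', ha, hk'⟩ | ⟨e', -⟩ <;> omega

namespace Strands

variable {o} {Γ Δ : Gluing} {b : Bool → Side} {m : Bool → TileSide} {h : ℕ → Bool}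
variable (S : o.Strands Γ b m)

include S in
theorem mem_exit (hband : o.t + 1 < o.s') (c : Bool) {k : ℕ} (h1 : o.s ≤ k) (h2 : k < o.t) :
    edge Γ (o.emb c (k, G.exit k)) ∈ matchingOf Γ (sidesOf G.tiles) h ↔
      Sel h (o.emb c (k, G.exit k)) ∧ Sel h (o.emb c (k + 1, G.entry (k + 1))) :=
  S.mem_of_glued (S.glued_exit hband c h1 h2)

include S in
theorem mem_exitBdry (hband : o.t + 1 < o.s') (c : Bool) {k : ℕ} (h1 : o.s ≤ k) (h2 : k < o.t) :
    edge Γ (o.emb c (k, G.exitBdry k)) ∈ matchingOf Γ (sidesOf G.tiles) h ↔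
      Sel h (o.emb c (k, G.exitBdry k)) := by
  rw [← tipMate_exit, ← tipMate_emb]
  exact S.mem_tipMate (S.glued_exit hband c h1 h2)

include S in
theorem mem_entryBdry (hband : o.t + 1 < o.s') (c : Bool) {k : ℕ} (h1 : o.s < k) (h2 : k ≤ o.t) :
    edge Γ (o.emb c (k, G.entryBdry k)) ∈ matchingOf Γ (sidesOf G.tiles) h ↔
      Sel h (o.emb c (k, G.entryBdry k)) := by
  obtain ⟨j, rfl⟩ : ∃ j, k = j + 1 := ⟨k - 1, by omega⟩
  rw [← tipMate_entry, ← tipMate_emb]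
  exact S.mem_tipMate (S.glued_exit hband c (by omega) (by omega)).symm

include S in
theorem mem_side (c : Bool) :
    edge Γ (o.emb c (o.t, b c)) ∈ matchingOf Γ (sidesOf G.tiles) h ↔
      Sel h (o.emb c (o.t, b c)) ∧ Sel h (m c) :=
  S.mem_of_glued (S.glued_middle c)

include S in
theorem mem_side_not (c : Bool) :
    edge Γ (o.emb c (o.t, b (!c))) ∈ matchingOf Γ (sidesOf G.tiles) h ↔
      Sel h (o.emb c (o.t, b (!c))) := by
  rw [← S.tipMate_side, ← tipMate_emb]
  exact S.mem_tipMate (S.glued_middle c)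

include S in
theorem mem_outerSide (hband : o.t + 1 < o.s') {c : Bool} (hc : o.HasOuter c) :
    edge Γ (o.emb c (o.s, o.outerSide c)) ∈ matchingOf Γ (sidesOf G.tiles) h ↔
      Sel h (o.emb c (o.s, o.outerSide c)) ∧ Sel h (o.outer c) :=
  S.mem_of_glued (S.glued_outer hband hc)

include S in
theorem mem_first (hband : o.t + 1 < o.s') {c : Bool} {y : TileSide} (hy : y.1 = o.s)
    (htip : y.2.tip = .sw) (hc : ¬ (o.HasOuter c ∧ y = (o.s, o.outerSide c))) :
    edge Γ (o.emb c y) ∈ matchingOf Γ (sidesOf G.tiles) h ↔ Sel h (o.emb c y) :=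
  S.mem_of_not_glued (o.emb_mem_tiles c ⟨hy.ge, hy.trans_le o.s_le_t⟩)
    (S.not_glued_first hband hy htip hc)

section switch

variable (S' : o.Strands Δ (fun c => b (!c)) (fun c => m (!c)))
include S S'

theorem valid_swap (hband : o.t + 1 < o.s') (hv : Valid Γ (sidesOf G.tiles) h) {p : ℕ}
    (hp : o.GoodPos m h p) : Valid Δ (sidesOf G.tiles) (o.swap (p / 2 + 1) h) := by
  have h0 := o.one_le_s; have hst := o.s_le_t
  have hle := hp.le
  have hv' : ∀ x y, Glued Γ x y → Sel h x ∨ Sel h y := fun x y hxy =>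
    hv x (S.glued_mem_tiles hxy) y (S.glued_mem_tiles hxy.symm) hxy
  have hsel := fun c (y : TileSide) (hy : y.1 ∈ Set.Icc o.s o.t) =>
    o.sel_swap hband (p / 2 + 1) h c hy
  have hex : ∀ c k, o.s ≤ k → k < o.t → Sel (o.swap (p / 2 + 1) h) (o.emb c (k, G.exit k)) ∨
      Sel (o.swap (p / 2 + 1) h) (o.emb c (k + 1, G.entry (k + 1))) := by
    intro c k h1 h2
    rw [hsel c (k, G.exit k) ⟨h1, h2.le⟩,
      hsel c (k + 1, G.entry (k + 1)) ⟨by dsimp only; omega, by dsimp only; omega⟩]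
    dsimp only
    have e1 := hv' _ _ (S.glued_exit hband c h1 h2)
    have e2 := hv' _ _ (S.glued_exit hband (!c) h1 h2)
    by_cases hk : k < p / 2 + 1
    · rw [if_pos hk]
      by_cases hk' : k + 1 < p / 2 + 1
      · rw [if_pos hk']
        exact e1
      · rw [if_neg hk', ← (agree_iff c (k + 1, G.entry (k + 1))).1
          (hp.agree (by omega) (by omega) (by omega))]
        exact e1
    · rw [if_neg hk, if_neg (by omega)]
      exact e2
  have core : ∀ c (y : TileSide) z, y.1 ∈ Set.Icc o.s o.t → Glued Δ (o.emb c y) z →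
      Sel (o.swap (p / 2 + 1) h) (o.emb c y) ∨ Sel (o.swap (p / 2 + 1) h) z := by
    intro c y z hy hyz
    rcases S'.partner hband hy hyz with ⟨k, h1, h2, rfl, rfl⟩ | ⟨k, h1, h2, rfl, rfl⟩ |
      ⟨rfl, rfl⟩ | ⟨hc, rfl, rfl⟩
    · exact hex c k h1 h2
    · exact (hex c k h1 h2).symm
    · rw [hsel c _ hy, o.sel_swap_outside _ _ (S.middle_notMem _)]
      dsimp only
      by_cases hk : o.t < p / 2 + 1
      · exact Or.inr (hp.middle (by omega) _)
      · rw [if_neg hk]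
        exact hv' _ _ (S.glued_middle (!c))
    · rw [hsel c _ hy, o.sel_swap_outside _ _ (o.outer_notMem hband hc)]
      dsimp only
      have e1 := hv' _ _ (S.glued_outer hband hc)
      by_cases hk : o.s < p / 2 + 1
      · rw [if_pos hk]
        exact e1
      · rw [if_neg hk]
        by_cases hk' : p = 2 * o.s - 2
        · exact Or.inr (hp.outer hk' c hc)
        · rw [← (agree_iff c (o.s, o.outerSide c)).1 (hp.agree le_rfl hst (by omega))]
          exact e1
  intro x _ z _ hxz
  by_cases hx : x.1 ∈ Set.Icc o.s o.t ∪ Set.Icc o.s' o.t'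
  · obtain ⟨c, y, hy, rfl⟩ := o.exists_emb hx
    exact core c y z hy hxz
  by_cases hz : z.1 ∈ Set.Icc o.s o.t ∪ Set.Icc o.s' o.t'
  · obtain ⟨c, y, hy, rfl⟩ := o.exists_emb hz
    exact (core c y x hy hxz.symm).symm
  rw [o.sel_swap_outside _ _ hx, o.sel_swap_outside _ _ hz]
  exact hv' _ _ (S'.glued_congr S hx hz hxz)

theorem mem_switch_iff (hband : o.t + 1 < o.s') {p : ℕ} (hp : o.GoodPos m h p) (c : Bool)
    {y : TileSide} (hy : y.1 ∈ Set.Icc o.s o.t) :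
    edge Δ (o.emb c y) ∈ o.switch Γ Δ p (matchingOf Γ (sidesOf G.tiles) h) ↔
      edge Δ (o.emb c y) ∈ matchingOf Δ (sidesOf G.tiles) (o.swap (p / 2 + 1) h) := by
  have h0 := o.one_le_s; have hst := o.s_le_t
  have hle := hp.le
  have hsel := fun (y : TileSide) (hy : y.1 ∈ Set.Icc o.s o.t) =>
    o.sel_swap hband (p / 2 + 1) h c hy
  have hexit : ∀ k, o.s ≤ k → k < o.t →
      (edge Δ (o.emb c (k, G.exit k)) ∈ o.switch Γ Δ p (matchingOf Γ (sidesOf G.tiles) h) ↔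
        edge Δ (o.emb c (k, G.exit k)) ∈
          matchingOf Δ (sidesOf G.tiles) (o.swap (p / 2 + 1) h)) := by
    intro k h1 h2
    have hk : (k, G.exit k).1 ∈ Set.Icc o.s o.t := ⟨h1, h2.le⟩
    have hr : o.rank (k, G.exit k) = 2 * k := o.rank_of_ne (G.tip_exit k)
    rw [S'.mem_exit hband c h1 h2, hsel _ hk,
      hsel (k + 1, G.entry (k + 1)) ⟨by dsimp only; omega, by dsimp only; omega⟩]
    dsimp only
    by_cases hkp : 2 * k ≤ p
    · rw [S.mem_switch_of_le S' hband _ c hk (by omega), S.mem_exit hband c h1 h2,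
        if_pos (by omega)]
      refine and_congr_right fun _ => ?_
      by_cases hk' : k + 1 < p / 2 + 1
      · rw [if_pos hk']
      · rw [if_neg hk']
        exact (agree_iff c (k + 1, G.entry (k + 1))).1
          (hp.agree (by omega) (by omega) (by omega))
    · rw [S.mem_switch_of_lt S' hband _ c hk (by omega), S.mem_exit hband (!c) h1 h2,
        if_neg (by omega), if_neg (by omega)]
  rcases tip_eq_sw_or y.2 with ⟨htip, -⟩ | ⟨htip, -⟩
  · rcases hy.1.eq_or_lt with hys | hys
    · -- The first tile of the overlap.
      have hr : o.rank y = 2 * o.s - 1 := by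
        rw [o.rank_of_sw htip (by omega), hys]
      by_cases hyc : o.HasOuter c ∧ y = (o.s, o.outerSide c)
      · obtain ⟨hc, rfl⟩ := hyc
        rw [S'.mem_outerSide hband hc, o.sel_swap_outside _ _ (o.outer_notMem hband hc), hsel _ hy]
        dsimp only
        by_cases hps : 2 * o.s - 1 ≤ p
        · rw [S.mem_switch_of_le S' hband _ c hy (by omega), S.mem_outerSide hband hc]
          refine and_congr_left fun _ => ?_
          by_cases hk : o.s < p / 2 + 1
          · rw [if_pos hk]
          · rw [if_neg hk]
            exact (agree_iff c (o.s, o.outerSide c)).1 (hp.agree le_rfl hst (by omega))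
        · have hno : ¬ (o.HasOuter (!c) ∧
              ((o.s, o.outerSide c) : TileSide) = (o.s, o.outerSide (!c))) := by
            rintro ⟨hc', e⟩
            have e' := (Prod.mk.inj e).2
            cases c
            · exact o.outerSide_ne hc hc' e'.symm
            · exact o.outerSide_ne hc' hc e'
          rw [S.mem_switch_of_lt S' hband _ c hy (by omega), S.mem_first hband rfl htip hno,
            if_neg (by omega)]
          exact (and_iff_left (hp.outer (by omega) c hc)).symm
      · rw [S'.mem_first hband hys.symm htip hyc, hsel _ hy]
        by_cases hps : 2 * o.s - 1 ≤ p
        · rw [S.mem_switch_of_le S' hband _ c hy (by omega), S.mem_first hband hys.symm htip hyc]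
          by_cases hk : y.1 < p / 2 + 1
          · rw [if_pos hk]
          · rw [if_neg hk]
            exact (agree_iff c y).1 (hp.agree hy.1 hy.2 (by omega))
        · rw [S.mem_switch_of_lt S' hband _ c hy (by omega), if_neg (by omega)]
          by_cases hyc' : o.HasOuter (!c) ∧ y = (o.s, o.outerSide (!c))
          · obtain ⟨hc', rfl⟩ := hyc'
            rw [S.mem_outerSide hband hc']
            exact and_iff_left (hp.outer (by omega) _ hc')
          · rw [S.mem_first hband hys.symm htip hyc']
    · rcases eq_entry_or (G := G) htip with e | e
      · obtain ⟨j, hj⟩ : ∃ j, y.1 = j + 1 := ⟨y.1 - 1, by omega⟩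
        have hy2 := hy.2
        rw [hj] at e
        rw [e, ← edge_eq_of_glued (S'.glued_exit hband c (k := j) (by omega) (by omega))]
        exact hexit j (by omega) (by omega)
      · have hr : o.rank y = 2 * y.1 - 1 := by
          refine o.rank_of_sw htip ?_
          rintro ⟨-, h'⟩
          have := G.tipMate_entry y.1
          rw [← h', ← e] at this
          exact tipMate_ne _ this
        have hm := fun c' => S.mem_entryBdry (h := h) hband c' hys hy.2
        have hm' := S'.mem_entryBdry (h := o.swap (p / 2 + 1) h) hband c hys hy.2
        rw [← e] at hm hm'
        rw [hm', hsel _ hy]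
        by_cases hps : 2 * y.1 - 1 ≤ p
        · rw [S.mem_switch_of_le S' hband _ c hy (by omega), hm]
          by_cases hk : y.1 < p / 2 + 1
          · rw [if_pos hk]
          · rw [if_neg hk]
            exact (agree_iff c y).1 (hp.agree hy.1 hy.2 (by omega))
        · rw [S.mem_switch_of_lt S' hband _ c hy (by omega), hm, if_neg (by omega)]
  · have hr : o.rank y = 2 * y.1 := o.rank_of_ne htip
    rcases hy.2.eq_or_lt with hyt | hyt
    · -- The last tile of the overlap.
      rcases S.eq_side_t c hyt htip with rfl | rfl
      · have hm := S'.mem_side_not (h := o.swap (p / 2 + 1) h) c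
        have hm' := S.mem_side_not (h := h) (!c)
        simp only [Bool.not_not] at hm hm'
        rw [hm, hsel _ hy]
        dsimp only at hr ⊢
        by_cases hpt : 2 * o.t ≤ p
        · rw [S.mem_switch_of_le S' hband _ c hy (by omega), S.mem_side, if_pos (by omega)]
          exact and_iff_left (hp.middle (by omega) c)
        · rw [S.mem_switch_of_lt S' hband _ c hy (by omega), hm', if_neg (by omega)]
      · rw [S'.mem_side c, o.sel_swap_outside _ _ (S.middle_notMem _), hsel _ hy]
        dsimp only at hr ⊢
        by_cases hpt : 2 * o.t ≤ p
        · rw [S.mem_switch_of_le S' hband _ c hy (by omega), S.mem_side_not, if_pos (by omega)]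
          exact (and_iff_left (hp.middle (by omega) _)).symm
        · rw [S.mem_switch_of_lt S' hband _ c hy (by omega), S.mem_side, if_neg (by omega)]
    · rcases eq_exit_or (G := G) htip with e | e
      · rw [e]
        exact hexit _ hy.1 hyt
      · have hm := fun c' => S.mem_exitBdry (h := h) hband c' hy.1 hyt
        have hm' := S'.mem_exitBdry (h := o.swap (p / 2 + 1) h) hband c hy.1 hyt
        rw [← e] at hm hm'
        rw [hm', hsel _ hy]
        by_cases hps : 2 * y.1 ≤ p
        · rw [S.mem_switch_of_le S' hband _ c hy (by omega), hm, if_pos (by omega)]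
        · rw [S.mem_switch_of_lt S' hband _ c hy (by omega), hm, if_neg (by omega)]

theorem notMem_of_glued (hband : o.t + 1 < o.s') {x : TileSide}
    (hx : x.1 ∉ Set.Icc o.s o.t ∪ Set.Icc o.s' o.t')
    (hxg : ∀ z, Glued Δ x z → z.1 ∉ Set.Icc o.s o.t ∪ Set.Icc o.s' o.t') (z : TileSide)
    (hz : Glued Γ x z) : z.1 ∉ Set.Icc o.s o.t ∪ Set.Icc o.s' o.t' := by
  intro hmem
  obtain ⟨c, y, hy, rfl⟩ := o.exists_emb hmem
  have hT : o.t ∈ Set.Icc o.s o.t := ⟨o.s_le_t, le_rfl⟩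
  have hs : o.s ∈ Set.Icc o.s o.t := ⟨le_rfl, o.s_le_t⟩
  rcases S.partner hband hy hz.symm with ⟨k, h1, h2, rfl, rfl⟩ | ⟨k, h1, h2, rfl, rfl⟩ |
    ⟨rfl, rfl⟩ | ⟨hc, rfl, rfl⟩
  · exact hx (o.emb_fst_mem c ⟨by dsimp only; omega, by dsimp only; omega⟩)
  · exact hx (o.emb_fst_mem c ⟨by dsimp only; omega, by dsimp only; omega⟩)
  · have := S'.glued_middle (!c)
    simp only [Bool.not_not] at this
    exact hxg _ this.symm (o.emb_fst_mem _ hT)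
  · exact hxg _ (S'.glued_outer hband hc).symm (o.emb_fst_mem _ hs)

theorem switch_eq (hband : o.t + 1 < o.s') {p : ℕ} (hp : o.GoodPos m h p) :
    o.switch Γ Δ p (matchingOf Γ (sidesOf G.tiles) h) =
      matchingOf Δ (sidesOf G.tiles) (o.swap (p / 2 + 1) h) := by
  suffices H : ∀ x : TileSide, x.1 ∈ G.tiles →
      (edge Δ x ∈ o.switch Γ Δ p (matchingOf Γ (sidesOf G.tiles) h) ↔
        edge Δ x ∈ matchingOf Δ (sidesOf G.tiles) (o.swap (p / 2 + 1) h)) by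
    ext e
    constructor
    · intro he
      obtain ⟨x, hx, rfl⟩ := o.switch_subset _ _ he
      exact (H x hx).1 he
    · intro he
      obtain ⟨x, hx, rfl⟩ := matchingOf_subset he
      exact (H x hx).2 he
  intro x hxT
  by_cases hx : x.1 ∈ Set.Icc o.s o.t ∪ Set.Icc o.s' o.t'
  · obtain ⟨c, y, hy, rfl⟩ := o.exists_emb hx
    exact S.mem_switch_iff S' hband hp c hy
  by_cases hxg : ∃ z, Glued Δ x z ∧ z.1 ∈ Set.Icc o.s o.t ∪ Set.Icc o.s' o.t'
  · obtain ⟨z, hxz, hz⟩ := hxg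
    obtain ⟨c, y, hy, rfl⟩ := o.exists_emb hz
    rw [edge_eq_of_glued hxz]
    exact S.mem_switch_iff S' hband hp c hy
  push Not at hxg
  rw [S.mem_switch_outside S' p _ hxT hx hxg, S.tame.mem_matchingOf (F := sidesOf G.tiles) hxT,
    S'.tame.mem_matchingOf (F := sidesOf G.tiles) hxT, o.sel_swap_outside _ _ hx]
  refine and_congr_right fun _ => forall_congr' fun z => forall_congr' fun _ => ?_
  constructor
  · intro H hxz
    have hz := hxg z hxz
    rw [o.sel_swap_outside _ _ hz]
    exact H (S'.glued_congr S hx hz hxz)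
  · intro H hxz
    have hz := S.notMem_of_glued S' hband hx hxg z hxz
    rw [← o.sel_swap_outside (p / 2 + 1) _ hz]
    exact H (S.glued_congr S' hx hz hxz)

/-- If switching produces the matching given by `h'`, then `h'` agrees with `h` away from
the overlaps. -/
theorem sel_of_switch_outside {p : ℕ} {h' : ℕ → Bool}
    (e : o.switch Γ Δ p (matchingOf Γ (sidesOf G.tiles) h) = matchingOf Δ (sidesOf G.tiles) h')
    {x z z' : TileSide} (hx : x.1 ∉ Set.Icc o.s o.t ∪ Set.Icc o.s' o.t')
    (hxz : Glued Γ x z) (hxz' : Glued Δ x z') : Sel h' x ↔ Sel h x := by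
  have hxT : x.1 ∈ G.tiles := S.glued_mem_tiles hxz
  have := S.mem_switch_outside S' p (matchingOf Γ (sidesOf G.tiles) h) (x := tipMate x) hxT hx
    (fun w hw => absurd hw (S'.tame.not_glued_tipMate hxz' w))
  rw [e, S.mem_tipMate hxz, S'.mem_tipMate hxz', sel_tipMate, sel_tipMate] at this
  exact not_iff_not.1 this

theorem sel_of_switch_ne (hband : o.t + 1 < o.s') {p : ℕ} {h' : ℕ → Bool}
    (e : o.switch Γ Δ p (matchingOf Γ (sidesOf G.tiles) h) = matchingOf Δ (sidesOf G.tiles) h')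
    (hp : p < 2 * o.t) (c : Bool) {y : TileSide} (hy : y.1 ∈ Set.Icc o.s o.t) :
    Sel h' (o.emb c y) ↔ if 2 * y.1 ≤ p then Sel h (o.emb c y) else Sel h (o.emb (!c) y) := by
  suffices H : ∃ z : TileSide, z.1 = y.1 ∧ (Sel h' (o.emb c z) ↔
      if 2 * y.1 ≤ p then Sel h (o.emb c z) else Sel h (o.emb (!c) z)) by
    obtain ⟨z, hz, H⟩ := H
    split_ifs with hk
    · rw [if_pos hk] at H
      exact (sel_same_tile (o.emb_fst_eq c hz) (o.emb_fst_eq c hz) (o.horizontal_emb _ _ _ _)).1 H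
    · rw [if_neg hk] at H
      exact (sel_same_tile (o.emb_fst_eq c hz) (o.emb_fst_eq (!c) hz)
        (o.horizontal_emb _ _ _ _)).1 H
  rcases hy.2.eq_or_lt with hyt | hyt
  · refine ⟨(o.t, b c), hyt.symm, ?_⟩
    have hT : ((o.t, b c) : TileSide).1 ∈ Set.Icc o.s o.t := ⟨o.s_le_t, le_rfl⟩
    have hr : o.rank (o.t, b c) = 2 * o.t := o.rank_of_ne (S.tip_side c)
    have h1 := S.mem_switch_of_lt S' hband (matchingOf Γ (sidesOf G.tiles) h) c hT
      (by rw [hr]; exact hp)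
    have hm := S'.mem_side_not (h := h') c
    have hm' := S.mem_side_not (h := h) (!c)
    simp only [Bool.not_not] at hm hm'
    rw [if_neg (by omega), ← hm', ← h1, e, hm]
  · refine ⟨(y.1, G.exitBdry y.1), rfl, ?_⟩
    have hr : o.rank (y.1, G.exitBdry y.1) = 2 * y.1 := o.rank_of_ne (G.tip_exitBdry _)
    rw [← S'.mem_exitBdry hband c hy.1 hyt, ← e]
    split_ifs with hk
    · rw [S.mem_switch_of_le S' hband _ c (y := (y.1, G.exitBdry y.1)) hy (by omega),
        S.mem_exitBdry hband c hy.1 hyt]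
    · rw [S.mem_switch_of_lt S' hband _ c (y := (y.1, G.exitBdry y.1)) hy (by omega),
        S.mem_exitBdry hband _ hy.1 hyt]

theorem sel_of_switch_sw (hband : o.t + 1 < o.s') {p : ℕ} {h' : ℕ → Bool}
    (e : o.switch Γ Δ p (matchingOf Γ (sidesOf G.tiles) h) = matchingOf Δ (sidesOf G.tiles) h')
    (c : Bool) {y : TileSide} (hy : y.1 ∈ Set.Icc o.s o.t) (hp : 2 * y.1 - 1 ≤ p) :
    Sel h' (o.emb c y) ↔ Sel h (o.emb c y) := by
  suffices H : ∃ z : TileSide, z.1 = y.1 ∧ (Sel h' (o.emb c z) ↔ Sel h (o.emb c z)) by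
    obtain ⟨z, hz, H⟩ := H
    exact (sel_same_tile (o.emb_fst_eq c hz) (o.emb_fst_eq c hz) (o.horizontal_emb _ _ _ _)).1 H
  rcases hy.1.eq_or_lt with hys | hys
  · have : ∃ z : TileSide, z.1 = o.s ∧ z.2.tip = .sw ∧
        ¬ (o.HasOuter c ∧ z = (o.s, o.outerSide c)) := by
      by_cases hz : o.outerSide c = .south
      · exact ⟨(o.s, .west), rfl, rfl, by simp [hz]⟩
      · exact ⟨(o.s, .south), rfl, rfl, by simp [Ne.symm hz]⟩
    obtain ⟨z, hz, htip, hno⟩ := this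
    refine ⟨z, hz.trans hys, ?_⟩
    have hr : o.rank z = 2 * o.s - 1 := by
      rw [o.rank_of_sw htip (by omega), hz]
    rw [← S'.mem_first hband hz htip hno, ← e,
      S.mem_switch_of_le S' hband _ c ⟨hz.ge, hz.trans_le o.s_le_t⟩ (by omega),
      S.mem_first hband hz htip hno]
  · refine ⟨(y.1, G.entryBdry y.1), rfl, ?_⟩
    have hr : o.rank (y.1, G.entryBdry y.1) = 2 * y.1 - 1 := by
      refine o.rank_of_sw (G.tip_entryBdry _) ?_
      rintro ⟨-, h'⟩
      have := G.tipMate_entry y.1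
      rw [← h'] at this
      exact tipMate_ne _ this
    rw [← S'.mem_entryBdry hband c hys hy.2, ← e,
      S.mem_switch_of_le S' hband _ c (y := (y.1, G.entryBdry y.1)) hy (by omega),
      S.mem_entryBdry hband c hys hy.2]

theorem goodPos_of_isPerfectMatching (hband : o.t + 1 < o.s') {p : ℕ}
    (hp1 : 2 * o.s - 2 ≤ p) (hp2 : p ≤ 2 * o.t)
    (hP : IsPerfectMatching (sideGraph Δ (sidesOf G.tiles))
      (o.switch Γ Δ p (matchingOf Γ (sidesOf G.tiles) h))) : o.GoodPos m h p := by
  have h0 := o.one_le_s; have hst := o.s_le_t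
  obtain ⟨h', hv, e⟩ := (S'.isPerfectMatching_iff _).1 hP
  have hv' : ∀ x y, Glued Δ x y → Sel h' x ∨ Sel h' y := fun x y hxy =>
    hv x (S'.glued_mem_tiles hxy) y (S'.glued_mem_tiles hxy.symm) hxy
  have hNE := fun (H : p < 2 * o.t) c (y : TileSide) (hy : y.1 ∈ Set.Icc o.s o.t) =>
    S.sel_of_switch_ne S' hband e H c hy
  by_cases hps : p = 2 * o.s - 2
  · refine Or.inl ⟨hps, fun c hc => ?_⟩
    have hy : ((o.s, o.outerSide c) : TileSide).1 ∈ Set.Icc o.s o.t := ⟨le_rfl, hst⟩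
    have htip := o.tip_outerSide c
    have hr : o.rank (o.s, o.outerSide c) = 2 * o.s - 1 :=
      o.rank_of_sw htip (by simp)
    have hno : ¬ (o.HasOuter (!c) ∧
        ((o.s, o.outerSide c) : TileSide) = (o.s, o.outerSide (!c))) := by
      rintro ⟨hc', e⟩
      have e' := (Prod.mk.inj e).2
      cases c
      · exact o.outerSide_ne hc hc' e'.symm
      · exact o.outerSide_ne hc' hc e'
    have h1 := S.mem_switch_of_lt S' hband (matchingOf Γ (sidesOf G.tiles) h) c hy (p := p)
      (by omega)
    rw [e, S'.mem_outerSide hband hc, S.mem_first hband rfl htip hno] at h1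
    have h2 := hNE (by omega) c _ hy
    rw [if_neg (by dsimp only; omega)] at h2
    have h3 := hv' _ _ (S'.glued_outer hband hc)
    have h4 := S.sel_of_switch_outside S' e (o.outer_notMem hband hc)
      (S.glued_outer hband hc).symm (S'.glued_outer hband hc).symm
    tauto
  by_cases hpt : p = 2 * o.t
  · refine Or.inr (Or.inr ⟨hpt, ?_⟩)
    suffices H : ∀ c, Sel h (m (!c)) by
      intro c
      simpa using H (!c)
    intro c
    have hy : ((o.t, b (!c)) : TileSide).1 ∈ Set.Icc o.s o.t := ⟨hst, le_rfl⟩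
    have hr : o.rank (o.t, b (!c)) = 2 * o.t := o.rank_of_ne (S.tip_side _)
    have h1 := S.mem_switch_of_le S' hband (matchingOf Γ (sidesOf G.tiles) h) c hy (p := p)
      (by omega)
    rw [e, S'.mem_side c, S.mem_side_not] at h1
    have h2 := S.sel_of_switch_sw S' hband e c hy (by dsimp only; omega)
    have h3 := hv' _ _ (S'.glued_middle c)
    have hg := S.glued_middle (!c)
    have h4 := S.sel_of_switch_outside S' e (S.middle_notMem (!c)) hg.symm
      (S'.glued_middle c).symm
    tauto
  refine Or.inr (Or.inl ?_)
  obtain ⟨k, hk⟩ : ∃ k, p = 2 * k - 1 ∨ p = 2 * k - 2 := ⟨p / 2 + 1, by omega⟩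
  by_cases hk' : p = 2 * k - 1
  · refine ⟨k, by omega, by omega, ?_, Or.inl hk'⟩
    have hy : ((k, .north) : TileSide).1 ∈ Set.Icc o.s o.t :=
      ⟨by dsimp only; omega, by dsimp only; omega⟩
    have h1 := hNE (by omega) false _ hy
    rw [if_neg (by dsimp only; omega)] at h1
    have h2 := S.sel_of_switch_sw S' hband e false hy (by dsimp only; omega)
    exact h2.symm.trans h1
  · obtain ⟨j, rfl⟩ : ∃ j, k = j + 1 := ⟨k - 1, by omega⟩
    refine ⟨j + 1, by omega, by omega, ?_, Or.inr ⟨by omega, by omega⟩⟩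
    have hj1 : o.s ≤ j := by omega
    have hj2 : j < o.t := by omega
    have hy : ((j, G.exit j) : TileSide).1 ∈ Set.Icc o.s o.t := ⟨hj1, hj2.le⟩
    have hy' : ((j + 1, G.entry (j + 1)) : TileSide).1 ∈ Set.Icc o.s o.t :=
      ⟨by dsimp only; omega, hj2⟩
    have hr : o.rank (j, G.exit j) = 2 * j := o.rank_of_ne (G.tip_exit j)
    have key : ∀ c, (Sel h (o.emb c (j, G.exit j)) ∧ Sel h (o.emb c (j + 1, G.entry (j + 1))) ↔
        Sel h (o.emb c (j, G.exit j)) ∧ Sel h (o.emb (!c) (j + 1, G.entry (j + 1)))) ∧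
        (Sel h (o.emb c (j, G.exit j)) ∨ Sel h (o.emb (!c) (j + 1, G.entry (j + 1)))) := by
      intro c
      have h1 := S.mem_switch_of_le S' hband (matchingOf Γ (sidesOf G.tiles) h) c hy (p := p)
        (by omega)
      have h2 := hNE (by omega) c _ hy
      have h3 := hNE (by omega) c _ hy'
      have h4 := hv' _ _ (S'.glued_exit hband c hj1 hj2)
      rw [if_pos (by dsimp only; omega)] at h2
      rw [if_neg (by dsimp only; omega)] at h3
      rw [e, S'.mem_exit hband c hj1 hj2, S.mem_exit hband c hj1 hj2] at h1
      rw [h2, h3] at h1 h4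
      exact ⟨h1.symm, h4⟩
    refine (agree_iff false (j + 1, G.entry (j + 1))).2 ?_
    obtain ⟨k1, k2⟩ := key false
    obtain ⟨k3, k4⟩ := key true
    simp only [Bool.not_false, Bool.not_true] at k1 k2 k3 k4 ⊢
    exact ⟨fun hx => k4.elim (fun hB => (k3.2 ⟨hB, hx⟩).2) fun _ => k2.elim
        (fun hA => (k1.1 ⟨hA, hx⟩).2) id,
      fun hy => k2.elim (fun hA => (k1.2 ⟨hA, hy⟩).2) fun _ => k4.elim
        (fun hB => (k3.1 ⟨hB, hy⟩).2) id⟩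

theorem switchPositions_eq (hband : o.t + 1 < o.s') (hv : Valid Γ (sidesOf G.tiles) h) :
    o.switchPositions Γ Δ (matchingOf Γ (sidesOf G.tiles) h) = {p | o.GoodPos m h p} := by
  ext p
  constructor
  · rintro ⟨h1, h2, h3⟩
    exact S.goodPos_of_isPerfectMatching S' hband h1 h2 h3
  · intro hp
    refine ⟨hp.le.1, hp.le.2, ?_⟩
    rw [S.switch_eq S' hband hp]
    exact (S'.isPerfectMatching_iff _).2 ⟨_, S.valid_swap S' hband hv hp, rfl⟩

end switch

end Strands

end OppositeOverlap

end SnakeGraph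

/-! ### Signs -/

/-- The sign function on a single tile whose value on the north side is `1`. -/
def Side.sign : Side → ℤˣ
  | .south => -1
  | .east => -1
  | .north => 1
  | .west => 1

namespace SnakeGraph

variable {G : SnakeGraph} (f : Edge G.gluing → ℤˣ)

/-- The sign of a perfect matching of the tile with index `k`: the common sign of its edges among
the south and west edges of the tile, which is opposite to that of its edges among the north and
east edges. -/
def state (h : ℕ → Bool) (k : ℕ) : ℤˣ :=
  if h k then -f (edge G.gluing (k, .north)) else f (edge G.gluing (k, .north))

/-- The choice of matchings of the tiles with prescribed signs. -/
def ofState (u : ℕ → ℤˣ) (k : ℕ) : Bool := decide (f (edge G.gluing (k, .north)) ≠ u k)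

theorem state_ofState (u : ℕ → ℤˣ) (k : ℕ) : state f (ofState f u) k = u k := by
  unfold state ofState
  by_cases h : f (edge G.gluing (k, .north)) = u k
  · simp [h]
  · simp [Int.units_ne_iff_eq_neg.1 h]

theorem eq_of_state_eq {h h' : ℕ → Bool} {k : ℕ} (e : state f h k = state f h' k) :
    h k = h' k := by
  revert e
  unfold state
  generalize f _ = a
  generalize h k = b
  generalize h' k = b'
  revert a b b'
  decide

theorem state_congr {h h' : ℕ → Bool} {k : ℕ} (e : h k = h' k) : state f h k = state f h' k := by
  unfold state
  rw [e]

variable {f} (hf : G.IsSignFunction f)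
include hf

theorem sign_side {x : TileSide} (hx : x.1 ∈ G.tiles) : f (edge G.gluing x) =
    x.2.sign * f (edge G.gluing (x.1, .north)) := by
  obtain ⟨h1, h2, h3⟩ := hf x.1 hx
  rcases x with ⟨k, a⟩
  dsimp only at h1 h2 h3 ⊢
  cases a <;> simp only [Side.sign, one_mul, neg_mul]
  · rw [h3, neg_neg]
  · rw [h3, ← h2, neg_neg]
  · exact h1.symm

theorem sign_tipMate {x : TileSide} (hx : x.1 ∈ G.tiles) :
    f (edge G.gluing (tipMate x)) = -f (edge G.gluing x) := by
  rw [sign_side hf hx, sign_side hf (x := tipMate x) hx]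
  rcases x with ⟨k, a⟩
  cases a <;> simp [tipMate, Side.tipMate, Side.sign]

theorem sel_iff_of_sw {h : ℕ → Bool} {x : TileSide} (hx : x.1 ∈ G.tiles) (htip : x.2.tip = .sw) :
    Sel h x ↔ f (edge G.gluing x) = state f h x.1 := by
  rw [sign_side hf hx]
  unfold Sel state
  generalize f _ = u
  generalize h x.1 = b
  rcases x with ⟨k, a⟩
  dsimp only at htip ⊢
  revert u b
  cases a
  · decide
  · cases htip
  · cases htip
  · decide

theorem sel_iff_of_ne {h : ℕ → Bool} {x : TileSide} (hx : x.1 ∈ G.tiles) (htip : x.2.tip = .ne) :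
    Sel h x ↔ f (edge G.gluing x) = -state f h x.1 := by
  rw [sign_side hf hx]
  unfold Sel state
  generalize f _ = u
  generalize h x.1 = b
  rcases x with ⟨k, a⟩
  dsimp only at htip ⊢
  revert u b
  cases a
  · cases htip
  · decide
  · decide
  · cases htip

theorem sel_exit_iff {h : ℕ → Bool} {i : ℕ} (h1 : 1 ≤ i) (h2 : i < G.d) :
    Sel h (i, G.exit i) ↔ G.innerSign f i = -state f h i :=
  sel_iff_of_ne hf (x := (i, G.exit i)) ⟨h1, h2.le⟩ (G.tip_exit i)

omit hf in
theorem innerSign_eq {i : ℕ} (h1 : 1 ≤ i) (h2 : i < G.d) :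
    G.innerSign f i = f (edge G.gluing (i + 1, G.entry (i + 1))) :=
  congrArg f (edge_eq_of_glued (G.glued_inner h1 h2))

theorem sel_entry_iff {h : ℕ → Bool} {i : ℕ} (h1 : 1 ≤ i) (h2 : i < G.d) :
    Sel h (i + 1, G.entry (i + 1)) ↔ G.innerSign f i = state f h (i + 1) := by
  rw [innerSign_eq (f := f) h1 h2]
  exact sel_iff_of_sw hf (x := (i + 1, G.entry (i + 1))) ⟨Nat.succ_pos i, h2⟩ (G.tip_entry _)

/-- If the two tiles at an interior edge are matched with the same sign, then exactly one of
the two copies of the edge is selected. -/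
theorem sel_entry_iff_of_state_eq {h : ℕ → Bool} {i : ℕ} (h1 : 1 ≤ i) (h2 : i < G.d)
    (e : state f h i = state f h (i + 1)) :
    Sel h (i + 1, G.entry (i + 1)) ↔ ¬ Sel h (i, G.exit i) := by
  rw [sel_exit_iff hf h1 h2, sel_entry_iff hf h1 h2, e, ← Ne, Int.units_ne_iff_eq_neg, neg_neg]

namespace OppositeOverlap

variable (o : G.OppositeOverlap) (hcross : o.SelfCrosses f) (hband : o.t + 1 < o.s')

omit hf in
theorem inner_t_lt (hband : o.t + 1 < o.s') : o.t < G.d := by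
  have h2 := o.s'_le_t'; have h3 := o.t'_le_d
  omega

theorem sign_flip_iff {k l : ℕ} (hk : k ∈ G.tiles) (hl : l ∈ G.tiles) (a b : Side) :
    f (edge G.gluing (l, o.σ.side a)) = -f (edge G.gluing (k, a)) ↔
      f (edge G.gluing (l, o.σ.side b)) = -f (edge G.gluing (k, b)) := by
  rw [sign_side hf (x := (l, o.σ.side a)) hl, sign_side hf (x := (l, o.σ.side b)) hl,
    sign_side hf (x := (k, a)) hk, sign_side hf (x := (k, b)) hk]
  dsimp only
  generalize f (edge G.gluing (l, .north)) = u
  generalize f (edge G.gluing (k, .north)) = v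
  revert u v
  cases o.σ <;> cases a <;> cases b <;> decide

include hcross hband

/-- The isomorphism between the two copies of the overlap reverses the signs. -/
theorem sign_flip {y : TileSide} (hy : y.1 ∈ Set.Icc o.s o.t) :
    f (edge G.gluing (o.flip y)) = -f (edge G.gluing y) := by
  have h0 := o.one_le_s; have h1 := o.s_le_t; have h2 := o.s'_le_t'; have h3 := o.t'_le_d
  have h4 := o.s_add_t'
  have htile : ∀ k, o.s ≤ k → k ≤ o.t → k ∈ G.tiles ∧ o.s + o.t' - k ∈ G.tiles :=
    fun k hk hk' => ⟨⟨by omega, by omega⟩, ⟨by omega, by omega⟩⟩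
  have hone : ∀ k, o.s ≤ k → k ≤ o.t → ∀ b,
      f (edge G.gluing (o.flip (k, b))) = -f (edge G.gluing (k, b)) → ∀ a,
      f (edge G.gluing (o.flip (k, a))) = -f (edge G.gluing (k, a)) := fun k hk hk' b hb a =>
    (o.sign_flip_iff hf (htile k hk hk').1 (htile k hk hk').2 b a).1 hb
  have hs' : o.s' - 1 + 1 = o.s' := by omega
  suffices H : ∀ n k, k + n = o.t → o.s ≤ k → ∀ a,
      f (edge G.gluing (o.flip (k, a))) = -f (edge G.gluing (k, a)) by
    exact H (o.t - y.1) y.1 (by have := hy.2; omega) hy.1 y.2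
  intro n
  induction n with
  | zero =>
    rintro k rfl hk
    refine hone _ hk le_rfl (G.exit o.t) ?_
    have e := innerSign_eq (f := f) (i := o.s' - 1) (by omega) (by omega)
    rw [hs', ← hcross.2] at e
    change f (edge G.gluing (o.flip (o.t, G.exit o.t))) = -G.innerSign f o.t
    rw [o.flip_exit_t hband, ← tipMate_entry, sign_tipMate hf (x := (o.s', G.entry o.s'))
      (show o.s' ∈ G.tiles from ⟨by omega, by omega⟩), e]
  | succ n ih =>
    intro k hkn hk
    have hkt : k < o.t := by omega
    have S := o.strands hband
    have g0 := edge_eq_of_glued (S.glued_exit hband false hk hkt)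
    have g1 := edge_eq_of_glued (S.glued_exit hband true hk hkt)
    refine hone k hk hkt.le (G.exit k) ?_
    have := ih (k + 1) (by omega) (by omega) (G.entry (k + 1))
    rw [emb_false, emb_false] at g0
    rw [emb_true, emb_true] at g1
    rw [g0, g1]
    exact this

theorem agree_iff_state {h : ℕ → Bool} {k : ℕ} (h1 : o.s ≤ k) (h2 : k ≤ o.t) :
    o.Agree h k ↔ state f h k = state f h (o.s + o.t' - k) := by
  have hy : ((k, .north) : TileSide).1 ∈ Set.Icc o.s o.t := ⟨h1, h2⟩
  have e := o.sign_flip hf hcross hband hy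
  unfold Agree
  rw [sel_iff_of_ne hf (o.emb_mem_tiles false hy) rfl,
    sel_iff_of_sw hf (o.emb_mem_tiles true hy) (by
      rw [emb_true]
      exact o.σ.tip_side .north)]
  rw [emb_true, emb_false, e]
  change (_ = -state f h k ↔ _ = state f h (o.s + o.t' - k)) ↔ _
  generalize f _ = a
  generalize state f h k = b
  generalize state f h _ = c
  revert a b c
  decide

theorem innerSign_flip {k : ℕ} (h1 : o.s ≤ k) (h2 : k < o.t) :
    G.innerSign f (o.s + o.t' - (k + 1)) = -G.innerSign f k := by
  have e := o.sign_flip hf hcross hband (y := (k + 1, G.entry (k + 1)))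
    ⟨by dsimp only; omega, by dsimp only; omega⟩
  have h0 := o.one_le_s
  rw [o.flip_entry h1 h2, ← innerSign_eq (f := f) (by omega) (by have := o.inner_t_lt hband; omega)] at e
  exact e

/-- In case of a crossing, the edges at the outer ends of the overlap have the sign opposite to
that of the edges at its inner ends. -/
theorem innerSign_outer : (1 < o.s → G.innerSign f (o.s - 1) = -G.innerSign f o.t) ∧
    (o.t' < G.d → G.innerSign f o.t' = -G.innerSign f o.t) := by
  have h1 := o.s_le_t
  by_cases hs : 1 < o.s
  · by_cases hd : o.t' < G.d
    · have h0 : o.HasOuter false := hs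
      have h1' : o.HasOuter true := hd
      have hmate := o.tipMate_outerSide (fun c => by cases c; exacts [h0, h1']) false
      have hst : o.s - 1 + 1 = o.s := by omega
      have hT : o.s ∈ G.tiles := ⟨hs.le, by have := o.inner_t_lt hband; omega⟩
      have S := o.strands hband
      have e0 := innerSign_eq (f := f) (i := o.s - 1) (by omega)
        (by have := o.inner_t_lt hband; omega)
      rw [hst] at e0
      have e1 : G.innerSign f o.t' = G.innerSign f (o.s - 1) := by
        have e2 := o.sign_flip hf hcross hband (y := (o.s, o.outerSide true)) ⟨le_rfl, h1⟩
        have e3 := sign_tipMate hf (x := (o.s, o.outerSide false)) hT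
        rw [hmate, Bool.not_false] at e3
        rw [e3, neg_neg] at e2
        rw [e0]
        refine Eq.trans ?_ e2
        have e : o.s + o.t' - o.s = o.t' := by omega
        have e4 : o.flip (o.s, o.outerSide true) = (o.t', G.exit o.t') := by
          simp only [flip, outerSide, if_true, Flip.side_side, e]
        rw [e4]
        rfl
      rcases hcross.1 with ⟨-, h⟩ | ⟨-, h⟩ | ⟨h, -⟩
      · exact ⟨fun _ => h, fun _ => e1.trans h⟩
      · have h' : G.innerSign f o.t' = -G.innerSign f o.t := by
          rw [hcross.2, h, neg_neg]
        exact ⟨fun _ => e1.symm.trans h', fun _ => h'⟩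
      · omega
    · refine ⟨fun _ => ?_, fun h => absurd h hd⟩
      rcases hcross.1 with ⟨-, h⟩ | ⟨h, -⟩ | ⟨h, -⟩
      · exact h
      · exact absurd h hd
      · omega
  · refine ⟨fun h => absurd h hs, fun hd => ?_⟩
    rcases hcross.1 with ⟨h, -⟩ | ⟨-, h⟩ | ⟨-, h⟩
    · exact absurd h hs
    · rw [hcross.2, h, neg_neg]
    · omega

/-- If the two copies of the overlap disagree on every tile, then the sign is constant along each
of them. -/
theorem state_eq_of_not_agree {Γ : Gluing} {b : Bool → Side} {m : Bool → TileSide}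
    (S : o.Strands Γ b m) {h : ℕ → Bool} (hv : Valid Γ (sidesOf G.tiles) h)
    (hno : ∀ k, o.s ≤ k → k ≤ o.t → ¬ o.Agree h k) {k : ℕ} (h1 : o.s ≤ k) (h2 : k ≤ o.t) :
    state f h k = state f h o.t ∧ state f h (o.s + o.t' - k) = -state f h o.t := by
  have h0 := o.one_le_s; have hs2 := o.s'_le_t'; have h3 := o.t'_le_d; have h4 := o.s_add_t'
  have hno' : ∀ k, o.s ≤ k → k ≤ o.t → state f h (o.s + o.t' - k) = -state f h k := by
    intro k hk hk'
    have := hno k hk hk'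
    rw [o.agree_iff_state hf hcross hband hk hk', ← Ne, Int.units_ne_iff_eq_neg] at this
    rw [this, neg_neg]
  suffices H : ∀ n k, k + n = o.t → o.s ≤ k → state f h k = state f h o.t by
    have e := H (o.t - k) k (by omega) h1
    exact ⟨e, by rw [hno' k h1 h2, e]⟩
  intro n
  induction n with
  | zero => rintro k rfl -; rfl
  | succ n ih =>
    intro k hkn hk
    have hkt : k < o.t := by omega
    rw [← ih (k + 1) (by omega) (by omega)]
    have v : ∀ c, _ := fun c => hv _ (S.glued_mem_tiles (S.glued_exit hband c hk hkt)) _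
      (S.glued_mem_tiles (S.glued_exit hband c hk hkt).symm) (S.glued_exit hband c hk hkt)
    have v0 := v false
    have v1 := v true
    rw [emb_false, emb_false, sel_exit_iff hf (by omega) (by omega),
      sel_entry_iff hf (by omega) (by omega)] at v0
    rw [emb_true, emb_true, o.flip_exit hk hkt, o.flip_entry hk hkt,
      sel_exit_iff hf (by omega) (by omega), sel_entry_iff hf (by omega) (by omega),
      o.innerSign_flip hf hcross hband hk hkt, hno' (k + 1) (by omega) (by omega)] at v1
    have e : o.s + o.t' - (k + 1) + 1 = o.s + o.t' - k := by omega
    rw [e, hno' k hk (by omega)] at v1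
    revert v0 v1
    generalize G.innerSign f k = a
    generalize state f h k = b
    generalize state f h _ = c
    revert a b c
    decide

end OppositeOverlap

end SnakeGraph

namespace SnakeGraph

namespace OppositeOverlap

variable {G : SnakeGraph} {f : Edge G.gluing → ℤˣ} (hf : G.IsSignFunction f)
variable (o : G.OppositeOverlap) (hcross : o.SelfCrosses f) (hband : o.t + 1 < o.s')

/-! ### Matchings without a switching position -/

section sel

variable {h : ℕ → Bool}
include hf hcross hband

theorem sel_outer_false (hs : 1 < o.s) :
    Sel h (o.outer false) ↔ state f h (o.s - 1) = G.innerSign f o.t := by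
  have h1 := o.s_le_t; have h2 := o.inner_t_lt hband
  change Sel h (o.s - 1, G.exit (o.s - 1)) ↔ _
  rw [sel_exit_iff hf (by omega) (by omega), (o.innerSign_outer hf hcross hband).1 hs, neg_inj]
  exact eq_comm

theorem sel_outer_true (hd : o.t' < G.d) :
    Sel h (o.outer true) ↔ state f h (o.t' + 1) = -G.innerSign f o.t := by
  have h1 := o.s_le_t; have h2 := o.s'_le_t'
  change Sel h (o.t' + 1, G.entry (o.t' + 1)) ↔ _
  rw [sel_entry_iff hf (by omega) hd, (o.innerSign_outer hf hcross hband).2 hd]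
  exact eq_comm

theorem state_of_forall_not_goodPos (hv : Valid G.gluing (sidesOf G.tiles) h)
    (hno : ∀ p, ¬ o.GoodPos o.middle h p) :
    (∀ k, o.s ≤ k → k ≤ o.t → state f h k = -G.innerSign f o.t) ∧
    (∀ k, o.s' ≤ k → k ≤ o.t' → state f h k = G.innerSign f o.t) := by
  have h0 := o.one_le_s; have h1 := o.s_le_t; have h2 := o.s'_le_t'; have h3 := o.t'_le_d
  have h4 := o.s_add_t'
  have hagree : ∀ k, o.s ≤ k → k ≤ o.t → ¬ o.Agree h k := fun k hk hk' ha =>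
    hno (2 * k - 1) (Or.inr (Or.inl ⟨k, hk, hk', ha, Or.inl rfl⟩))
  have hmid : ¬ ∀ c, Sel h (o.middle c) := fun hm => hno (2 * o.t) (Or.inr (Or.inr ⟨rfl, hm⟩))
  have S := o.strands hband
  have key := fun k hk hk' => o.state_eq_of_not_agree hf hcross hband S hv hagree (k := k) hk hk'
  have hs' : o.s + o.t' - o.t = o.s' := by omega
  have ht : state f h o.t = -G.innerSign f o.t := by
    have k1 := (key o.t h1 le_rfl).2
    rw [hs'] at k1
    have hs1 : o.s' - 1 + 1 = o.s' := by omega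
    have v0 := hv (o.t, G.exit o.t) ⟨by dsimp only; omega, by dsimp only; omega⟩
      (o.t + 1, G.entry (o.t + 1)) ⟨by dsimp only; omega, by dsimp only; omega⟩
      (G.glued_inner (by omega) (by omega))
    have v1 := hv (o.s' - 1, G.exit (o.s' - 1)) ⟨by dsimp only; omega, by dsimp only; omega⟩
      (o.s' - 1 + 1, G.entry (o.s' - 1 + 1)) ⟨by dsimp only; omega, by dsimp only; omega⟩
      (G.glued_inner (by omega) (by omega))
    rw [sel_exit_iff hf (by omega) (by omega)] at v0
    rw [sel_entry_iff hf (by omega) (by omega), ← hcross.2, hs1, k1] at v1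
    rw [Bool.forall_bool] at hmid
    have m0 : Sel h (o.t + 1, G.entry (o.t + 1)) → Sel h (o.middle false) := id
    have m1 : Sel h (o.s' - 1, G.exit (o.s' - 1)) → Sel h (o.middle true) := id
    by_contra hne
    refine hmid ⟨m0 (v0.resolve_left fun e => hne ?_), m1 (v1.resolve_right fun e => hne ?_)⟩
    · rw [e, neg_neg]
    · rw [e, neg_neg]
  refine ⟨fun k hk hk' => (key k hk hk').1.trans ht, fun k hk hk' => ?_⟩
  have := (key (o.s + o.t' - k) (by omega) (by omega)).2
  have e : o.s + o.t' - (o.s + o.t' - k) = k := by omega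
  rwa [e, ht, neg_neg] at this

/-- Every perfect matching of `G₃₄` has a switching position: if the two copies of the overlap
disagree on every tile, the signs at the inner ends force those at the outer ends to be
selected. -/
theorem exists_goodPos34 (hv : Valid o.gluing34 (sidesOf G.tiles) h) :
    ∃ p, o.GoodPos (fun c => o.middle (!c)) h p := by
  by_contra! hno
  have h0 := o.one_le_s; have h1 := o.s_le_t; have h2 := o.s'_le_t'; have h3 := o.t'_le_d
  have h4 := o.s_add_t'
  have hagree : ∀ k, o.s ≤ k → k ≤ o.t → ¬ o.Agree h k := fun k hk hk' ha =>
    hno (2 * k - 1) (Or.inr (Or.inl ⟨k, hk, hk', ha, Or.inl rfl⟩))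
  have hmid : ¬ ∀ c, Sel h (o.middle (!c)) := fun hm => hno (2 * o.t) (Or.inr (Or.inr ⟨rfl, hm⟩))
  have S := o.strands34 hband
  have hv' : ∀ x y, Glued o.gluing34 x y → Sel h x ∨ Sel h y := fun x y hxy =>
    hv x (S.glued_mem_tiles hxy) y (S.glued_mem_tiles hxy.symm) hxy
  have key := fun k hk hk' => o.state_eq_of_not_agree hf hcross hband S hv hagree (k := k) hk hk'
  have hs' : o.s + o.t' - o.t = o.s' := by omega
  have ht : state f h o.t = G.innerSign f o.t := by
    have k1 := (key o.t h1 le_rfl).2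
    rw [hs'] at k1
    have v0 := hv' _ _ (S.glued_middle false)
    have v1 := hv' _ _ (S.glued_middle true)
    have e0 : o.emb false (o.t, o.innerSide (!false)) = tipMate (o.t, G.exit o.t) :=
      (G.tipMate_exit _).symm
    have e1 : o.emb true (o.t, o.innerSide (!true)) = tipMate (o.s', G.entry o.s') :=
      (o.flip_exit_t hband).trans (G.tipMate_entry _).symm
    have hs1 : o.s' - 1 + 1 = o.s' := by omega
    have e2 := sel_entry_iff hf (h := h) (i := o.s' - 1) (by omega) (by omega)
    rw [hs1, ← hcross.2, k1] at e2
    rw [e0, sel_tipMate, sel_exit_iff hf (by omega) (by omega), neg_eq_iff_eq_neg.symm] at v0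
    rw [e1, sel_tipMate, e2] at v1
    rw [Bool.forall_bool] at hmid
    by_contra hne
    have hne' : state f h o.t = -G.innerSign f o.t := Int.units_ne_iff_eq_neg.1 hne
    refine hmid ⟨v0.resolve_left (not_not.2 ?_), v1.resolve_left (not_not.2 ?_)⟩
    · exact hne'.symm
    · rw [hne', neg_neg]
  refine hno (2 * o.s - 2) (Or.inl ⟨rfl, fun c hc => ?_⟩)
  refine (hv' _ _ (S.glued_outer hband hc)).resolve_left ?_
  have hy : ((o.s, o.outerSide c) : TileSide).1 ∈ Set.Icc o.s o.t := ⟨le_rfl, h1⟩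
  have ks := key o.s le_rfl h1
  have es : o.s + o.t' - o.s = o.t' := by omega
  rw [es, ht] at ks
  cases c
  · have hs : 1 < o.s := hc
    have hst : o.s - 1 + 1 = o.s := by omega
    have e2 := sel_entry_iff hf (h := h) (i := o.s - 1) (by omega) (by omega)
    rw [hst, ks.1, (o.innerSign_outer hf hcross hband).1 hs] at e2
    exact fun e => units_ne_neg_self _ (e2.1 e).symm
  · have hd : o.t' < G.d := hc
    have e3 : o.emb true (o.s, o.outerSide true) = (o.t', G.exit o.t') := by
      simp only [emb_true, flip, outerSide, if_true, Flip.side_side, es]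
    rw [e3, sel_exit_iff hf (by omega) (by omega), ks.2,
      (o.innerSign_outer hf hcross hband).2 hd, neg_neg]
    exact fun e => units_ne_neg_self _ e.symm

end sel

end OppositeOverlap

end SnakeGraph

namespace SnakeGraph

namespace OppositeOverlap

variable {G : SnakeGraph} {f : Edge G.gluing → ℤˣ}

/-! ### The tiles of `G₅` and of the band graph -/

/-- The tiles of `G₅`; there are none if `G₅` is a single edge. If both `G[1,s-1]` and `G[t'+1,d]` are
non-empty, these are all their tiles; otherwise the tiles before the last, respectively after the
first, interior edge of the sign that `G₅` requires, which need not be chosen explicitly: a tile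
belongs to `G₅` if some such edge lies between it and the overlap. -/
def tiles5 (o : G.OppositeOverlap) (f : Edge G.gluing → ℤˣ) : Set ℕ :=
  {k | (1 ≤ k ∧ k < o.s ∧
      (o.t' < G.d ∨ ∃ j, k ≤ j ∧ j + 1 < o.s ∧ G.innerSign f j = G.innerSign f (o.s - 1))) ∨
    (o.t' < k ∧ k ≤ G.d ∧
      (1 < o.s ∨ ∃ j, o.t' < j ∧ j < k ∧ G.innerSign f j = G.innerSign f o.t'))}

/-- The signs, on the tiles that belong neither to `G₅` nor to the band graph, of a matching
without a switching position. -/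
def forcedState (o : G.OppositeOverlap) (f : Edge G.gluing → ℤˣ) (k : ℕ) : ℤˣ :=
  if k ≤ o.t then -G.innerSign f o.t else G.innerSign f o.t

/-- The tiles outside `G₅` and the band graph are matched with the signs `forcedState`. -/
def IsForced (o : G.OppositeOverlap) (f : Edge G.gluing → ℤˣ) (h : ℕ → Bool) : Prop :=
  ∀ k ∈ G.tiles, k ∉ o.tiles5 f → k ∉ o.tiles6 → state f h k = o.forcedState f k

section tiles

variable (o : G.OppositeOverlap)

theorem tiles5_subset {k : ℕ} (hk : k ∈ o.tiles5 f) : k ∈ G.tiles ∧ (k < o.s ∨ o.t' < k) := by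
  have h1 := o.s_le_t; have h2 := o.s'_le_t'; have h3 := o.t'_le_d; have h5 := o.lt
  rcases hk with ⟨h, h', -⟩ | ⟨h, h', -⟩
  · exact ⟨⟨h, by omega⟩, Or.inl h'⟩
  · exact ⟨⟨by omega, h'⟩, Or.inr h⟩

theorem tiles6_subset (hband : o.t + 1 < o.s') {k : ℕ} (hk : k ∈ o.tiles6) : k ∈ G.tiles := by
  have h2 := o.s'_le_t'; have h3 := o.t'_le_d
  exact ⟨(Nat.succ_pos _).trans_le hk.1, by have := hk.2; omega⟩

theorem mem_tiles6 (hband : o.t + 1 < o.s') {k : ℕ} : k ∈ o.tiles6 ↔ o.t < k ∧ k < o.s' := by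
  simp only [tiles6, Set.mem_Icc]
  omega

theorem mem_tiles5_of_both {k : ℕ} (hs : 1 < o.s) (hd : o.t' < G.d) (hk : k ∈ G.tiles)
    (hk' : k < o.s ∨ o.t' < k) : k ∈ o.tiles5 f := by
  rcases hk' with h | h
  · exact Or.inl ⟨hk.1, h, Or.inl hd⟩
  · exact Or.inr ⟨h, hk.2, Or.inl hs⟩

variable (hf : G.IsSignFunction f) (hcross : o.SelfCrosses f) (hband : o.t + 1 < o.s')

include hf hcross hband in
/-- Where `G₅` ends, the edge that leads out of it has the sign that selects it
from outside. -/
theorem innerSign_of_tiles5 {i : ℕ} (h1 : 1 ≤ i) (h2 : i < G.d) :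
    (i ∈ o.tiles5 f → i + 1 ∉ o.tiles5 f → i < o.s ∧ G.innerSign f i = -G.innerSign f o.t) ∧
    (i ∉ o.tiles5 f → i + 1 ∈ o.tiles5 f → o.t' ≤ i ∧ G.innerSign f i = -G.innerSign f o.t) := by
  have hst := o.s_le_t; have hs2 := o.s'_le_t'
  have hout := o.innerSign_outer hf hcross hband
  constructor
  · rintro (⟨-, h, h'⟩ | ⟨h, h', h''⟩) hn
    · refine ⟨h, ?_⟩
      by_cases hi : i + 1 = o.s
      · obtain rfl : i = o.s - 1 := by omega
        exact hout.1 (by omega)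
      · rcases h' with h' | ⟨j, hj, hj', hj''⟩
        · exact absurd (Or.inl ⟨by omega, by omega, Or.inl h'⟩) hn
        · by_cases hji : i = j
          · subst hji
            rw [hj'', hout.1 (by omega)]
          · exact absurd (Or.inl ⟨by omega, by omega, Or.inr ⟨j, by omega, hj', hj''⟩⟩) hn
    · refine absurd (Or.inr ⟨by omega, h2, ?_⟩) hn
      exact h''.imp id fun ⟨j, hj, hj', hj''⟩ => ⟨j, hj, by omega, hj''⟩
  · rintro hn (⟨h, h', h''⟩ | ⟨h, h', h''⟩)
    · refine absurd (Or.inl ⟨h1, by omega, ?_⟩) hn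
      exact h''.imp id fun ⟨j, hj, hj', hj''⟩ => ⟨j, by omega, hj', hj''⟩
    · refine ⟨by omega, ?_⟩
      by_cases hi : i = o.t'
      · subst hi
        exact hout.2 h2
      · rcases h'' with h'' | ⟨j, hj, hj', hj''⟩
        · exact absurd (Or.inr ⟨by omega, by omega, Or.inl h''⟩) hn
        · by_cases hji : j = i
          · subst hji
            rw [hj'', hout.2 (by omega)]
          · exact absurd (Or.inr ⟨by omega, by omega, Or.inr ⟨j, hj, by omega, hj''⟩⟩) hn

theorem glued5_of_glued {x y : TileSide} (h : Glued G.gluing x y) (hx : x.1 ∈ o.tiles5 f)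
    (hy : y.1 ∈ o.tiles5 f) : Glued o.gluing5 x y := by
  have hst := o.s_le_t; have hs2 := o.s'_le_t'; have h5 := o.lt
  obtain ⟨i, h1, h2, h⟩ := G.glued_gluing.1 h
  have key : i + 1 < o.s ∨ o.t' < i := by
    rcases h with ⟨rfl, rfl⟩ | ⟨rfl, rfl⟩ <;>
    · have := (o.tiles5_subset hx).2
      have := (o.tiles5_subset hy).2
      dsimp only at *
      omega
  rcases h with ⟨rfl, rfl⟩ | ⟨rfl, rfl⟩
  · exact Or.inl (Or.inl ⟨i, h1, h2, key, rfl⟩)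
  · exact Or.inr (Or.inl ⟨i, h1, h2, key, rfl⟩)

theorem glued5_cases {x y : TileSide} (h : Glued o.gluing5 x y) : Glued G.gluing x y ∨
    (1 < o.s ∧ o.t' < G.d ∧
      ((x = (o.s - 1, G.exitBdry (o.s - 1)) ∧ y = (o.t' + 1, G.entryBdry (o.t' + 1))) ∨
        (x = (o.t' + 1, G.entryBdry (o.t' + 1)) ∧ y = (o.s - 1, G.exitBdry (o.s - 1))))) := by
  rcases h with (⟨i, h1, h2, -, h⟩ | ⟨h1, h2, h⟩) | (⟨i, h1, h2, -, h⟩ | ⟨h1, h2, h⟩)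
  · exact Or.inl (Or.inl ⟨i, h1, h2, h⟩)
  · exact Or.inr ⟨h1, h2, Or.inl (Prod.mk.inj h)⟩
  · exact Or.inl (Or.inr ⟨i, h1, h2, h⟩)
  · exact Or.inr ⟨h1, h2, Or.inr (Prod.mk.inj h).symm⟩

theorem glued6_of_glued (hband : o.t + 1 < o.s') {x y : TileSide} (h : Glued G.gluing x y)
    (hx : x.1 ∈ o.tiles6) (hy : y.1 ∈ o.tiles6) : Glued o.gluing6 x y := by
  rw [o.mem_tiles6 hband] at hx hy
  obtain ⟨i, h1, h2, ⟨rfl, rfl⟩ | ⟨rfl, rfl⟩⟩ := G.glued_gluing.1 h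
  · exact Or.inl (Or.inl ⟨i, hx.1, hy.2, rfl⟩)
  · exact Or.inr (Or.inl ⟨i, hy.1, hx.2, rfl⟩)

theorem glued6_cases {x y : TileSide} (h : Glued o.gluing6 x y) :
    Glued G.gluing x y ∨
      ((x = (o.s' - 1, G.exitBdry (o.s' - 1)) ∧ y = (o.t + 1, G.entryBdry (o.t + 1))) ∨
        (x = (o.t + 1, G.entryBdry (o.t + 1)) ∧ y = (o.s' - 1, G.exitBdry (o.s' - 1)))) := by
  have h2 := o.s'_le_t'; have h3 := o.t'_le_d
  rcases h with (⟨i, h1, h2, h⟩ | h) | (⟨i, h1, h2, h⟩ | h)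
  · exact Or.inl (Or.inl ⟨i, by omega, by omega, h⟩)
  · exact Or.inr (Or.inl (Prod.mk.inj h))
  · exact Or.inl (Or.inr ⟨i, by omega, by omega, h⟩)
  · exact Or.inr (Or.inr (Prod.mk.inj h).symm)

include hf hcross hband

/-- A side glued to `G₅` or to the band graph, but not in it, is selected in a matching whose
signs outside them are the forced ones. -/
theorem sel_of_isForced {h : ℕ → Bool} (hh : o.IsForced f h) {x y : TileSide}
    (hxy : Glued G.gluing x y) (hx : x.1 ∈ o.tiles5 f ∪ o.tiles6)
    (hy : y.1 ∉ o.tiles5 f ∪ o.tiles6) : Sel h y := by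
  have h0 := o.one_le_s; have hst := o.s_le_t; have hs2 := o.s'_le_t'; have h5 := o.t'_le_d
  rw [Set.mem_union, not_or] at hy
  rcases hx with hx | hx
  · obtain ⟨i, h1, h2, ⟨rfl, rfl⟩ | ⟨rfl, rfl⟩⟩ := G.glued_gluing.1 hxy
    · obtain ⟨hi, e⟩ := (o.innerSign_of_tiles5 hf hcross hband h1 h2).1 hx hy.1
      rw [sel_entry_iff hf h1 h2, hh (i + 1) ⟨by omega, h2⟩ hy.1 hy.2, forcedState,
        if_pos (by omega)]
      exact e
    · obtain ⟨hi, e⟩ := (o.innerSign_of_tiles5 hf hcross hband h1 h2).2 hy.1 hx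
      rw [sel_exit_iff hf h1 h2, hh i ⟨h1, h2.le⟩ hy.1 hy.2, forcedState, if_neg (by omega)]
      exact e
  · rw [o.mem_tiles6 hband] at hx
    obtain ⟨i, h1, h2, ⟨rfl, rfl⟩ | ⟨rfl, rfl⟩⟩ := G.glued_gluing.1 hxy
    · have hy2 := hy.2
      rw [o.mem_tiles6 hband] at hy2
      dsimp only at hx hy2
      obtain rfl : i = o.s' - 1 := by omega
      rw [sel_entry_iff hf h1 h2, hh (o.s' - 1 + 1) ⟨by omega, h2⟩ hy.1 hy.2, forcedState,
        if_neg (by omega)]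
      exact hcross.2.symm
    · have hy2 := hy.2
      rw [o.mem_tiles6 hband] at hy2
      dsimp only at hx hy2
      obtain rfl : i = o.t := by omega
      rw [sel_exit_iff hf h1 h2, hh o.t ⟨h1, h2.le⟩ hy.1 hy.2, forcedState,
        if_pos le_rfl, neg_neg]

omit hf hcross in
theorem forcedState_succ {i : ℕ} (hi : i + 1 ∉ o.tiles6) :
    o.forcedState f i = o.forcedState f (i + 1) := by
  rw [o.mem_tiles6 hband] at hi
  unfold forcedState
  by_cases h : i ≤ o.t
  · rw [if_pos h, if_pos (by omega)]
  · rw [if_neg h, if_neg (by omega)]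

/-- Either `G₅` consists of all sides of the tiles in `tiles5`, or it is a single boundary edge of `G`,
which belongs to every matching with the forced signs. -/
theorem sides5_cases : o.sides5 f = sidesOf (o.tiles5 f) ∨
    ∃ x, o.sides5 f = {x} ∧ o.tiles5 f = ∅ ∧ x.1 ∈ G.tiles ∧ x.1 ∉ o.tiles6 ∧
      (∀ y, ¬ Glued G.gluing x y) ∧
      ∀ h, state f h x.1 = o.forcedState f x.1 → Sel h x := by
  have h0 := o.one_le_s; have hst := o.s_le_t; have hs2 := o.s'_le_t'; have h5 := o.t'_le_d
  have hout := o.innerSign_outer hf hcross hband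
  unfold sides5
  by_cases hs : o.s = 1 <;> by_cases hd : o.t' = G.d
  · rw [if_neg (by omega), if_neg (by omega), if_neg (by omega)]
    refine Or.inl (Eq.symm ?_)
    ext x
    refine ⟨?_, fun h => absurd h (Set.notMem_empty _)⟩
    rintro (h | h) <;> omega
  · rw [if_neg (by omega), if_pos ⟨hs, hd⟩]
    by_cases hex : ∃ j, o.t' + 1 ≤ j ∧ j < G.d ∧ G.innerSign f j = G.innerSign f o.t'
    · left
      ext x
      constructor
      · rintro (⟨i, hi, hi', hi''⟩ | ⟨hno, -⟩)
        · exact Or.inr ⟨by have := hi.1.1; omega, hi'',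
            Or.inr ⟨i, by have := hi.1.1; omega, by omega, hi.1.2.2⟩⟩
        · obtain ⟨j, hj, hj', hj''⟩ := hex
          exact absurd hj'' (hno j hj hj')
      · rintro (⟨h, h', -⟩ | ⟨h, h', h'' | ⟨j, hj, hj', hj''⟩⟩)
        · omega
        · omega
        · have hmem : j ∈ {j | o.t' + 1 ≤ j ∧ j < G.d ∧ G.innerSign f j = G.innerSign f o.t'} :=
            ⟨by omega, by omega, hj''⟩
          refine Or.inl ⟨sInf _, ⟨Nat.sInf_mem ⟨j, hmem⟩, fun k hk => Nat.sInf_le hk⟩, ?_, h'⟩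
          exact (Nat.succ_le_succ (Nat.sInf_le hmem)).trans hj'
    · right
      have hdT : G.d ∈ G.tiles := ⟨G.one_le_d, le_rfl⟩
      have htm := sign_tipMate hf (x := (G.d, .north)) hdT
      have hx : ∃ x : TileSide, x.1 = G.d ∧ x.2.tip = .ne ∧
          f (edge G.gluing x) = G.innerSign f o.t' := by
        by_cases h : f (edge G.gluing (G.d, .north)) = G.innerSign f o.t'
        · exact ⟨(G.d, .north), rfl, rfl, h⟩
        · refine ⟨tipMate (G.d, .north), rfl, rfl, ?_⟩
          rw [htm, Int.units_ne_iff_eq_neg.1 h, neg_neg]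
      obtain ⟨x, hx1, hx2, hx3⟩ := hx
      refine ⟨x, ?_, ?_, by rw [hx1]; exact hdT, by rw [o.mem_tiles6 hband]; omega, ?_, ?_⟩
      · ext y
        constructor
        · rintro (⟨i, hi, -⟩ | ⟨-, hy1, hy2, hy3⟩)
          · exact absurd ⟨i, hi.1⟩ hex
          · have htip : tipCorner y = tipCorner x := by
              have : y.2.tip = .ne := by rcases hy2 with h | h <;> rw [h] <;> rfl
              simp [tipCorner, hx1, hy1, this, hx2]
            rcases tipCorner_eq_iff.1 htip with rfl | rfl
            · rfl
            · rw [sign_tipMate hf (by rw [hx1]; exact hdT), hx3] at hy3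
              exact absurd hy3.symm (units_ne_neg_self _)
        · rintro rfl
          refine Or.inr ⟨fun j hj hj' hj'' => hex ⟨j, hj, hj', hj''⟩, hx1, ?_, hx3⟩
          revert hx2
          cases y.2 <;> simp [Side.tip]
      · refine Set.eq_empty_iff_forall_notMem.2 ?_
        rintro k (⟨h, h', -⟩ | ⟨h, h', h'' | ⟨j, hj, hj', hj''⟩⟩)
        · omega
        · omega
        · exact hex ⟨j, by omega, by omega, hj''⟩
      · intro y hy
        obtain ⟨i, hi1, hi2, ⟨rfl, -⟩ | ⟨rfl, -⟩⟩ := G.glued_gluing.1 hy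
        · dsimp only at hx1
          omega
        · rw [tip_entry] at hx2
          cases hx2
      · intro h hh
        rw [sel_iff_of_ne hf (by rw [hx1]; exact hdT) hx2, hh, hx3, hout.2 (by omega),
          forcedState, if_neg (by omega)]
  · rw [if_neg (by omega), if_neg (by omega), if_pos ⟨hs, hd⟩]
    by_cases hex : ∃ j, 1 ≤ j ∧ j < o.s - 1 ∧ G.innerSign f j = G.innerSign f (o.s - 1)
    · left
      ext x
      constructor
      · rintro (⟨i, hi, hi', hi''⟩ | ⟨hno, -⟩)
        · exact Or.inl ⟨hi', by have := hi.1.2.1; omega,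
            Or.inr ⟨i, hi'', by have := hi.1.2.1; omega, hi.1.2.2⟩⟩
        · obtain ⟨j, hj, hj', hj''⟩ := hex
          exact absurd hj'' (hno j hj hj')
      · rintro (⟨h, h', h'' | ⟨j, hj, hj', hj''⟩⟩ | ⟨h, h', -⟩)
        · omega
        · have hmem : j ∈ {j | 1 ≤ j ∧ j < o.s - 1 ∧ G.innerSign f j = G.innerSign f (o.s - 1)} :=
            ⟨by omega, by omega, hj''⟩
          have hbdd : BddAbove {j | 1 ≤ j ∧ j < o.s - 1 ∧
              G.innerSign f j = G.innerSign f (o.s - 1)} := ⟨o.s, fun k hk => by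
            have := hk.2.1
            omega⟩
          exact Or.inl ⟨sSup _, ⟨Nat.sSup_mem ⟨j, hmem⟩ hbdd, fun k hk => le_csSup hbdd hk⟩, h,
            hj.trans (le_csSup hbdd hmem)⟩
        · omega
    · right
      have hdT : 1 ∈ G.tiles := ⟨le_rfl, G.one_le_d⟩
      have htm := sign_tipMate hf (x := (1, .south)) hdT
      have hx : ∃ x : TileSide, x.1 = 1 ∧ x.2.tip = .sw ∧
          f (edge G.gluing x) = G.innerSign f (o.s - 1) := by
        by_cases h : f (edge G.gluing (1, .south)) = G.innerSign f (o.s - 1)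
        · exact ⟨(1, .south), rfl, rfl, h⟩
        · refine ⟨tipMate (1, .south), rfl, rfl, ?_⟩
          rw [htm, Int.units_ne_iff_eq_neg.1 h, neg_neg]
      obtain ⟨x, hx1, hx2, hx3⟩ := hx
      refine ⟨x, ?_, ?_, by rw [hx1]; exact hdT, by rw [o.mem_tiles6 hband]; omega, ?_, ?_⟩
      · ext y
        constructor
        · rintro (⟨i, hi, -⟩ | ⟨-, hy1, hy2, hy3⟩)
          · exact absurd ⟨i, hi.1⟩ hex
          · have htip : tipCorner y = tipCorner x := by
              have : y.2.tip = .sw := by rcases hy2 with h | h <;> rw [h] <;> rfl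
              simp [tipCorner, hx1, hy1, this, hx2]
            rcases tipCorner_eq_iff.1 htip with rfl | rfl
            · rfl
            · rw [sign_tipMate hf (by rw [hx1]; exact hdT), hx3] at hy3
              exact absurd hy3.symm (units_ne_neg_self _)
        · rintro rfl
          refine Or.inr ⟨fun j hj hj' hj'' => hex ⟨j, hj, hj', hj''⟩, hx1, ?_, hx3⟩
          revert hx2
          cases y.2 <;> simp [Side.tip]
      · refine Set.eq_empty_iff_forall_notMem.2 ?_
        rintro k (⟨h, h', h'' | ⟨j, hj, hj', hj''⟩⟩ | ⟨h, h', -⟩)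
        · omega
        · exact hex ⟨j, by omega, by omega, hj''⟩
        · omega
      · intro y hy
        obtain ⟨i, hi1, hi2, ⟨rfl, -⟩ | ⟨rfl, -⟩⟩ := G.glued_gluing.1 hy
        · rw [tip_exit] at hx2
          cases hx2
        · dsimp only at hx1
          omega
      · intro h hh
        rw [sel_iff_of_sw hf (by rw [hx1]; exact hdT) hx2, hh, hx3, hout.1 (by omega),
          forcedState, if_pos (by omega)]
  · rw [if_pos ⟨hs, hd⟩]
    left
    ext x
    constructor
    · rintro (⟨h, h'⟩ | ⟨h, h'⟩)
      · exact Or.inl ⟨h, by omega, Or.inl (by omega)⟩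
      · exact Or.inr ⟨by omega, h', Or.inl (by omega)⟩
    · rintro (⟨h, h', -⟩ | ⟨h, h', -⟩)
      · exact Or.inl ⟨h, by omega⟩
      · exact Or.inr ⟨by omega, h'⟩

end tiles

end OppositeOverlap

end SnakeGraph

theorem matchingOf_congr {Γ : Gluing} {F : Set TileSide} {h h' : ℕ → Bool}
    (e : ∀ x ∈ F, h x.1 = h' x.1) : matchingOf Γ F h = matchingOf Γ F h' := by
  ext _
  refine and_congr_right fun _ => forall_congr' fun x => forall_congr' fun hx => ?_
  rw [sel_congr (e x hx)]

theorem valid_congr {Γ : Gluing} {F : Set TileSide} {h h' : ℕ → Bool}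
    (e : ∀ x ∈ F, h x.1 = h' x.1) (hv : Valid Γ F h) : Valid Γ F h' := by
  intro x hx y hy hxy
  rw [← sel_congr (e x hx), ← sel_congr (e y hy)]
  exact hv x hx y hy hxy

theorem Arcs.not_glued {Γ : Gluing} {inn out : ℕ → Side} {R : ℕ → ℕ → Prop}
    (A : Arcs Γ inn out R) {x : TileSide} (h1 : x.2 ≠ inn x.1) (h2 : x.2 ≠ out x.1)
    (y : TileSide) : ¬ Glued Γ x y := by
  rw [A.glued_iff]
  rintro ⟨j, k, -, ⟨rfl, -⟩ | ⟨rfl, -⟩⟩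
  · exact h2 rfl
  · exact h1 rfl

namespace SnakeGraph

variable {G : SnakeGraph}

theorem exitBdry_ne_entry (i : ℕ) : G.exitBdry i ≠ G.entry i := fun h => by
  have := congrArg Side.tip h
  rw [tip_exitBdry, tip_entry] at this
  cases this

theorem entryBdry_ne_exit (i : ℕ) : G.entryBdry i ≠ G.exit i := fun h => by
  have := congrArg Side.tip h
  rw [tip_entryBdry, tip_exit] at this
  cases this

theorem entry_ne_exitBdry (i : ℕ) : G.entry i ≠ G.exitBdry i := (exitBdry_ne_entry i).symm

theorem entry_ne_exit (i : ℕ) : G.entry i ≠ G.exit i := fun h => by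
  have := congrArg Side.tip h
  rw [tip_entry, tip_exit] at this
  cases this

theorem entryBdry_ne_exitBdry (i : ℕ) : G.entryBdry i ≠ G.exitBdry i := fun h => by
  have := congrArg Side.tip h
  rw [tip_entryBdry, tip_exitBdry] at this
  cases this

theorem exitBdry_ne_exit (i : ℕ) : G.exitBdry i ≠ G.exit i := by
  unfold exit exitBdry
  split_ifs <;> simp

theorem entryBdry_ne_entry (i : ℕ) : G.entryBdry i ≠ G.entry i := by
  unfold entry entryBdry
  split_ifs <;> simp

namespace OppositeOverlap

/-! ### Restrictions of a matching -/

theorem restrict_matchingOf {Γ : Gluing} {F : Set TileSide} {h : ℕ → Bool}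
    (hF : F ⊆ sidesOf G.tiles)
    (H : ∀ x ∈ F, ∀ y, Glued G.gluing x y → (y ∈ F ∧ Glued Γ x y) ∨ Sel h y) :
    restrict Γ F (matchingOf G.gluing (sidesOf G.tiles) h) = matchingOf Γ F h := by
  ext e
  refine and_congr_right fun _ => ⟨fun hr x hx hxe => ?_, fun hr x hx hxe => ?_⟩
  · exact ((G.tame.mem_matchingOf (hF hx)).1 (hr x hx hxe)).1
  · refine (G.tame.mem_matchingOf (hF hx)).2 ⟨hr x hx hxe, fun y _ hxy => ?_⟩
    rcases H x hx y hxy with ⟨hy, hxy'⟩ | hs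
    · exact hr y hy ((edge_eq_of_glued hxy').symm.trans hxe)
    · exact hs

/-- A side that is not glued in the restricted graph belongs to the restriction of a
matching if and only if it belongs to the matching. -/
theorem sel_iff_of_restrict_eq {Γ : Gluing} (hΓ : Tame Γ) {T : Set ℕ} (hT : T ⊆ G.tiles)
    {h h' : ℕ → Bool}
    (hr : restrict Γ (sidesOf T) (matchingOf G.gluing (sidesOf G.tiles) h') =
      matchingOf Γ (sidesOf T) h) {x : TileSide} (hx : x.1 ∈ T) (hxg : ∀ y, ¬ Glued Γ x y) :
    Sel h x ↔ Sel h' x ∧ ∀ y, Glued G.gluing x y → Sel h' y := by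
  have h1 : edge Γ x ∈ matchingOf Γ (sidesOf T) h ↔ Sel h x := by
    rw [hΓ.mem_matchingOf (F := sidesOf T) hx]
    exact and_iff_left fun y _ hy => absurd hy (hxg y)
  have h2 : edge G.gluing x ∈ matchingOf G.gluing (sidesOf G.tiles) h' ↔
      Sel h' x ∧ ∀ y, Glued G.gluing x y → Sel h' y := by
    rw [G.tame.mem_matchingOf (F := sidesOf G.tiles) (hT hx)]
    refine and_congr_right fun _ => ⟨fun H y hxy => H y ?_ hxy, fun H y _ => H y⟩
    obtain ⟨i, hi1, hi2, ⟨-, rfl⟩ | ⟨-, rfl⟩⟩ := G.glued_gluing.1 hxy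
    · exact ⟨Nat.succ_pos _, hi2⟩
    · exact ⟨hi1, hi2.le⟩
  rw [← h1, ← h2, ← hr]
  constructor
  · exact fun H => H.2 x hx rfl
  · refine fun H => ⟨⟨x, hx, rfl⟩, fun y _ e => ?_⟩
    rcases hΓ.edge_eq_iff.1 e with rfl | e
    · exact H
    · exact absurd e.symm (hxg y)

/-! ### Pairs of matchings and their completions -/

variable {f : Edge G.gluing → ℤˣ} {o : G.OppositeOverlap}

/-- The choices of matchings of the tiles that describe the matchings without a switching position,
or equivalently the pairs of matchings of `G₅` and of the band graph. -/
structure IsSplit (o : G.OppositeOverlap) (f : Edge G.gluing → ℤˣ) (h : ℕ → Bool) : Prop where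
  forced : o.IsForced f h
  valid5 : Valid o.gluing5 (o.sides5 f) h
  valid6 : Valid o.gluing6 (sidesOf o.tiles6) h

section split

variable (hf : G.IsSignFunction f) (hcross : o.SelfCrosses f) (hband : o.t + 1 < o.s')

theorem notMem_tiles6_of_glued (hband : o.t + 1 < o.s') {x y : TileSide}
    (hxy : Glued G.gluing x y) (hx : x.1 ∈ o.tiles5 f) : y.1 ∉ o.tiles6 := by
  have h1 := o.s_le_t; have h2 := o.s'_le_t'
  have hx' := (o.tiles5_subset hx).2
  rw [o.mem_tiles6 hband]
  obtain ⟨i, -, -, ⟨rfl, rfl⟩ | ⟨rfl, rfl⟩⟩ := G.glued_gluing.1 hxy <;>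
  · dsimp only at hx' ⊢
    omega

theorem notMem_tiles6_of_mem_tiles5 (hband : o.t + 1 < o.s') {k : ℕ} (hk : k ∈ o.tiles5 f) :
    k ∉ o.tiles6 := by
  have h1 := o.s_le_t; have h2 := o.s'_le_t'
  have hx' := (o.tiles5_subset hk).2
  rw [o.mem_tiles6 hband]
  omega

/-- The tiles of the overlaps belong neither to `G₅` nor to the band graph. -/
theorem notMem_of_overlap (hband : o.t + 1 < o.s') {k : ℕ}
    (hk : (o.s ≤ k ∧ k ≤ o.t) ∨ (o.s' ≤ k ∧ k ≤ o.t')) :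
    k ∈ G.tiles ∧ k ∉ o.tiles5 f ∧ k ∉ o.tiles6 := by
  have h0 := o.one_le_s; have h1 := o.s_le_t; have h2 := o.s'_le_t'; have h3 := o.t'_le_d
  refine ⟨⟨by omega, by omega⟩, fun hk' => ?_, ?_⟩
  · have := (o.tiles5_subset hk').2
    omega
  · rw [o.mem_tiles6 hband]
    omega

include hf hcross hband

theorem sidesOf_tiles5_subset : sidesOf (o.tiles5 f) ⊆ o.sides5 f := by
  rcases o.sides5_cases hf hcross hband with e | ⟨x, -, e, -⟩
  · rw [e]
  · rw [e]
    exact fun y hy => absurd hy (Set.notMem_empty _)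

theorem sides5_subset : o.sides5 f ⊆ sidesOf G.tiles := by
  rcases o.sides5_cases hf hcross hband with e | ⟨x, e, -, hx, -⟩
  · rw [e]
    exact fun y hy => (o.tiles5_subset hy).1
  · rw [e]
    rintro _ rfl
    exact hx

namespace IsSplit

variable {h : ℕ → Bool} (hs : o.IsSplit f h)
include hs

omit hf hcross in
theorem state_low {k : ℕ} (h1 : o.s ≤ k) (h2 : k ≤ o.t) : state f h k = -G.innerSign f o.t := by
  obtain ⟨hk, hk5, hk6⟩ := o.notMem_of_overlap (f := f) hband (k := k) (Or.inl ⟨h1, h2⟩)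
  rw [hs.forced k hk hk5 hk6, forcedState, if_pos h2]

omit hf hcross in
theorem state_high {k : ℕ} (h1 : o.s' ≤ k) (h2 : k ≤ o.t') : state f h k = G.innerSign f o.t := by
  obtain ⟨hk, hk5, hk6⟩ := o.notMem_of_overlap (f := f) hband (k := k) (Or.inr ⟨h1, h2⟩)
  rw [hs.forced k hk hk5 hk6, forcedState, if_neg (by omega)]

omit hf hcross in
theorem state_eq {i : ℕ} (h1 : 1 ≤ i) (h2 : i < G.d) (hi : i ∉ o.tiles5 f ∪ o.tiles6)
    (hi' : i + 1 ∉ o.tiles5 f ∪ o.tiles6) : state f h i = state f h (i + 1) := by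
  rw [Set.mem_union, not_or] at hi hi'
  rw [hs.forced i ⟨h1, h2.le⟩ hi.1 hi.2, hs.forced (i + 1) ⟨Nat.succ_pos _, h2⟩ hi'.1 hi'.2]
  exact o.forcedState_succ hband hi'.2

theorem valid : Valid G.gluing (sidesOf G.tiles) h := by
  suffices H : ∀ x y, Glued G.gluing x y → x.1 ∈ o.tiles5 f ∪ o.tiles6 → Sel h x ∨ Sel h y by
    intro x _ y _ hxy
    by_cases hx : x.1 ∈ o.tiles5 f ∪ o.tiles6
    · exact H x y hxy hx
    by_cases hy : y.1 ∈ o.tiles5 f ∪ o.tiles6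
    · exact (H y x hxy.symm hy).symm
    have key : ∀ i, 1 ≤ i → i < G.d → i ∉ o.tiles5 f ∪ o.tiles6 →
        i + 1 ∉ o.tiles5 f ∪ o.tiles6 →
        Sel h (i, G.exit i) ∨ Sel h (i + 1, G.entry (i + 1)) := by
      intro i h1 h2 hi hi'
      rw [sel_entry_iff_of_state_eq hf h1 h2 (hs.state_eq hband h1 h2 hi hi')]
      exact em _
    obtain ⟨i, h1, h2, ⟨rfl, rfl⟩ | ⟨rfl, rfl⟩⟩ := G.glued_gluing.1 hxy
    · exact key i h1 h2 hx hy
    · exact (key i h1 h2 hy hx).symm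
  intro x y hxy hx
  by_cases hy : y.1 ∈ o.tiles5 f ∪ o.tiles6
  · rcases hx with hx | hx
    · have hy5 : y.1 ∈ o.tiles5 f := hy.resolve_right (o.notMem_tiles6_of_glued hband hxy hx)
      have hsub := sidesOf_tiles5_subset hf hcross hband
      exact hs.valid5 x (hsub hx) y (hsub hy5) (o.glued5_of_glued hxy hx hy5)
    · have hy6 : y.1 ∈ o.tiles6 := hy.resolve_left fun hy5 =>
        o.notMem_tiles6_of_glued hband hxy.symm hy5 hx
      exact hs.valid6 x hx y hy6 (o.glued6_of_glued hband hxy hx hy6)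
  · exact Or.inr (o.sel_of_isForced hf hcross hband hs.forced hxy hx hy)

theorem restrict5_eq : o.restrict5 f (matchingOf G.gluing (sidesOf G.tiles) h) =
    matchingOf o.gluing5 (o.sides5 f) h := by
  refine restrict_matchingOf (sides5_subset hf hcross hband) fun x hx y hxy => ?_
  rcases o.sides5_cases hf hcross hband with e | ⟨z, e, -, -, -, hz, -⟩
  · rw [e] at hx ⊢
    by_cases hy : y.1 ∈ o.tiles5 f
    · exact Or.inl ⟨hy, o.glued5_of_glued hxy hx hy⟩
    · refine Or.inr (o.sel_of_isForced hf hcross hband hs.forced hxy (Or.inl hx) ?_)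
      exact fun h' => h'.elim hy (o.notMem_tiles6_of_glued hband hxy hx)
  · rw [e] at hx
    obtain rfl : x = z := hx
    exact absurd hxy (hz y)

theorem restrict6_eq : o.restrict6 (matchingOf G.gluing (sidesOf G.tiles) h) =
    matchingOf o.gluing6 (sidesOf o.tiles6) h := by
  refine restrict_matchingOf (fun x hx => o.tiles6_subset hband hx) fun x hx y hxy => ?_
  by_cases hy : y.1 ∈ o.tiles6
  · exact Or.inl ⟨hy, o.glued6_of_glued hband hxy hx hy⟩
  · refine Or.inr (o.sel_of_isForced hf hcross hband hs.forced hxy (Or.inr hx) ?_)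
    exact fun h' => h'.elim (fun hy5 => o.notMem_tiles6_of_glued hband hxy.symm hy5 hx) hy

theorem isCompletion : o.IsCompletion f (matchingOf o.gluing5 (o.sides5 f) h)
    (matchingOf o.gluing6 (sidesOf o.tiles6) h) (matchingOf G.gluing (sidesOf G.tiles) h) := by
  refine ⟨G.mem_Match.2 ⟨h, hs.valid hf hcross hband, rfl⟩, hs.restrict5_eq hf hcross hband,
    hs.restrict6_eq hf hcross hband, ?_⟩
  rintro e he hne i h1 h2 rfl
  have hg := G.glued_inner h1 h2
  have hsub := sidesOf_tiles5_subset hf hcross hband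
  have hi : i ∉ o.tiles5 f ∪ o.tiles6 := fun h' =>
    hne (i, G.exit i) (h'.imp (fun h' => hsub h') id) rfl
  have hi' : i + 1 ∉ o.tiles5 f ∪ o.tiles6 := fun h' =>
    hne (i + 1, G.entry (i + 1)) (h'.imp (fun h' => hsub h') id) (edge_eq_of_glued hg).symm
  have := ((o.strands hband).mem_of_glued hg).1 he
  exact (sel_entry_iff_of_state_eq hf h1 h2
    (hs.state_eq hband h1 h2 hi hi')).1 this.2 this.1

theorem not_goodPos (hne : ¬ (o.s = 1 ∧ o.t' = G.d)) (p : ℕ) : ¬ o.GoodPos o.middle h p := by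
  have h0 := o.one_le_s; have h1 := o.s_le_t; have h2 := o.s'_le_t'; have h3 := o.t'_le_d
  have h4 := o.s_add_t'
  have hout := o.innerSign_outer hf hcross hband
  have hsub := sidesOf_tiles5_subset hf hcross hband
  rintro (⟨-, ho⟩ | ⟨k, hk1, hk2, ha, -⟩ | ⟨-, hm⟩)
  · by_cases hs1 : 1 < o.s
    · have e0 := (o.sel_outer_false hf hcross hband hs1).1 (ho false hs1)
      by_cases hd : o.t' < G.d
      · have e1 := (o.sel_outer_true hf hcross hband hd).1 (ho true hd)
        have m0 : o.s - 1 ∈ o.tiles5 f :=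
          o.mem_tiles5_of_both hs1 hd ⟨by omega, by omega⟩ (by omega)
        have m1 : o.t' + 1 ∈ o.tiles5 f :=
          o.mem_tiles5_of_both hs1 hd ⟨by omega, by omega⟩ (by omega)
        have v := hs.valid5 (o.s - 1, G.exitBdry (o.s - 1)) (hsub m0)
          (o.t' + 1, G.entryBdry (o.t' + 1)) (hsub m1) (Or.inl (Or.inr ⟨hs1, hd, rfl⟩))
        rw [← tipMate_exit, ← tipMate_entry, sel_tipMate, sel_tipMate] at v
        exact v.elim (fun v => v (ho false hs1)) fun v => v (ho true hd)
      · have m0 : o.s - 1 ∉ o.tiles5 f := by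
          rintro (⟨-, -, h' | ⟨j, hj, hj', -⟩⟩ | ⟨h', -⟩) <;> omega
        have m6 : o.s - 1 ∉ o.tiles6 := by
          rw [o.mem_tiles6 hband]
          omega
        rw [hs.forced _ ⟨by omega, by omega⟩ m0 m6, forcedState, if_pos (by omega)] at e0
        exact units_ne_neg_self _ e0.symm
    · by_cases hd : o.t' < G.d
      · have e1 := (o.sel_outer_true hf hcross hband hd).1 (ho true hd)
        have m0 : o.t' + 1 ∉ o.tiles5 f := by
          rintro (⟨-, h', -⟩ | ⟨-, -, h' | ⟨j, hj, hj', -⟩⟩) <;> omega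
        have m6 : o.t' + 1 ∉ o.tiles6 := by
          rw [o.mem_tiles6 hband]
          omega
        rw [hs.forced _ ⟨by omega, by omega⟩ m0 m6, forcedState, if_neg (by omega)] at e1
        exact units_ne_neg_self _ e1
      · omega
  · rw [o.agree_iff_state hf hcross hband hk1 hk2, hs.state_low hband hk1 hk2,
      hs.state_high hband (by omega) (by omega)] at ha
    exact units_ne_neg_self _ ha.symm
  · have v := hs.valid6 (o.s' - 1, G.exitBdry (o.s' - 1))
      ((o.mem_tiles6 hband).2 ⟨by dsimp only; omega, by dsimp only; omega⟩)
      (o.t + 1, G.entryBdry (o.t + 1))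
      ((o.mem_tiles6 hband).2 ⟨by dsimp only; omega, by dsimp only; omega⟩)
      (Or.inl (Or.inr rfl))
    rw [← tipMate_exit, ← tipMate_entry, sel_tipMate, sel_tipMate] at v
    exact v.elim (fun v => v (hm true)) fun v => v (hm false)

end IsSplit

end split

end OppositeOverlap

end SnakeGraph

namespace SnakeGraph

namespace OppositeOverlap

variable {G : SnakeGraph} {f : Edge G.gluing → ℤˣ} {o : G.OppositeOverlap}
variable (hf : G.IsSignFunction f) (hcross : o.SelfCrosses f) (hband : o.t + 1 < o.s')
include hf hcross hband

/-- Along the overlaps, the absence of a switching position forces the signs. These propagate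
outwards up to the first edge of the sign at which `G₅` begins. -/
theorem isSplit_of_forall_not_goodPos {h : ℕ → Bool} (hv : Valid G.gluing (sidesOf G.tiles) h)
    (hno : ∀ p, ¬ o.GoodPos o.middle h p) : o.IsSplit f h := by
  have h0 := o.one_le_s; have h1 := o.s_le_t; have h2 := o.s'_le_t'; have h3 := o.t'_le_d
  have hout := o.innerSign_outer hf hcross hband
  obtain ⟨hlow, hhigh⟩ := o.state_of_forall_not_goodPos hf hcross hband hv hno
  have houter : ∃ c, o.HasOuter c ∧ ¬ Sel h (o.outer c) := by
    by_contra! hall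
    exact hno (2 * o.s - 2) (Or.inl ⟨rfl, hall⟩)
  have hmid : ∃ c, ¬ Sel h (o.middle c) := by
    by_contra! hall
    exact hno (2 * o.t) (Or.inr (Or.inr ⟨rfl, hall⟩))
  have hstep : ∀ i, 1 ≤ i → i < G.d →
      G.innerSign f i = -state f h i ∨ G.innerSign f i = state f h (i + 1) := by
    intro i hi hi'
    rw [← sel_exit_iff hf hi hi', ← sel_entry_iff hf hi hi']
    exact hv (i, G.exit i) ⟨hi, hi'.le⟩ (i + 1, G.entry (i + 1)) ⟨Nat.succ_pos _, hi'⟩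
      (G.glued_inner hi hi')
  refine ⟨fun k hk hk5 hk6 => ?_, fun x hx y hy hxy => ?_, fun x hx y hy hxy => ?_⟩
  · rw [o.mem_tiles6 hband] at hk6
    have hkT := hk
    obtain ⟨hk1, hkd⟩ := hkT
    unfold forcedState
    by_cases hkt : k ≤ o.t
    · rw [if_pos hkt]
      by_cases hks : o.s ≤ k
      · exact hlow k hks hkt
      -- The tile lies before the first copy of the overlap, and nothing lies after the second.
      have hd : ¬ o.t' < G.d := fun hd => hk5 (Or.inl ⟨hk1, by omega, Or.inl hd⟩)
      have hs : 1 < o.s := by omega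
      have hlast : state f h (o.s - 1) = -G.innerSign f o.t := by
        obtain ⟨_ | _, hc, hsel⟩ := houter
        · rw [o.sel_outer_false hf hcross hband hs] at hsel
          exact Int.units_ne_iff_eq_neg.1 hsel
        · exact absurd hc hd
      have hne : ∀ j, k ≤ j → j + 1 < o.s → G.innerSign f j = G.innerSign f o.t := by
        intro j hj hj'
        by_contra hne
        refine hk5 (Or.inl ⟨hk1, by omega, Or.inr ⟨j, hj, hj', ?_⟩⟩)
        rw [hout.1 hs]
        exact Int.units_ne_iff_eq_neg.1 hne
      suffices H : ∀ n j, j + n = o.s - 1 → k ≤ j → state f h j = -G.innerSign f o.t from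
        H (o.s - 1 - k) k (by omega) le_rfl
      intro n
      induction n with
      | zero =>
        rintro j hj -
        obtain rfl : j = o.s - 1 := by omega
        exact hlast
      | succ n ih =>
        intro j hj hkj
        have e := ih (j + 1) (by omega) (by omega)
        rcases hstep j (by omega) (by omega) with e' | e' <;>
          rw [hne j hkj (by omega)] at e'
        · rw [e', neg_neg]
        · rw [e] at e'
          exact absurd e' (units_ne_neg_self _)
    · rw [if_neg hkt]
      by_cases hks : k ≤ o.t'
      · exact hhigh k (by omega) hks
      -- The tile lies after the second copy of the overlap, and nothing lies before the first.
      have hs : ¬ 1 < o.s := fun hs => hk5 (Or.inr ⟨by omega, hkd, Or.inl hs⟩)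
      have hd : o.t' < G.d := by omega
      have hfirst : state f h (o.t' + 1) = G.innerSign f o.t := by
        obtain ⟨_ | _, hc, hsel⟩ := houter
        · exact absurd hc hs
        · rw [o.sel_outer_true hf hcross hband hd, ← Ne, Int.units_ne_iff_eq_neg, neg_neg] at hsel
          exact hsel
      have hne : ∀ j, o.t' < j → j < k → G.innerSign f j = G.innerSign f o.t := by
        intro j hj hj'
        by_contra hne
        refine hk5 (Or.inr ⟨by omega, hkd, Or.inr ⟨j, hj, hj', ?_⟩⟩)
        rw [hout.2 hd]
        exact Int.units_ne_iff_eq_neg.1 hne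
      suffices H : ∀ n j, j = o.t' + 1 + n → j ≤ k → state f h j = G.innerSign f o.t from
        H (k - (o.t' + 1)) k (by omega) le_rfl
      intro n
      induction n with
      | zero =>
        rintro j rfl -
        exact hfirst
      | succ n ih =>
        rintro j rfl hkj
        have e := ih (o.t' + 1 + n) rfl (by omega)
        rcases hstep (o.t' + 1 + n) (by omega) (by omega) with e' | e' <;>
          rw [hne _ (by omega) (by omega)] at e'
        · rw [e] at e'
          exact absurd e' (units_ne_neg_self _)
        · exact e'.symm
  · have hsub := sides5_subset hf hcross hband
    rcases o.glued5_cases hxy with hg | ⟨hs, hd, hg⟩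
    · exact hv x (hsub hx) y (hsub hy) hg
    · have key : Sel h (o.s - 1, G.exitBdry (o.s - 1)) ∨
          Sel h (o.t' + 1, G.entryBdry (o.t' + 1)) := by
        rw [← tipMate_exit, ← tipMate_entry, sel_tipMate, sel_tipMate]
        obtain ⟨_ | _, -, hsel⟩ := houter
        · exact Or.inl hsel
        · exact Or.inr hsel
      rcases hg with ⟨rfl, rfl⟩ | ⟨rfl, rfl⟩
      · exact key
      · exact key.symm
  · rcases o.glued6_cases hxy with hg | hg
    · exact hv x (o.tiles6_subset hband hx) y (o.tiles6_subset hband hy) hg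
    · have key : Sel h (o.s' - 1, G.exitBdry (o.s' - 1)) ∨
          Sel h (o.t + 1, G.entryBdry (o.t + 1)) := by
        rw [← tipMate_exit, ← tipMate_entry, sel_tipMate, sel_tipMate]
        obtain ⟨_ | _, hsel⟩ := hmid
        · exact Or.inr hsel
        · exact Or.inl hsel
      rcases hg with ⟨rfl, rfl⟩ | ⟨rfl, rfl⟩
      · exact key
      · exact key.symm

omit hf hcross hband in
theorem not_both_ends {h : ℕ → Bool} (hno : ∀ p, ¬ o.GoodPos o.middle h p) :
    ¬ (o.s = 1 ∧ o.t' = G.d) := by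
  rintro ⟨hs, hd⟩
  refine hno (2 * o.s - 2) (Or.inl ⟨rfl, ?_⟩)
  rintro (_ | _) hc
  · exact absurd (show 1 < o.s from hc) (by omega)
  · exact absurd (show o.t' < G.d from hc) (by omega)

theorem mem_Match5 {P : Set (Edge o.gluing5)} : P ∈ o.Match5 f ↔ ¬ (o.s = 1 ∧ o.t' = G.d) ∧
    ∃ h, o.IsForced f h ∧ Valid o.gluing5 (o.sides5 f) h ∧
      P = matchingOf o.gluing5 (o.sides5 f) h := by
  refine and_congr_right fun hne => ?_
  have h1 := o.s_le_t; have h2 := o.s'_le_t'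
  unfold graph5
  rcases o.sides5_cases hf hcross hband with e | ⟨x, e, e5, hxT, hx6, hx, hsel⟩
  · rw [e]
    have key := o.arcs5.isPerfectMatching_iff id (fun j k h => by
      unfold Next5 at h
      simp only [id]
      have := o.lt
      omega) (T := o.tiles5 f) (P := P) (by
        rintro i j k hij hjk (⟨hi, hi', hi''⟩ | ⟨hi, hi', hi''⟩) hk
        · by_cases hd : o.t' < G.d
          · by_cases hs : 1 < o.s
            · refine o.mem_tiles5_of_both hs hd ⟨?_, ?_⟩ ?_ <;>
              · unfold Next5 at hij hjk
                omega
            · omega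
          · rcases hk with ⟨hk, hk', hk'' | ⟨l, hl, hl', hl''⟩⟩ | ⟨hk, hk', -⟩
            · exact absurd hk'' hd
            · unfold Next5 at hij hjk
              exact Or.inl ⟨by omega, by omega, Or.inr ⟨l, by omega, hl', hl''⟩⟩
            · omega
        · unfold Next5 at hij hjk
          refine Or.inr ⟨by omega, by omega, hi''.imp id ?_⟩
          rintro ⟨l, hl, hl', hl''⟩
          exact ⟨l, hl, by omega, hl''⟩)
    rw [show (IsPerfectMatching (sideGraph o.gluing5 (sidesOf (o.tiles5 f))) P ↔ _) from key]
    constructor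
    · rintro ⟨h, hv, rfl⟩
      classical
      have hcongr : ∀ x ∈ sidesOf (o.tiles5 f), h x.1 =
          (if x.1 ∈ o.tiles5 f then h x.1 else ofState f (o.forcedState f) x.1) := fun x hx =>
        (if_pos hx).symm
      refine ⟨fun k => if k ∈ o.tiles5 f then h k else ofState f (o.forcedState f) k, ?_,
        valid_congr hcongr hv, matchingOf_congr hcongr⟩
      intro k hk hk5 hk6
      rw [← state_ofState f (o.forcedState f) k]
      exact state_congr f (if_neg hk5)
    · rintro ⟨h, -, hv, rfl⟩
      exact ⟨h, hv, rfl⟩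
  · rw [e, isPerfectMatching_singleton]
    have key : ∀ h, o.IsForced f h → matchingOf o.gluing5 {x} h = {edge o.gluing5 x} := by
      intro h hh
      have hs := hsel h (hh x.1 hxT (by rw [e5]; exact Set.notMem_empty _) hx6)
      ext e
      constructor
      · rintro ⟨⟨_, rfl, rfl⟩, -⟩
        rfl
      · rintro rfl
        refine ⟨⟨x, rfl, rfl⟩, ?_⟩
        rintro _ rfl -
        exact hs
    constructor
    · rintro rfl
      have hforced : o.IsForced f (ofState f (o.forcedState f)) := fun k _ _ _ =>
        state_ofState f _ k
      refine ⟨_, hforced, ?_, (key _ hforced).symm⟩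
      rintro _ rfl _ rfl hg
      exact absurd hg (o.arcs5.tame.irrefl _)
    · rintro ⟨h, hh, -, rfl⟩
      exact key h hh

theorem IsSplit.mem_Match {h : ℕ → Bool} (hs : o.IsSplit f h) (hne : ¬ (o.s = 1 ∧ o.t' = G.d)) :
    matchingOf o.gluing5 (o.sides5 f) h ∈ o.Match5 f ∧
      matchingOf o.gluing6 (sidesOf o.tiles6) h ∈ o.Match6 :=
  ⟨(mem_Match5 hf hcross hband).2 ⟨hne, h, hs.forced, hs.valid5, rfl⟩,
    (o.mem_Match6 hband).2 ⟨h, hs.valid6, rfl⟩⟩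

theorem exists_isSplit {P₅ : Set (Edge o.gluing5)} {P₆ : Set (Edge o.gluing6)}
    (h5 : P₅ ∈ o.Match5 f) (h6 : P₆ ∈ o.Match6) : ∃ h, o.IsSplit f h ∧
      P₅ = matchingOf o.gluing5 (o.sides5 f) h ∧
      P₆ = matchingOf o.gluing6 (sidesOf o.tiles6) h := by
  obtain ⟨-, h, hh, hv, rfl⟩ := (mem_Match5 hf hcross hband).1 h5
  obtain ⟨h', hv', rfl⟩ := (o.mem_Match6 hband).1 h6
  classical
  have e5 : ∀ x ∈ o.sides5 f, h x.1 = if x.1 ∈ o.tiles6 then h' x.1 else h x.1 := by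
    intro x hx
    rw [if_neg]
    rcases o.sides5_cases hf hcross hband with e | ⟨z, e, -, -, hz, -⟩
    · rw [e] at hx
      exact o.notMem_tiles6_of_mem_tiles5 hband hx
    · rw [e] at hx
      obtain rfl : x = z := hx
      exact hz
  have e6 : ∀ x ∈ sidesOf o.tiles6, h' x.1 = if x.1 ∈ o.tiles6 then h' x.1 else h x.1 :=
    fun x hx => (if_pos hx).symm
  refine ⟨fun k => if k ∈ o.tiles6 then h' k else h k, ⟨fun k hk hk5 hk6 => ?_,
    valid_congr e5 hv, valid_congr e6 hv'⟩, matchingOf_congr e5, matchingOf_congr e6⟩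
  rw [← hh k hk hk5 hk6]
  exact state_congr f (if_neg hk6)

/-- A completion is determined: on the tiles of `G₅` and of the band graph by the restrictions, at
the inner ends of the overlaps because the edges there come from two edges of the matching or are
not selected, and from there on because no interior edge may be used. -/
theorem IsSplit.eq_of_isCompletion {h : ℕ → Bool} (hs : o.IsSplit f h) {P : Set (Edge G.gluing)}
    (hP : o.IsCompletion f (matchingOf o.gluing5 (o.sides5 f) h)
      (matchingOf o.gluing6 (sidesOf o.tiles6) h) P) :
    P = matchingOf G.gluing (sidesOf G.tiles) h := by
  have h0 := o.one_le_s; have h1 := o.s_le_t; have h2 := o.s'_le_t'; have h3 := o.t'_le_d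
  have hlt := o.lt
  obtain ⟨hPM, hr5, hr6, hint⟩ := hP
  obtain ⟨h', hv, rfl⟩ := G.mem_Match.1 hPM
  have A6 := o.arcs6 hband
  have hsub6 : o.tiles6 ⊆ G.tiles := fun k hk => o.tiles6_subset hband hk
  have key6 := fun (x : TileSide) (hx : x.1 ∈ o.tiles6) (hxg : ∀ y, ¬ Glued o.gluing6 x y) =>
    sel_iff_of_restrict_eq A6.tame hsub6 hr6 hx hxg
  have heq : ∀ x : TileSide, (Sel h x ↔ Sel h' x ∧ ∀ y, Glued G.gluing x y → Sel h' y) →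
      (∀ y, ¬ Glued G.gluing x y) → h' x.1 = h x.1 := by
    intro x hx hxg
    refine eq_of_sel_iff (x := x) (Iff.trans ?_ hx.symm)
    exact ⟨fun hx' => ⟨hx', fun y hy => absurd hy (hxg y)⟩, fun hx' => hx'.1⟩
  have hentry : o.inn6 (o.t + 1) = G.entryBdry (o.t + 1) := if_pos rfl
  have hexit : o.out6 (o.s' - 1) = G.exitBdry (o.s' - 1) := if_pos (by omega)
  have hm1 : o.t + 1 ∈ o.tiles6 := (o.mem_tiles6 hband).2 (by omega)
  have hm2 : o.s' - 1 ∈ o.tiles6 := (o.mem_tiles6 hband).2 (by omega)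
  have kentry := key6 (o.t + 1, G.entry (o.t + 1)) hm1 (A6.not_glued
    (by rw [hentry]; exact (entryBdry_ne_entry _).symm)
    (by dsimp only; unfold out6; split_ifs; exacts [entry_ne_exitBdry _, entry_ne_exit _]))
  have kexit := key6 (o.s' - 1, G.exit (o.s' - 1)) hm2 (A6.not_glued
    (by dsimp only; unfold inn6; split_ifs; exacts [(entryBdry_ne_exit _).symm,
      (entry_ne_exit _).symm])
    (by rw [hexit]; exact (exitBdry_ne_exit _).symm))
  have heq6 : ∀ k ∈ o.tiles6, h' k = h k := by
    intro k hk
    by_cases hk1 : k = o.t + 1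
    · by_cases hk2 : k = o.s' - 1
      · -- The band graph has a single tile; one of the two sides next to the overlaps is selected.
        subst hk1
        rw [← hk2] at kexit
        have e : G.innerSign f (o.t + 1) = G.innerSign f o.t := by rw [hk2, hcross.2]
        have e1 := sel_exit_iff hf (h := h) (i := o.t + 1) (by omega) (by omega)
        have e2 := sel_entry_iff hf (h := h) (i := o.t) (by omega) (by omega)
        by_cases hc : G.innerSign f o.t = state f h (o.t + 1)
        · have := e2.2 hc
          exact eq_of_sel_iff (x := (o.t + 1, G.entry (o.t + 1)))
            (iff_of_true (kentry.1 this).1 this)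
        · have := e1.2 (by rw [e]; exact Int.units_ne_iff_eq_neg.1 hc)
          exact eq_of_sel_iff (x := (o.t + 1, G.exit (o.t + 1)))
            (iff_of_true (kexit.1 this).1 this)
      · refine heq (k, G.exitBdry k) (key6 (k, G.exitBdry k) hk (A6.not_glued ?_ ?_))
          (G.arcs.not_glued (exitBdry_ne_entry k) (exitBdry_ne_exit k))
        · dsimp only
          unfold inn6
          rw [if_pos hk1]
          exact (entryBdry_ne_exitBdry k).symm
        · dsimp only
          unfold out6
          rw [if_neg (by omega)]
          exact exitBdry_ne_exit k
    · refine heq (k, G.entryBdry k) (key6 (k, G.entryBdry k) hk (A6.not_glued ?_ ?_))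
        (G.arcs.not_glued (entryBdry_ne_entry k) (entryBdry_ne_exit k))
      · dsimp only
        unfold inn6
        rw [if_neg hk1]
        exact entryBdry_ne_entry k
      · dsimp only
        unfold out6
        split_ifs
        · exact entryBdry_ne_exitBdry k
        · exact entryBdry_ne_exit k
  have heq5 : ∀ k ∈ o.tiles5 f, h' k = h k := by
    intro k hk
    have e : o.sides5 f = sidesOf (o.tiles5 f) := by
      rcases o.sides5_cases hf hcross hband with e | ⟨-, -, e, -⟩
      · exact e
      · rw [e] at hk
        exact absurd hk (Set.notMem_empty _)
    unfold restrict5 at hr5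
    rw [e] at hr5
    have key5 := fun (x : TileSide) (hx : x.1 ∈ o.tiles5 f) (hxg : ∀ y, ¬ Glued o.gluing5 x y) =>
      sel_iff_of_restrict_eq o.arcs5.tame (fun k hk => (o.tiles5_subset hk).1) hr5 hx hxg
    rcases (o.tiles5_subset hk).2 with hk' | hk'
    · refine heq (k, G.entryBdry k) (key5 (k, G.entryBdry k) hk (o.arcs5.not_glued ?_ ?_))
        (G.arcs.not_glued (entryBdry_ne_entry k) (entryBdry_ne_exit k))
      · dsimp only
        unfold inn5
        rw [if_neg (by omega)]
        exact entryBdry_ne_entry k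
      · dsimp only
        unfold out5
        split_ifs
        · exact entryBdry_ne_exitBdry k
        · exact entryBdry_ne_exit k
    · refine heq (k, G.exitBdry k) (key5 (k, G.exitBdry k) hk (o.arcs5.not_glued ?_ ?_))
        (G.arcs.not_glued (exitBdry_ne_entry k) (exitBdry_ne_exit k))
      · dsimp only
        unfold inn5
        split_ifs
        · exact (entryBdry_ne_exitBdry k).symm
        · exact exitBdry_ne_entry k
      · dsimp only
        unfold out5
        rw [if_neg (by omega)]
        exact exitBdry_ne_exit k
  have hval : ∀ i, 1 ≤ i → i < G.d → Sel h' (i, G.exit i) ∨ Sel h' (i + 1, G.entry (i + 1)) :=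
    fun i hi hi' => hv (i, G.exit i) ⟨hi, hi'.le⟩ (i + 1, G.entry (i + 1)) ⟨Nat.succ_pos _, hi'⟩
      (G.glued_inner hi hi')
  have ht : state f h' o.t = -G.innerSign f o.t := by
    have hsel : Sel h' (o.t, G.exit o.t) := by
      refine (hval o.t (by omega) (by omega)).elim id fun hsel => ?_
      exact (kentry.1 ((sel_congr (heq6 _ hm1)).1 hsel)).2 _
        (G.glued_inner (by omega) (by omega)).symm
    rw [sel_exit_iff hf (by omega) (by omega)] at hsel
    rw [hsel, neg_neg]
  have hs1 : o.s' - 1 + 1 = o.s' := by omega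
  have hs' : state f h' o.s' = G.innerSign f o.t := by
    have hsel : Sel h' (o.s' - 1 + 1, G.entry (o.s' - 1 + 1)) := by
      refine (hval (o.s' - 1) (by omega) (by omega)).elim (fun hsel => ?_) id
      exact (kexit.1 ((sel_congr (heq6 _ hm2)).1 hsel)).2 _
        (G.glued_inner (by omega) (by omega))
    rw [sel_entry_iff hf (by omega) (by omega), hs1, ← hcross.2] at hsel
    exact hsel.symm
  have hstep : ∀ i, 1 ≤ i → i < G.d → i ∉ o.tiles5 f ∪ o.tiles6 →
      i + 1 ∉ o.tiles5 f ∪ o.tiles6 → state f h' i = state f h' (i + 1) := by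
    intro i hi hi' hn hn'
    have hg := G.glued_inner hi hi'
    have hnot : ¬ (Sel h' (i, G.exit i) ∧ Sel h' (i + 1, G.entry (i + 1))) := by
      rw [← (o.strands hband).mem_of_glued hg]
      refine fun he => hint _ he (fun x hx e => ?_) i hi hi' rfl
      have hx' : x.1 ∈ o.tiles5 f ∪ o.tiles6 ∨ ∀ y, ¬ Glued G.gluing x y := by
        rcases hx with hx | hx
        · rcases o.sides5_cases hf hcross hband with e | ⟨z, e, -, -, -, hz, -⟩
          · rw [e] at hx
            exact Or.inl (Or.inl hx)
          · rw [e] at hx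
            obtain rfl : x = z := hx
            exact Or.inr hz
        · exact Or.inl (Or.inr hx)
      rcases G.tame.edge_eq_iff.1 e with rfl | e
      · exact hx'.elim hn fun hz => hz _ hg
      · obtain rfl := G.tame.unique e.symm hg
        exact hx'.elim hn' fun hz => hz _ hg.symm
    have hor := hval i hi hi'
    rw [sel_exit_iff hf hi hi', sel_entry_iff hf hi hi'] at hnot hor
    revert hnot hor
    generalize G.innerSign f i = a
    generalize state f h' i = b
    generalize state f h' (i + 1) = c
    revert a b c
    decide
  have hlow : ∀ n k, k + n = o.t → 1 ≤ k → k ∉ o.tiles5 f →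
      state f h' k = -G.innerSign f o.t := by
    intro n
    induction n with
    | zero =>
      rintro k rfl - -
      exact ht
    | succ n ih =>
      intro k hk hk1 hk5
      have hk5' : k + 1 ∉ o.tiles5 f := fun hmem => by
        have := ((o.innerSign_of_tiles5 hf hcross hband hk1 (by omega)).2 hk5 hmem).1
        omega
      rw [hstep k hk1 (by omega) (fun hmem => hmem.elim hk5 fun hmem => by
          rw [o.mem_tiles6 hband] at hmem
          omega) (fun hmem => hmem.elim hk5' fun hmem => by
          rw [o.mem_tiles6 hband] at hmem
          omega)]
      exact ih (k + 1) (by omega) (by omega) hk5'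
  have hhigh : ∀ n k, k = o.s' + n → k ≤ G.d → k ∉ o.tiles5 f →
      state f h' k = G.innerSign f o.t := by
    intro n
    induction n with
    | zero =>
      rintro k rfl - -
      exact hs'
    | succ n ih =>
      rintro k rfl hkd hk5
      have hk5' : o.s' + n ∉ o.tiles5 f := fun hmem => by
        have := ((o.innerSign_of_tiles5 hf hcross hband (i := o.s' + n) (by omega) (by omega)).1
          hmem hk5).1
        omega
      rw [← ih (o.s' + n) rfl (by omega) hk5']
      refine (hstep (o.s' + n) (by omega) (by omega) (fun hmem => hmem.elim hk5' fun hmem => ?_)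
        (fun hmem => hmem.elim hk5 fun hmem => ?_)).symm <;>
      · rw [o.mem_tiles6 hband] at hmem
        omega
  refine matchingOf_congr fun x hx => ?_
  obtain ⟨hx1, hx2⟩ : 1 ≤ x.1 ∧ x.1 ≤ G.d := hx
  by_cases hx5 : x.1 ∈ o.tiles5 f
  · exact heq5 _ hx5
  by_cases hx6 : x.1 ∈ o.tiles6
  · exact heq6 _ hx6
  refine eq_of_state_eq f ?_
  rw [hs.forced _ ⟨hx1, hx2⟩ hx5 hx6]
  rw [o.mem_tiles6 hband] at hx6
  unfold forcedState
  split_ifs with hxt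
  · exact hlow (o.t - x.1) _ (by omega) hx1 hx5
  · exact hhigh (x.1 - o.s') _ (by omega) hx2 hx5

end OppositeOverlap

end SnakeGraph

namespace SnakeGraph

namespace OppositeOverlap

variable {G : SnakeGraph} {o : G.OppositeOverlap}

/-! ### The two maps -/

/-- Switching does not change the set of switching positions, and switching twice at the
same position gives back the matching. -/
theorem Strands.switch_switch {Γ Δ : Gluing} {b : Bool → Side} {m : Bool → TileSide}
    (S : o.Strands Γ b m) (S' : o.Strands Δ (fun c => b (!c)) (fun c => m (!c)))
    (hband : o.t + 1 < o.s') {P : Set (Edge Γ)}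
    (hP : IsPerfectMatching (sideGraph Γ (sidesOf G.tiles)) P) {p : ℕ}
    (hp : p ∈ o.switchPositions Γ Δ P) :
    o.switchPositions Δ Γ (o.switch Γ Δ p P) = o.switchPositions Γ Δ P ∧
      o.switch Δ Γ p (o.switch Γ Δ p P) = P := by
  obtain ⟨h, hv, rfl⟩ := (S.isPerfectMatching_iff P).1 hP
  have S'' : o.Strands Γ (fun c => (fun c => b (!c)) (!c)) (fun c => (fun c => m (!c)) (!c)) := by
    simpa using S
  rw [S.switchPositions_eq S' hband hv] at hp ⊢
  have hpos : ∀ q, o.GoodPos (fun c => m (!c)) (o.swap (p / 2 + 1) h) q ↔ o.GoodPos m h q :=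
    fun q => (goodPos_not m _ q).trans (S.goodPos_swap hband _ h q)
  rw [S.switch_eq S' hband hp]
  constructor
  · rw [S'.switchPositions_eq S'' hband (S.valid_swap S' hband hv hp)]
    exact Set.ext hpos
  · rw [S'.switch_eq S'' hband ((hpos p).2 hp), o.swap_swap hband]

/-- Switching at the first switching position is an involution. -/
theorem Strands.switch_first {Γ Δ : Gluing} {b : Bool → Side} {m : Bool → TileSide}
    (S : o.Strands Γ b m) (S' : o.Strands Δ (fun c => b (!c)) (fun c => m (!c)))
    (hband : o.t + 1 < o.s') {P : Set (Edge Γ)}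
    (hP : IsPerfectMatching (sideGraph Γ (sidesOf G.tiles)) P)
    (hne : (o.switchPositions Γ Δ P).Nonempty) :
    let Q := o.switch Γ Δ (sInf (o.switchPositions Γ Δ P)) P
    IsPerfectMatching (sideGraph Δ (sidesOf G.tiles)) Q ∧
      (o.switchPositions Δ Γ Q).Nonempty ∧
      o.switch Δ Γ (sInf (o.switchPositions Δ Γ Q)) Q = P := by
  have hmem := Nat.sInf_mem hne
  obtain ⟨h1, h2⟩ := S.switch_switch S' hband hP hmem
  intro Q
  refine ⟨hmem.2.2, ?_, ?_⟩
  · rw [h1]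
    exact hne
  · rw [h1]
    exact h2

end OppositeOverlap

end SnakeGraph

end Snake

theorem mainTheorem2 (G : Snake.SnakeGraph) (f : Snake.Edge G.gluing → ℤˣ)
    (hf : G.IsSignFunction f) (o : G.OppositeOverlap) (hcross : o.SelfCrosses f)
    (hband : o.t + 1 < o.s') :
    Set.BijOn (o.phi f) G.Match (o.MatchRes f) ∧
    (∀ P ∈ o.Match34, (o.switchPositions o.gluing34 G.gluing P).Nonempty) ∧
    (∀ P₅ ∈ o.Match5 f, ∀ P₆ ∈ o.Match6, ∃! P, o.IsCompletion f P₅ P₆ P) ∧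
    Set.MapsTo (o.psi f) (o.MatchRes f) G.Match ∧
    Set.InvOn (o.psi f) (o.phi f) G.Match (o.MatchRes f) := by
  have S := o.strands hband
  have S34 := o.strands34 hband
  have S' : o.Strands G.gluing (fun c => (fun c => o.innerSide (!c)) (!c))
      (fun c => (fun c => o.middle (!c)) (!c)) := by simpa using S
  have hne34 : ∀ P ∈ o.Match34, (o.switchPositions o.gluing34 G.gluing P).Nonempty := by
    intro P hP
    obtain ⟨h, hv, rfl⟩ := (o.mem_Match34 hband).1 hP
    rw [S34.switchPositions_eq S' hband hv]
    exact o.exists_goodPos34 hf hcross hband hv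
  -- A matching without a switching position is the completion of its restrictions.
  have hcut : ∀ P ∈ G.Match, ¬ (o.switchPositions G.gluing o.gluing34 P).Nonempty →
      o.restrict5 f P ∈ o.Match5 f ∧ o.restrict6 P ∈ o.Match6 ∧
        o.IsCompletion f (o.restrict5 f P) (o.restrict6 P) P := by
    intro P hP hno
    obtain ⟨h, hv, rfl⟩ := G.mem_Match.1 hP
    rw [S.switchPositions_eq S34 hband hv, Set.not_nonempty_iff_eq_empty,
      Set.eq_empty_iff_forall_notMem] at hno
    have hs := Snake.SnakeGraph.OppositeOverlap.isSplit_of_forall_not_goodPos hf hcross hband hv hno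
    obtain ⟨m5, m6⟩ := hs.mem_Match hf hcross hband (Snake.SnakeGraph.OppositeOverlap.not_both_ends hno)
    rw [hs.restrict5_eq hf hcross hband, hs.restrict6_eq hf hcross hband]
    exact ⟨m5, m6, hs.isCompletion hf hcross hband⟩
  have hglue : ∀ P₅ ∈ o.Match5 f, ∀ P₆ ∈ o.Match6, ∃ P, o.IsCompletion f P₅ P₆ P ∧
      ¬ (o.switchPositions G.gluing o.gluing34 P).Nonempty ∧
      ∀ P', o.IsCompletion f P₅ P₆ P' → P' = P := by
    intro P₅ h5 P₆ h6
    obtain ⟨h, hs, rfl, rfl⟩ := Snake.SnakeGraph.OppositeOverlap.exists_isSplit hf hcross hband h5 h6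
    refine ⟨_, hs.isCompletion hf hcross hband, ?_,
      fun P' hP' => hs.eq_of_isCompletion hf hcross hband hP'⟩
    rw [S.switchPositions_eq S34 hband (hs.valid hf hcross hband), Set.not_nonempty_iff_eq_empty,
      Set.eq_empty_iff_forall_notMem]
    exact hs.not_goodPos hf hcross hband h5.1
  have hpsi : ∀ P₅ ∈ o.Match5 f, ∀ P₆ ∈ o.Match6, ∀ P, o.IsCompletion f P₅ P₆ P →
      o.psi f (Sum.inr (P₅, P₆)) = P := by
    intro P₅ h5 P₆ h6 P hP
    obtain ⟨P', -, -, hu⟩ := hglue P₅ h5 P₆ h6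
    have hex : ∃ P, o.IsCompletion f P₅ P₆ P := ⟨P, hP⟩
    have e : o.psi f (Sum.inr (P₅, P₆)) = hex.choose := dif_pos hex
    rw [e, hu _ hex.choose_spec, hu _ hP]
  have hphi_maps : Set.MapsTo (o.phi f) G.Match (o.MatchRes f) := by
    intro P hP
    unfold Snake.SnakeGraph.OppositeOverlap.phi
    split_ifs with hne
    · exact Or.inl ⟨_, (S.switch_first S34 hband hP hne).1, rfl⟩
    · obtain ⟨h5, h6, -⟩ := hcut P hP hne
      exact Or.inr ⟨_, ⟨h5, h6⟩, rfl⟩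
  have hpsi_maps : Set.MapsTo (o.psi f) (o.MatchRes f) G.Match := by
    rintro _ (⟨P, hP, rfl⟩ | ⟨⟨P₅, P₆⟩, ⟨h5, h6⟩, rfl⟩)
    · exact (S34.switch_first S' hband hP (hne34 P hP)).1
    · obtain ⟨P, hP, -, -⟩ := hglue P₅ h5 P₆ h6
      rw [hpsi P₅ h5 P₆ h6 P hP]
      exact hP.1
  have hinv : Set.InvOn (o.psi f) (o.phi f) G.Match (o.MatchRes f) := by
    constructor
    · intro P hP
      unfold Snake.SnakeGraph.OppositeOverlap.phi
      split_ifs with hne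
      · exact (S.switch_first S34 hband hP hne).2.2
      · obtain ⟨h5, h6, hc⟩ := hcut P hP hne
        exact hpsi _ h5 _ h6 P hc
    · rintro _ (⟨P, hP, rfl⟩ | ⟨⟨P₅, P₆⟩, ⟨h5, h6⟩, rfl⟩)
      · obtain ⟨-, hne, e⟩ := S34.switch_first S' hband hP (hne34 P hP)
        unfold Snake.SnakeGraph.OppositeOverlap.phi Snake.SnakeGraph.OppositeOverlap.psi
        rw [if_pos hne, e]
      · obtain ⟨P, hP, hno, -⟩ := hglue P₅ h5 P₆ h6
        rw [hpsi P₅ h5 P₆ h6 P hP]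
        unfold Snake.SnakeGraph.OppositeOverlap.phi
        rw [if_neg hno, hP.2.1, hP.2.2.1]
  refine ⟨hinv.bijOn hphi_maps hpsi_maps, hne34, fun P₅ h5 P₆ h6 => ?_, hpsi_maps, hinv⟩
  obtain ⟨P, hP, -, hu⟩ := hglue P₅ h5 P₆ h6
  exact ⟨P, hP, hu⟩
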